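/- Let $G=\{G(x),x\in\mathbb R\}$ be a (jointly measurable) mean zero Gaussian process with stationary increments, $\sigma^2(x-y)=E(G(x)-G(y))^2$ with $\sigma^2\not\equiv0$, and put $$\rho_h(x-y)=\frac{1}{\sigma^2(h)}E\big[(G(x+h)-G(x))(G(y+h)-G(y))\big].$$ Fix $-\infty<a<b<\infty$, let $\mu$ be the standard Gaussian measure on $\mathbb R$, $\eta\sim N(0,1)$, and let $H_m$, $m\ge0$, be the Hermite polynomials normalized to be orthonormal in $L^2(\mu)$. Let $f\in L^2(\mu)$ be symmetric (even), $a_{2m}=\int fH_{2m}\,d\mu$, suppose that $a_{2m}\neq0$ for some $m\ge1$, and let $k_0=\min\{m\ge1: a_{2m}\ne0\}$. Put $$I_G(f,h;a,b)=\int_a^b f\Big(\frac{G(x+h)-G(x)}{\sigma(h)}\Big)\,dx .$$ Suppose that $$\lim_{h\downarrow0}\frac{\int_a^b\!\int_a^b|\rho_h(x-y)|^{2k_0+2}\,dx\,dy}{\int_a^b\!\int_a^b|\rho_h(x-y)|^{2k_0}\,dx\,dy}=0 .$$ Then, as $h\downarrow0$, $$\operatorname{Var} I_G(f,h;a,b)\sim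 a_{2k_0}^2\int_a^b\!\int_a^b|\rho_h(x-y)|^{2k_0}\,dx\,dy$$ (the ratio of the two sides tends to $1$). If, moreover, there is a constant $C$ such that for all sufficiently small $h>0$ $$\sup_{a\le x\le b}\int_a^b|\rho_h(x-y)|^{2k_0}\,dy\le C\int_a^b\!\int_a^b|\rho_h(x-y)|^{2k_0}\,dx\,dy,$$ and for all integers $1\le j<2k_0$, as $h\downarrow0$, $$\sup_{a\le x\le b}\Big(\int_a^b|\rho_h(x-y)|^{j}\,dy\Big)^{1/j}=o\Big(\Big(\int_a^b\!\int_a^b|\rho_h(x-y)|^{2k_0}\,dx\,dy\Big)^{1/(2k_0)}\Big),$$ then $$\frac{I_G(f,h;a,b)-(b-a)Ef(\eta)}{\sqrt{\operatorname{Var} I_G(f,h;a,b)}}\longrightarrow N(0,1)\quad\text{in law as }h\downarrow0 .$$ -/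

import Mathlib

open MeasureTheory ProbabilityTheory Filter Set
open scoped Topology

noncomputable section

namespace GaussianIncrements

/-- The normalized Hermite polynomials `H_m = He_m / √(m!)` (`He_m` the probabilists' ones); they
form an orthonormal basis of `L²` of the standard Gaussian measure. -/
def normHermite (m : ℕ) (x : ℝ) : ℝ :=
  Polynomial.aeval x (Polynomial.hermite m) / √(m.factorial : ℝ)

/-- The Hermite coefficient `a_m = ∫ f H_m dμ`, with `μ` the standard Gaussian measure on `ℝ`. -/
def hermiteCoeff (f : ℝ → ℝ) (m : ℕ) : ℝ :=
  ∫ x, f x * normHermite m x ∂(gaussianReal 0 1)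

variable {Ω : Type*} [MeasurableSpace Ω]

/-- Stationary increments: the law of the process `x ↦ G (x + t) - G t` does not depend on `t`. -/
def HasStationaryIncrements (G : ℝ → Ω → ℝ) (P : Measure Ω) : Prop :=
  ∀ t : ℝ, P.map (fun ω (x : ℝ) => G (x + t) ω - G t ω) = P.map (fun ω (x : ℝ) => G x ω - G 0 ω)

/-- The increments variance `σ²(h) = E (G(h) - G(0))²`. For a process with stationary increments,
`E (G(x) - G(y))² = σ²(x - y)`. -/
def incVar (G : ℝ → Ω → ℝ) (P : Measure Ω) (h : ℝ) : ℝ :=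
  ∫ ω, (G h ω - G 0 ω) ^ 2 ∂P

/-- `ρ_h(x, y) = σ(h)⁻² E (G(x+h) - G(x)) (G(y+h) - G(y))`. -/
def rho (G : ℝ → Ω → ℝ) (P : Measure Ω) (h x y : ℝ) : ℝ :=
  (∫ ω, (G (x + h) ω - G x ω) * (G (y + h) ω - G y ω) ∂P) / incVar G P h

/-- `∫_a^b ∫_a^b |ρ_h(x, y)|^n dx dy`. -/
def rhoInt (G : ℝ → Ω → ℝ) (P : Measure Ω) (a b : ℝ) (n : ℕ) (h : ℝ) : ℝ :=
  ∫ x in a..b, ∫ y in a..b, |rho G P h x y| ^ n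

/-- The functional `I_G(f, h; a, b) = ∫_a^b f ((G(x+h) - G(x)) / σ(h)) dx`. -/
def incFunctional (G : ℝ → Ω → ℝ) (P : Measure Ω) (f : ℝ → ℝ) (a b h : ℝ) (ω : Ω) : ℝ :=
  ∫ x in a..b, f ((G (x + h) ω - G x ω) / √(incVar G P h))

end GaussianIncrements

end

set_option linter.unusedSectionVars false

namespace GaussianIncrements

/-! For a fixed lag the normalized increments form a process of standard Gaussian variables with
correlation `rho`, written `r` below. Mehler's formula (`IsStdGaussian.hasSum_hermiteCoeff_sq_mul`)
turns `E f(X_x) f(X_y)` into the power series of the correlation `r(x, y)` with coefficients `a_n²`.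
The constant term accounts for the mean, evenness of `f` removes the odd terms, and the first
surviving term has degree `2 k₀`. As `|r| ≤ 1`, all later terms together are at most a constant
times `|r| ^ (2 k₀ + 2)`. After integration the variance is `a² V + O(W)`, where `V` and `W` are the
double integrals of `|r|` to the powers `2 k₀` and `2 k₀ + 2`; the hypothesis is `W = o(V)`.

The same estimate shows that the centred functional differs from its Hermite term of degree `2 k₀`
by `o(√V)`, so the limit law is decided inside one chaos. There Stein's method applies to
characteristic functions. For a finite sum `F` of `H_{p+1}(ξ_i)`, Gaussian integration by parts
gives `E F e^{itF} = i t E T e^{itF}`, with a random factor `T` of mean `Var F`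
(`IsStdGaussian.integral_chaosSum_mul_cexp`). Hence `ψ(t) = E e^{itF}` almost solves `ψ' = -t V ψ`,
now with `V = Var F` and with an error governed by the standard deviation of `T`
(`norm_sub_exp_le_of_hasDerivAt`).

The second moment of `T` is a sum of fourfold Hermite moments, that is, of diagrams on four vertices
`a, b, c, d`. Diagrams whose edges join only `a` with `b` and `c` with `d` sum to exactly `(E T)²`.
The others contain crossing edges (`exists_abs_hermiteMoment_sub_le`) and reduce to four-cycles,
which `sum_cycle_le` bounds by the variance times products `U_q U_{p+1-q}`, where `U_q` bounds the
integrals of `|r| ^ q` in one variable. If `U_q = (ε V^{1/(2k₀)})^q` with `p + 1 = 2 k₀`, each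
product is `ε^{2k₀} V`, so `Var T` is of order `ε^{2k₀} V²`.

Riemann sums carry the finite result over to integrals. This requires continuity of the correlation,
which joint measurability of `G` supplies (`IsStationaryGaussian.tendsto_incVar_zero`). -/

/-! ### Hermite polynomials and Gaussian integration by parts -/

/-- The probabilists' Hermite polynomial as a real function. -/
noncomputable def He (n : ℕ) (x : ℝ) : ℝ := Polynomial.aeval x (Polynomial.hermite n)

theorem He_zero (x : ℝ) : He 0 x = 1 := by simp [He]

/-- Differentiating the defining recursion `He_{n+1} = X He_n - He_n'` and inserting the induction
hypothesis reproduces the recursion itself. -/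
theorem derivative_hermite_succ (n : ℕ) :
    Polynomial.derivative (Polynomial.hermite (n + 1)) =
      ((n + 1 : ℕ) : Polynomial ℤ) * Polynomial.hermite n := by
  induction n with
  | zero => simp
  | succ n ih =>
    rw [Polynomial.hermite_succ (n + 1), Polynomial.derivative_sub, Polynomial.derivative_mul, ih,
      Polynomial.derivative_natCast_mul, Polynomial.derivative_X, one_mul]
    have h := Polynomial.hermite_succ n
    push_cast
    linear_combination (-(n + 1 : Polynomial ℤ)) * h

theorem hasDerivAt_He_succ (n : ℕ) (x : ℝ) :
    HasDerivAt (He (n + 1)) ((n + 1 : ℕ) * He n x) x := by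
  have h := (Polynomial.hermite (n + 1)).hasDerivAt_aeval x
  rw [derivative_hermite_succ, map_mul, map_natCast] at h
  exact h

theorem hasDerivAt_He (n : ℕ) (x : ℝ) : HasDerivAt (He n) (n * He (n - 1) x) x := by
  cases n with
  | zero =>
    have : He 0 = fun _ => 1 := funext He_zero
    simpa [this] using hasDerivAt_const x (1 : ℝ)
  | succ n => simpa using hasDerivAt_He_succ n x

/-- The derivative in the defining recursion is replaced by its value. For `n = 0` the factor `n`
makes the truncated index `n - 1` harmless. -/
theorem He_succ (n : ℕ) (x : ℝ) : He (n + 1) x = x * He n x - n * He (n - 1) x := by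
  have h : Polynomial.aeval x (Polynomial.derivative (Polynomial.hermite n)) = n * He (n - 1) x :=
    ((Polynomial.hermite n).hasDerivAt_aeval x).unique (hasDerivAt_He n x)
  rw [He, Polynomial.hermite_succ, map_sub, map_mul, Polynomial.aeval_X, h, ← He]

@[fun_prop]
theorem continuous_He (n : ℕ) : Continuous (He n) := (Polynomial.hermite n).continuous_aeval

@[fun_prop]
theorem measurable_He (n : ℕ) : Measurable (He n) := (continuous_He n).measurable

theorem hasDerivAt_gaussianPDFReal (x : ℝ) :
    HasDerivAt (gaussianPDFReal 0 1) (-x * gaussianPDFReal 0 1 x) x := by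
  have h : HasDerivAt (fun y : ℝ => (√(2 * Real.pi * (1 : NNReal)))⁻¹ *
      Real.exp (-(y - 0) ^ 2 / (2 * (1 : NNReal)))) ((√(2 * Real.pi * (1 : NNReal)))⁻¹ *
      (Real.exp (-(x - 0) ^ 2 / (2 * (1 : NNReal))) * (-x))) x := by
    refine (HasDerivAt.exp ?_).const_mul _
    have := (((hasDerivAt_id x).sub_const 0).pow 2).neg.div_const (2 * ((1 : NNReal) : ℝ))
    convert! this using 1
    simp
    ring
  rw [gaussianPDFReal_def]
  convert! h using 1
  simp
  ring

section IntegrationByParts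

variable {E : Type*} [NormedAddCommGroup E] [NormedSpace ℝ E]

theorem integrable_gaussian_iff {g : ℝ → E} :
    Integrable g (gaussianReal 0 1) ↔ Integrable fun x => gaussianPDFReal 0 1 x • g x := by
  rw [gaussianReal_of_var_ne_zero 0 one_ne_zero]
  rw [integrable_withDensity_iff_integrable_smul' (measurable_gaussianPDF 0 1)
    (by simp [gaussianPDF_lt_top])]
  simp

/-- Gaussian integration by parts. -/
theorem integral_gaussian_smul_self {φ φ' : ℝ → E} (hd : ∀ x, HasDerivAt φ (φ' x) x)
    (h0 : Integrable φ (gaussianReal 0 1)) (h1 : Integrable (fun x => x • φ x) (gaussianReal 0 1))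
    (h2 : Integrable φ' (gaussianReal 0 1)) :
    ∫ x, x • φ x ∂(gaussianReal 0 1) = ∫ x, φ' x ∂(gaussianReal 0 1) := by
  rw [← sub_eq_zero, ← integral_sub h1 h2, integral_gaussianReal_eq_integral_smul one_ne_zero]
  rw [← neg_eq_zero, ← integral_neg]
  refine integral_eq_zero_of_hasDerivAt_of_integrable
    (f := fun x => gaussianPDFReal 0 1 x • φ x) (fun x => ?_) ?_ (integrable_gaussian_iff.1 h0)
  · have := (hasDerivAt_gaussianPDFReal x).smul (hd x)
    convert! this using 1
    module
  · exact (integrable_gaussian_iff.1 (h1.sub h2)).neg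

/-- Since `He_{n+1} = x He_n - He_n'`, integrating `x He_n φ` by parts cancels the derivative of
`He_n`: one Hermite degree is traded for one derivative of `φ` alone. -/
theorem integral_He_succ_smul {φ φ' : ℝ → E} (n : ℕ) (hd : ∀ x, HasDerivAt φ (φ' x) x)
    (h0 : Integrable (fun x => He n x • φ x) (gaussianReal 0 1))
    (h1 : Integrable (fun x => (x * He n x) • φ x) (gaussianReal 0 1))
    (h2 : Integrable (fun x => (n * He (n - 1) x) • φ x) (gaussianReal 0 1))
    (h3 : Integrable (fun x => He n x • φ' x) (gaussianReal 0 1)) :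
    ∫ x, He (n + 1) x • φ x ∂(gaussianReal 0 1) = ∫ x, He n x • φ' x ∂(gaussianReal 0 1) := by
  have key := integral_gaussian_smul_self (φ := fun x => He n x • φ x)
    (fun x => (hasDerivAt_He n x).smul (hd x)) h0 (by simpa only [smul_smul] using h1) (h3.add h2)
  rw [integral_add h3 h2] at key
  rw [← sub_eq_iff_eq_add] at key
  rw [← key]
  simp only [smul_smul]
  rw [← integral_sub h1 h2]
  simp_rw [He_succ, sub_smul]

/-- Integration by parts in a standard Gaussian variable `Z`, independent of `R`. -/
theorem integral_He_succ_smul_indep {Ω S : Type*} [MeasurableSpace Ω] [MeasurableSpace S]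
    {P : Measure Ω} [IsProbabilityMeasure P] {Z : Ω → ℝ} {R : Ω → S}
    (hZ : AEMeasurable Z P) (hR : AEMeasurable R P) (hlaw : P.map Z = gaussianReal 0 1)
    (hind : IndepFun Z R P) {Φ Φ' : ℝ → S → E}
    (hΦ : StronglyMeasurable (Function.uncurry Φ)) (hΦ' : StronglyMeasurable (Function.uncurry Φ'))
    (hd : ∀ s x, HasDerivAt (fun x => Φ x s) (Φ' x s) x) (n : ℕ)
    (h0 : Integrable (fun ω => He n (Z ω) • Φ (Z ω) (R ω)) P)
    (h1 : Integrable (fun ω => (Z ω * He n (Z ω)) • Φ (Z ω) (R ω)) P)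
    (h2 : Integrable (fun ω => (n * He (n - 1) (Z ω)) • Φ (Z ω) (R ω)) P)
    (h3 : Integrable (fun ω => He n (Z ω) • Φ' (Z ω) (R ω)) P) :
    ∫ ω, He (n + 1) (Z ω) • Φ (Z ω) (R ω) ∂P = ∫ ω, He n (Z ω) • Φ' (Z ω) (R ω) ∂P := by
  -- Independence makes the joint law a product, so `Z` can be integrated first and the
  -- one-dimensional formula used for almost every value of `R`.
  have hmap : P.map (fun ω => (Z ω, R ω)) = (gaussianReal 0 1).prod (P.map R) := by
    rw [(indepFun_iff_map_prod_eq_prod_map_map hZ hR).1 hind, hlaw]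
  have hZR : AEMeasurable (fun ω => (Z ω, R ω)) P := hZ.prodMk hR
  have : IsProbabilityMeasure (P.map R) := Measure.isProbabilityMeasure_map hR
  have tr : ∀ (c : ℝ → ℝ) (Ψ : ℝ → S → E), Measurable c → StronglyMeasurable (Function.uncurry Ψ) →
      (Integrable (fun ω => c (Z ω) • Ψ (Z ω) (R ω)) P →
        Integrable (fun p : ℝ × S => c p.1 • Ψ p.1 p.2) ((gaussianReal 0 1).prod (P.map R))) ∧
      ∫ ω, c (Z ω) • Ψ (Z ω) (R ω) ∂P =
        ∫ p, c p.1 • Ψ p.1 p.2 ∂((gaussianReal 0 1).prod (P.map R)) := by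
    intro c Ψ hc hΨ
    have hm : StronglyMeasurable (fun p : ℝ × S => c p.1 • Ψ p.1 p.2) :=
      (hc.comp measurable_fst).stronglyMeasurable.smul hΨ
    rw [← hmap]
    refine ⟨fun h => ?_, ?_⟩
    · exact (integrable_map_measure hm.aestronglyMeasurable hZR).2 h
    · rw [integral_map hZR hm.aestronglyMeasurable]
  have i0 := (tr (He n) Φ (by fun_prop) hΦ).1 h0
  have i1 := (tr (fun x => x * He n x) Φ (by fun_prop) hΦ).1 h1
  have i2 := (tr (fun x => n * He (n - 1) x) Φ (by fun_prop) hΦ).1 h2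
  have i3 := (tr (He n) Φ' (by fun_prop) hΦ').1 h3
  have i4 : Integrable (fun p : ℝ × S => He (n + 1) p.1 • Φ p.1 p.2)
      ((gaussianReal 0 1).prod (P.map R)) := by
    refine (i1.sub i2).congr (ae_of_all _ fun p => ?_)
    simp [He_succ, sub_smul]
  rw [(tr (He (n + 1)) Φ (by fun_prop) hΦ).2, (tr (He n) Φ' (by fun_prop) hΦ').2,
    integral_prod_symm _ i4, integral_prod_symm _ i3]
  refine integral_congr_ae ?_
  filter_upwards [i0.prod_left_ae, i1.prod_left_ae, i2.prod_left_ae, i3.prod_left_ae]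
    with s s0 s1 s2 s3
  exact integral_He_succ_smul n (hd s) s0 s1 s2 s3

end IntegrationByParts

/-! ### Random variables with moments of all orders -/

section AllMoments

variable {Ω : Type*} [MeasurableSpace Ω] {P : Measure Ω} {𝕜 : Type*} [RCLike 𝕜]

/-- `f` belongs to `L^p` for every finite `p`. -/
def HasAllMoments (f : Ω → 𝕜) (P : Measure Ω) : Prop := ∀ p : ENNReal, p ≠ ⊤ → MemLp f p P

/-- Hölder with both exponents `2p`. Closure under products lets integrability of polynomials in
Gaussian variables be read off from the factors. -/
theorem HasAllMoments.mul {f g : Ω → 𝕜} (hf : HasAllMoments f P) (hg : HasAllMoments g P) :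
    HasAllMoments (fun ω => f ω * g ω) P := by
  intro p hp
  have : ENNReal.HolderTriple (2 * p) (2 * p) p := ⟨by
    rw [ENNReal.mul_inv (by simp) (by simp), ← add_mul, ENNReal.inv_two_add_inv_two, one_mul]⟩
  exact (hg (2 * p) (ENNReal.mul_ne_top (by simp) hp)).mul'
    (hf (2 * p) (ENNReal.mul_ne_top (by simp) hp))

theorem HasAllMoments.add {f g : Ω → 𝕜} (hf : HasAllMoments f P) (hg : HasAllMoments g P) :
    HasAllMoments (fun ω => f ω + g ω) P := fun p hp => (hf p hp).add (hg p hp)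

theorem HasAllMoments.sub {f g : Ω → 𝕜} (hf : HasAllMoments f P) (hg : HasAllMoments g P) :
    HasAllMoments (fun ω => f ω - g ω) P := fun p hp => (hf p hp).sub (hg p hp)

theorem HasAllMoments.const_mul {f : Ω → 𝕜} (hf : HasAllMoments f P) (c : 𝕜) :
    HasAllMoments (fun ω => c * f ω) P := fun p hp => (hf p hp).const_mul c

theorem HasAllMoments.sum {ι : Type*} (s : Finset ι) {f : ι → Ω → 𝕜}
    (hf : ∀ i ∈ s, HasAllMoments (f i) P) : HasAllMoments (fun ω => ∑ i ∈ s, f i ω) P :=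
  fun p hp => memLp_finsetSum s fun i hi => hf i hi p hp

theorem hasAllMoments_const [IsFiniteMeasure P] (c : 𝕜) : HasAllMoments (fun _ : Ω => c) P :=
  fun _ _ => memLp_const c

theorem HasAllMoments.prod [IsFiniteMeasure P] {ι : Type*} (s : Finset ι) {f : ι → Ω → 𝕜}
    (hf : ∀ i ∈ s, HasAllMoments (f i) P) : HasAllMoments (fun ω => ∏ i ∈ s, f i ω) P := by
  classical
  induction s using Finset.induction_on with
  | empty => simpa using hasAllMoments_const (P := P) (1 : 𝕜)
  | insert a s ha ih =>
    simp only [Finset.prod_insert ha]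
    exact (hf a (by simp)).mul (ih fun i hi => hf i (by simp [hi]))

theorem HasAllMoments.memLp_two {f : Ω → 𝕜} (hf : HasAllMoments f P) : MemLp f 2 P :=
  hf 2 (by simp)

theorem HasAllMoments.integrable {f : Ω → 𝕜} (hf : HasAllMoments f P) : Integrable f P :=
  memLp_one_iff_integrable.1 (hf 1 (by simp))

theorem HasAllMoments.ofReal {f : Ω → ℝ} (hf : HasAllMoments f P) :
    HasAllMoments (fun ω => (f ω : 𝕜)) P := fun p hp => (hf p hp).ofReal

end AllMoments

/-! ### Standardized Gaussian processes -/

/-- A centred Gaussian process all of whose values have variance one. -/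
structure IsStdGaussian {T Ω : Type*} [MeasurableSpace Ω] (X : T → Ω → ℝ) (P : Measure Ω) :
    Prop where
  gaussian : IsGaussianProcess X P
  mean : ∀ t, ∫ ω, X t ω ∂P = 0
  second : ∀ t, ∫ ω, X t ω ^ 2 ∂P = 1

/-- The correlation of the variables `X s` and `X t` of a standardized process. -/
noncomputable def corr {T Ω : Type*} [MeasurableSpace Ω] (X : T → Ω → ℝ) (P : Measure Ω) (s t : T) :
    ℝ :=
  ∫ ω, X s ω * X t ω ∂P

namespace IsStdGaussian

variable {T Ω : Type*} [MeasurableSpace Ω] {P : Measure Ω} [IsProbabilityMeasure P]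
  {X : T → Ω → ℝ}

theorem comp (hX : IsStdGaussian X P) {ι : Type*} (τ : ι → T) :
    IsStdGaussian (fun i => X (τ i)) P where
  gaussian := hX.gaussian.comp_right τ
  mean i := hX.mean (τ i)
  second i := hX.second (τ i)

theorem aemeasurable (hX : IsStdGaussian X P) (t : T) : AEMeasurable (X t) P :=
  hX.gaussian.aemeasurable t

theorem memLp_two (hX : IsStdGaussian X P) (t : T) : MemLp (X t) 2 P :=
  (hX.gaussian.hasGaussianLaw_eval t).memLp_two

theorem map_eq (hX : IsStdGaussian X P) (t : T) : P.map (X t) = gaussianReal 0 1 := by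
  rw [(hX.gaussian.hasGaussianLaw_eval t).map_eq_gaussianReal, hX.mean,
    variance_of_integral_eq_zero (hX.aemeasurable t) (hX.mean t), hX.second]
  simp

theorem hasAllMoments (hX : IsStdGaussian X P) (t : T) : HasAllMoments (X t) P :=
  fun _ hp => (hX.gaussian.hasGaussianLaw_eval t).memLp hp

theorem hasAllMoments_He (hX : IsStdGaussian X P) (n : ℕ) (t : T) :
    HasAllMoments (fun ω => He n (X t ω)) P := by
  induction n using Nat.strong_induction_on with
  | _ n ih =>
    cases n with
    | zero => simpa only [He_zero] using hasAllMoments_const (P := P) (1 : ℝ)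
    | succ n =>
      simp only [He_succ]
      exact ((hX.hasAllMoments t).mul (ih n (by omega))).sub ((ih (n - 1) (by omega)).const_mul _)

theorem corr_self (hX : IsStdGaussian X P) (t : T) : corr X P t t = 1 := by
  simp only [corr, ← pow_two, hX.second]

omit [IsProbabilityMeasure P] in
theorem corr_comm (s t : T) : corr X P s t = corr X P t s := by simp only [corr, mul_comm]

theorem cov_eq_corr (hX : IsStdGaussian X P) (s t : T) : cov[X s, X t; P] = corr X P s t := by
  rw [covariance_eq_sub (hX.memLp_two s) (hX.memLp_two t), hX.mean, hX.mean]
  simp [corr]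

/-- Both `E (X_s + X_t)²` and `E (X_s - X_t)²` are nonnegative. -/
theorem abs_corr_le_one (hX : IsStdGaussian X P) (s t : T) : |corr X P s t| ≤ 1 := by
  have i1 := (hX.memLp_two s).integrable_sq
  have i2 := (hX.memLp_two t).integrable_sq
  have i3 : Integrable (fun ω => X s ω * X t ω) P := (hX.memLp_two s).integrable_mul (hX.memLp_two t)
  have h1 : 0 ≤ ∫ ω, (X s ω + X t ω) ^ 2 ∂P := integral_nonneg fun _ => sq_nonneg _
  have h2 : 0 ≤ ∫ ω, (X s ω - X t ω) ^ 2 ∂P := integral_nonneg fun _ => sq_nonneg _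
  have e1 : ∫ ω, (X s ω + X t ω) ^ 2 ∂P = 1 + 2 * corr X P s t + 1 := by
    simp only [add_sq, mul_assoc]
    rw [integral_add (f := fun ω => X s ω ^ 2 + 2 * (X s ω * X t ω)) (i1.add (i3.const_mul 2)) i2,
      integral_add i1 (i3.const_mul 2),
      integral_const_mul, hX.second, hX.second, corr]
  have e2 : ∫ ω, (X s ω - X t ω) ^ 2 ∂P = 1 - 2 * corr X P s t + 1 := by
    simp only [sub_sq, mul_assoc]
    rw [integral_add (f := fun ω => X s ω ^ 2 - 2 * (X s ω * X t ω)) (i1.sub (i3.const_mul 2)) i2,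
      integral_sub i1 (i3.const_mul 2),
      integral_const_mul, hX.second, hX.second, corr]
  rw [abs_le]
  constructor <;> linarith

theorem hasGaussianLaw_pi {ι : Type*} [Fintype ι] {ξ : ι → Ω → ℝ} (hξ : IsStdGaussian ξ P) :
    HasGaussianLaw (fun ω i => ξ i ω) P :=
  (hξ.gaussian.hasGaussianLaw Finset.univ).map_fun
    (ContinuousLinearMap.pi fun i : ι =>
      ContinuousLinearMap.proj (R := ℝ) (φ := fun _ : (Finset.univ : Finset ι) => ℝ)
        ⟨i, Finset.mem_univ i⟩)

/-- The residuals of the regression on `ξ i` are jointly Gaussian with `ξ i` and uncorrelated with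
it, hence independent. The one-point index `Unit` presents `ξ i` as a family, so that the covariance
criterion for two families applies. -/
theorem indepFun_residual {ι : Type*} [Fintype ι] {ξ : ι → Ω → ℝ} (hξ : IsStdGaussian ξ P)
    (i : ι) : IndepFun (ξ i) (fun ω j => ξ j ω - corr ξ P i j * ξ i ω) P := by
  have hg : HasGaussianLaw (fun ω => ((fun _ : Unit => ξ i ω),
      (fun j => ξ j ω - corr ξ P i j * ξ i ω))) P := by
    have := hξ.hasGaussianLaw_pi.map_fun
      ((ContinuousLinearMap.pi fun _ : Unit =>
        ContinuousLinearMap.proj (R := ℝ) (φ := fun _ : ι => ℝ) i).prod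
        (ContinuousLinearMap.pi fun j => ContinuousLinearMap.proj (R := ℝ) (φ := fun _ : ι => ℝ) j
          - corr ξ P i j • ContinuousLinearMap.proj (R := ℝ) (φ := fun _ : ι => ℝ) i))
    exact this
  have h := hg.indepFun_of_covariance_eval (X := fun _ : Unit => ξ i)
    (Y := fun j ω => ξ j ω - corr ξ P i j * ξ i ω) (fun _ j => by
      rw [covariance_fun_sub_right (hξ.memLp_two i) (hξ.memLp_two j)
        ((hξ.memLp_two i).const_mul _), covariance_const_mul_right, hξ.cov_eq_corr,
        hξ.cov_eq_corr, hξ.corr_self]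
      ring)
  exact h.comp (φ := fun x : Unit → ℝ => x ()) (ψ := id) (measurable_pi_apply ()) measurable_id

/-- Integration by parts for functions of a finite Gaussian family. -/
theorem integral_He_succ_smul {ι : Type*} [Fintype ι] {ξ : ι → Ω → ℝ} (hξ : IsStdGaussian ξ P)
    {𝕜 : Type*} [RCLike 𝕜] (i : ι) (n : ℕ) {Φ Φ' : (ι → ℝ) → 𝕜} (hΦ : Continuous Φ)
    (hΦ' : Continuous Φ')
    (hd : ∀ v, HasDerivAt (fun s : ℝ => Φ (fun j => v j + s * corr ξ P i j)) (Φ' v) 0)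
    (h2 : MemLp (fun ω => Φ (fun j => ξ j ω)) 2 P)
    (h2' : MemLp (fun ω => Φ' (fun j => ξ j ω)) 2 P) :
    ∫ ω, (He (n + 1) (ξ i ω) : 𝕜) * Φ (fun j => ξ j ω) ∂P =
      ∫ ω, (He n (ξ i ω) : 𝕜) * Φ' (fun j => ξ j ω) ∂P := by
  -- Residual plus regression restores `ξ j`, so `Φ` becomes a function of `ξ i` and of a vector
  -- independent of it.
  have hcomb : ∀ ω, (fun j => ξ j ω - corr ξ P i j * ξ i ω + ξ i ω * corr ξ P i j) =
      fun j => ξ j ω := fun ω => by ext j; ring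
  have hint : ∀ {c : Ω → ℝ} {Ψ : Ω → 𝕜}, HasAllMoments c P → MemLp Ψ 2 P →
      Integrable (fun ω => c ω • Ψ ω) P := by
    intro c Ψ hc hΨ
    simp only [RCLike.real_smul_eq_coe_mul]
    exact MemLp.integrable_mul (hc.ofReal (𝕜 := 𝕜)).memLp_two hΨ
  have hR : AEMeasurable (fun ω j => ξ j ω - corr ξ P i j * ξ i ω) P :=
    aemeasurable_pi_lambda _ fun j =>
      (hξ.aemeasurable j).sub ((hξ.aemeasurable i).const_mul _)
  have key := integral_He_succ_smul_indep (P := P) (Z := ξ i)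
    (R := fun ω j => ξ j ω - corr ξ P i j * ξ i ω) (hξ.aemeasurable i) hR (hξ.map_eq i)
    (hξ.indepFun_residual i) (Φ := fun x s => Φ (fun j => s j + x * corr ξ P i j))
    (Φ' := fun x s => Φ' (fun j => s j + x * corr ξ P i j))
    (by
      refine Continuous.stronglyMeasurable (hΦ.comp (by fun_prop)))
    (by
      refine Continuous.stronglyMeasurable (hΦ'.comp (by fun_prop)))
    (fun s x => by
      -- The derivative is given only at `0`, but at every base point; moving the base point along
      -- the line yields it at `x`.
      have h := hd (fun j => s j + x * corr ξ P i j)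
      rw [← sub_self x] at h
      have := h.comp_sub_const x x
      convert! this using 1
      ext t
      congr 1
      ext j
      ring) n
    (by simpa only [hcomb] using hint (hξ.hasAllMoments_He n i) h2)
    (by simpa only [hcomb] using hint ((hξ.hasAllMoments i).mul (hξ.hasAllMoments_He n i)) h2)
    (by simpa only [hcomb] using hint ((hξ.hasAllMoments_He (n - 1) i).const_mul n) h2)
    (by simpa only [hcomb] using hint (hξ.hasAllMoments_He n i) h2')
  simpa only [hcomb, RCLike.real_smul_eq_coe_mul] using key

end IsStdGaussian

/-! ### Moments of products of Hermite polynomials -/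

section HermiteMoments

variable {T Ω : Type*} [MeasurableSpace Ω]

/-- The mixed moment of four Hermite polynomials. -/
noncomputable def hermiteMoment (X : T → Ω → ℝ) (P : Measure Ω) (a b c d : T) (k l m n : ℕ) : ℝ :=
  ∫ ω, He k (X a ω) * He l (X b ω) * He m (X c ω) * He n (X d ω) ∂P

variable {P : Measure Ω} {X : T → Ω → ℝ}

theorem hermiteMoment_swap12 (a b c d : T) (k l m n : ℕ) :
    hermiteMoment X P a b c d k l m n = hermiteMoment X P b a c d l k m n := by
  unfold hermiteMoment; congr 1; ext ω; ring

theorem hermiteMoment_swap13 (a b c d : T) (k l m n : ℕ) :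
    hermiteMoment X P a b c d k l m n = hermiteMoment X P c b a d m l k n := by
  unfold hermiteMoment; congr 1; ext ω; ring

theorem hermiteMoment_swap14 (a b c d : T) (k l m n : ℕ) :
    hermiteMoment X P a b c d k l m n = hermiteMoment X P d b c a n l m k := by
  unfold hermiteMoment; congr 1; ext ω; ring

variable [IsProbabilityMeasure P]

theorem IsStdGaussian.hermiteMoment_zero (a b c d : T) : hermiteMoment X P a b c d 0 0 0 0 = 1 := by
  simp [hermiteMoment, He_zero]

theorem IsStdGaussian.hasAllMoments_He_mul (hX : IsStdGaussian X P) (a b c d : T) (k l m n : ℕ) :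
    HasAllMoments (fun ω => He k (X a ω) * He l (X b ω) * He m (X c ω) * He n (X d ω)) P :=
  (((hX.hasAllMoments_He k a).mul (hX.hasAllMoments_He l b)).mul (hX.hasAllMoments_He m c)).mul
    (hX.hasAllMoments_He n d)

theorem IsStdGaussian.hasAllMoments_He_mul₃ (hX : IsStdGaussian X P) (b c d : T) (l m n : ℕ) :
    HasAllMoments (fun ω => He l (X b ω) * He m (X c ω) * He n (X d ω)) P :=
  ((hX.hasAllMoments_He l b).mul (hX.hasAllMoments_He m c)).mul (hX.hasAllMoments_He n d)

/-- Wick's recursion: one half-edge at `a` is joined to `b`, `c` or `d`. Integration by parts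
against `He` produces no edge from `a` to itself. -/
theorem IsStdGaussian.hermiteMoment_succ (hX : IsStdGaussian X P) (a b c d : T) (k l m n : ℕ) :
    hermiteMoment X P a b c d (k + 1) l m n =
      l * corr X P a b * hermiteMoment X P a b c d k (l - 1) m n +
      m * corr X P a c * hermiteMoment X P a b c d k l (m - 1) n +
      n * corr X P a d * hermiteMoment X P a b c d k l m (n - 1) := by
  have hξ := hX.comp ![a, b, c, d]
  have key := hξ.integral_He_succ_smul (𝕜 := ℝ) 0 k
    (Φ := fun v => He l (v 1) * He m (v 2) * He n (v 3))
    (Φ' := fun v => l * corr X P a b * (He (l - 1) (v 1) * He m (v 2) * He n (v 3)) +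
      m * corr X P a c * (He l (v 1) * He (m - 1) (v 2) * He n (v 3)) +
      n * corr X P a d * (He l (v 1) * He m (v 2) * He (n - 1) (v 3)))
    (by fun_prop) (by fun_prop)
    (fun v => by
      have hlin : ∀ (y r : ℝ), HasDerivAt (fun s : ℝ => y + s * r) r 0 := fun y r => by
        simpa using ((hasDerivAt_id (0 : ℝ)).mul_const r).const_add y
      have hHe : ∀ (j : ℕ) (y r : ℝ), HasDerivAt (fun s : ℝ => He j (y + s * r))
          (j * He (j - 1) y * r) 0 := fun j y r => by
        exact (hasDerivAt_He j y).comp_of_eq (0 : ℝ) (hlin y r) (by simp)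
      have := ((hHe l (v 1) (corr X P a b)).mul (hHe m (v 2) (corr X P a c))).mul
        (hHe n (v 3) (corr X P a d))
      convert! this using 1
      simp
      ring)
    (hX.hasAllMoments_He_mul₃ b c d l m n).memLp_two
    (by
      refine HasAllMoments.memLp_two ?_
      exact (((hX.hasAllMoments_He_mul₃ b c d (l - 1) m n).const_mul _).add
        ((hX.hasAllMoments_He_mul₃ b c d l (m - 1) n).const_mul _)).add
        ((hX.hasAllMoments_He_mul₃ b c d l m (n - 1)).const_mul _))
  have h1 := (hX.hasAllMoments_He_mul a b c d k (l - 1) m n).integrable.const_mul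
    (l * corr X P a b)
  have h2 := (hX.hasAllMoments_He_mul a b c d k l (m - 1) n).integrable.const_mul
    (m * corr X P a c)
  have h3 := (hX.hasAllMoments_He_mul a b c d k l m (n - 1)).integrable.const_mul
    (n * corr X P a d)
  unfold hermiteMoment
  rw [← integral_const_mul, ← integral_const_mul, ← integral_const_mul, ← integral_add h1 h2,
    ← integral_add (h1.fun_add h2) h3]
  convert! key using 1
  · congr 1
    ext ω
    simp
    ring
  · congr 1
    ext ω
    simp
    ring

/-- The contribution to the mixed moment of the diagrams that join only `a` with `b` and `c` with
`d`. -/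
noncomputable def splitMoment (k l m n : ℕ) (x y : ℝ) : ℝ :=
  if k = l ∧ m = n then (k.factorial * m.factorial : ℝ) * x ^ k * y ^ m else 0

/-- `B` dominates `w` times the weight of every diagram with degrees `k, l, m, n` that satisfies
`p`, a condition on the number of edges that join `{a, b}` with `{c, d}`. -/
def DiagramBound (X : T → Ω → ℝ) (P : Measure Ω) (a b c d : T) (k l m n : ℕ) (p : ℕ → Prop)
    (w B : ℝ) : Prop :=
  ∀ e₁₂ e₁₃ e₁₄ e₂₃ e₂₄ e₃₄ : ℕ, e₁₂ + e₁₃ + e₁₄ = k → e₁₂ + e₂₃ + e₂₄ = l → e₁₃ + e₂₃ + e₃₄ = m →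
    e₁₄ + e₂₄ + e₃₄ = n → p (e₁₃ + e₁₄ + e₂₃ + e₂₄) →
    w * (|corr X P a b| ^ e₁₂ * |corr X P a c| ^ e₁₃ * |corr X P a d| ^ e₁₄ *
      |corr X P b c| ^ e₂₃ * |corr X P b d| ^ e₂₄ * |corr X P c d| ^ e₃₄) ≤ B

/-- A nonzero split moment is the weight of the single diagram with `k` edges between `a, b` and `m`
between `c, d`, times the number `k! m!` of ways to match them. -/
theorem abs_splitMoment_le {a b c d : T} {k l m n : ℕ} {w B : ℝ} (hB : 0 ≤ B)
    (h : DiagramBound X P a b c d k l m n (fun _ => True) w B) :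
    w * |splitMoment k l m n (corr X P a b) (corr X P c d)| ≤ (k.factorial * m.factorial : ℝ) * B := by
  unfold splitMoment
  split_ifs with hs
  · obtain ⟨rfl, rfl⟩ := hs
    have := h k 0 0 0 0 m (by omega) (by omega) (by omega) (by omega) trivial
    simp only [pow_zero, mul_one] at this
    rw [abs_mul, abs_mul, abs_pow, abs_pow, abs_of_nonneg (by positivity)]
    calc w * ((k.factorial * m.factorial : ℝ) * |corr X P a b| ^ k * |corr X P c d| ^ m)
        = (k.factorial * m.factorial : ℝ) * (w * (|corr X P a b| ^ k * |corr X P c d| ^ m)) := by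
          ring
      _ ≤ _ := by gcongr
  · simp; positivity

/-- Once the split diagrams are subtracted, every remaining diagram has a crossing edge. The proof
is by induction on the total degree, removing one edge at a time; `K` depends on the degrees only,
not on the process, the points or the weights. -/
theorem exists_abs_hermiteMoment_sub_splitMoment_le (P : Measure Ω) [IsProbabilityMeasure P]
    (N : ℕ) : ∀ k l m n : ℕ, k + l + m + n = N → ∃ K : ℝ, 0 ≤ K ∧
      ∀ (X : T → Ω → ℝ), IsStdGaussian X P → ∀ (a b c d : T) (w B : ℝ), 0 ≤ w → 0 ≤ B →
        DiagramBound X P a b c d k l m n (fun j => 1 ≤ j) w B →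
        w * |hermiteMoment X P a b c d k l m n -
          splitMoment k l m n (corr X P a b) (corr X P c d)| ≤ K * B := by
  induction N using Nat.strong_induction_on with
  | _ N ih =>
  -- This is needed after removal of a crossing edge: the rest of the diagram is then unrestricted,
  -- and restoring the split part costs `k! m!`.
  have full : ∀ k l m n : ℕ, k + l + m + n < N → ∃ K : ℝ, 0 ≤ K ∧
      ∀ (X : T → Ω → ℝ), IsStdGaussian X P → ∀ (a b c d : T) (w B : ℝ), 0 ≤ w → 0 ≤ B →
        DiagramBound X P a b c d k l m n (fun _ => True) w B →
        w * |hermiteMoment X P a b c d k l m n| ≤ K * B := by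
    intro k l m n hlt
    obtain ⟨K, hK, h⟩ := ih _ hlt k l m n rfl
    refine ⟨K + (k.factorial * m.factorial : ℝ), by positivity, ?_⟩
    intro X hX a b c d w B hw hB hd
    have h1 := h X hX a b c d w B hw hB (fun _ _ _ _ _ _ h1 h2 h3 h4 _ =>
      hd _ _ _ _ _ _ h1 h2 h3 h4 trivial)
    have h2 := abs_splitMoment_le hB hd
    calc w * |hermiteMoment X P a b c d k l m n|
        ≤ w * (|hermiteMoment X P a b c d k l m n -
          splitMoment k l m n (corr X P a b) (corr X P c d)| +
          |splitMoment k l m n (corr X P a b) (corr X P c d)|) := by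
          gcongr
          simpa using abs_add_le (hermiteMoment X P a b c d k l m n -
            splitMoment k l m n (corr X P a b) (corr X P c d))
            (splitMoment k l m n (corr X P a b) (corr X P c d))
      _ ≤ _ := by linarith
  intro k l m n hN
  -- The edge is taken at the first vertex of positive degree. An edge inside a pair keeps the split
  -- part subtracted, with its factorials matching; a crossing edge leaves a full moment, bounded by
  -- `full`.
  rcases k with _ | k
  · rcases l with _ | l
    · rcases m with _ | m
      · refine ⟨0, le_rfl, fun X hX a b c d w B hw hB _ => ?_⟩
        rcases n with _ | n
        · simp [IsStdGaussian.hermiteMoment_zero, splitMoment]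
        · rw [hermiteMoment_swap14, hX.hermiteMoment_succ]
          simp [splitMoment]
      · obtain ⟨K, hK, h⟩ := ih (0 + 0 + m + (n - 1)) (by omega) 0 0 m (n - 1) rfl
        refine ⟨n * K, by positivity, fun X hX a b c d w B hw hB hd => ?_⟩
        have e1 : hermiteMoment X P a b c d 0 0 (m + 1) n -
            splitMoment 0 0 (m + 1) n (corr X P a b) (corr X P c d) =
            n * (corr X P c d * (hermiteMoment X P a b c d 0 0 m (n - 1) -
              splitMoment 0 0 m (n - 1) (corr X P a b) (corr X P c d))) := by
          rw [hermiteMoment_swap13 a b c d 0 0 (m + 1) n, hX.hermiteMoment_succ,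
            hermiteMoment_swap13 a b c d 0 0 m (n - 1)]
          rcases n with _ | n
          · simp [splitMoment]
          · simp only [splitMoment]
            by_cases hmn : m = n
            · subst hmn
              simp [Nat.factorial_succ, pow_succ]
              ring
            · simp [hmn]
              ring
        rw [e1, abs_mul, abs_mul, Nat.abs_cast]
        rcases n with _ | n
        · simp
        -- The correlation of the removed edge is absorbed in the weight. Adding that edge back to a
        -- smaller diagram gives one that `hd` covers.
        have := h X hX a b c d (w * |corr X P c d|) B (by positivity) hB
          (fun e₁₂ e₁₃ e₁₄ e₂₃ e₂₄ e₃₄ h1 h2 h3 h4 h5 => by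
            refine le_of_eq_of_le ?_ (hd e₁₂ e₁₃ e₁₄ e₂₃ e₂₄ (e₃₄ + 1) (by omega) (by omega)
              (by omega) (by omega) (by omega))
            ring)
        calc _ = ((n + 1 : ℕ) : ℝ) * (w * |corr X P c d| *
              |hermiteMoment X P a b c d 0 0 m (n + 1 - 1) -
                splitMoment 0 0 m (n + 1 - 1) (corr X P a b) (corr X P c d)|) := by ring
          _ ≤ ((n + 1 : ℕ) : ℝ) * (K * B) := by gcongr
          _ = _ := by ring
    · obtain ⟨K₁, hK₁, h₁⟩ := full 0 l (m - 1) n (by omega)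
      obtain ⟨K₂, hK₂, h₂⟩ := full 0 l m (n - 1) (by omega)
      refine ⟨m * K₁ + n * K₂, by positivity, fun X hX a b c d w B hw hB hd => ?_⟩
      have e1 : hermiteMoment X P a b c d 0 (l + 1) m n -
          splitMoment 0 (l + 1) m n (corr X P a b) (corr X P c d) =
          m * (corr X P b c * hermiteMoment X P a b c d 0 l (m - 1) n) +
          n * (corr X P b d * hermiteMoment X P a b c d 0 l m (n - 1)) := by
        rw [hermiteMoment_swap12, hX.hermiteMoment_succ, hermiteMoment_swap12 b a c d l 0 (m - 1) n,
          hermiteMoment_swap12 b a c d l 0 m (n - 1)]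
        simp [splitMoment]
        ring
      have t1 : w * |m * (corr X P b c * hermiteMoment X P a b c d 0 l (m - 1) n)| ≤
          m * K₁ * B := by
        rcases m with _ | m
        · simp
        have := h₁ X hX a b c d (w * |corr X P b c|) B (by positivity) hB
          (fun e₁₂ e₁₃ e₁₄ e₂₃ e₂₄ e₃₄ h1 h2 h3 h4 h5 => by
            refine le_of_eq_of_le ?_ (hd e₁₂ e₁₃ e₁₄ (e₂₃ + 1) e₂₄ e₃₄ (by omega) (by omega)
              (by omega) (by omega) (by omega))
            ring)
        rw [abs_mul, abs_mul, Nat.abs_cast]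
        calc _ = ((m + 1 : ℕ) : ℝ) * (w * |corr X P b c| *
              |hermiteMoment X P a b c d 0 l (m + 1 - 1) n|) := by ring
          _ ≤ ((m + 1 : ℕ) : ℝ) * (K₁ * B) := by gcongr
          _ = _ := by ring
      have t2 : w * |n * (corr X P b d * hermiteMoment X P a b c d 0 l m (n - 1))| ≤
          n * K₂ * B := by
        rcases n with _ | n
        · simp
        have := h₂ X hX a b c d (w * |corr X P b d|) B (by positivity) hB
          (fun e₁₂ e₁₃ e₁₄ e₂₃ e₂₄ e₃₄ h1 h2 h3 h4 h5 => by
            refine le_of_eq_of_le ?_ (hd e₁₂ e₁₃ e₁₄ e₂₃ (e₂₄ + 1) e₃₄ (by omega) (by omega)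
              (by omega) (by omega) (by omega))
            ring)
        rw [abs_mul, abs_mul, Nat.abs_cast]
        calc _ = ((n + 1 : ℕ) : ℝ) * (w * |corr X P b d| *
              |hermiteMoment X P a b c d 0 l m (n + 1 - 1)|) := by ring
          _ ≤ ((n + 1 : ℕ) : ℝ) * (K₂ * B) := by gcongr
          _ = _ := by ring
      rw [e1]
      refine (mul_le_mul_of_nonneg_left (abs_add_le _ _) hw).trans ?_
      linarith
  · obtain ⟨K₀, hK₀, h₀⟩ := ih (k + (l - 1) + m + n) (by omega) k (l - 1) m n rfl
    obtain ⟨K₁, hK₁, h₁⟩ := full k l (m - 1) n (by omega)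
    obtain ⟨K₂, hK₂, h₂⟩ := full k l m (n - 1) (by omega)
    refine ⟨l * K₀ + m * K₁ + n * K₂, by positivity, fun X hX a b c d w B hw hB hd => ?_⟩
    have e1 : hermiteMoment X P a b c d (k + 1) l m n -
        splitMoment (k + 1) l m n (corr X P a b) (corr X P c d) =
        l * (corr X P a b * (hermiteMoment X P a b c d k (l - 1) m n -
          splitMoment k (l - 1) m n (corr X P a b) (corr X P c d))) +
        m * (corr X P a c * hermiteMoment X P a b c d k l (m - 1) n) +
        n * (corr X P a d * hermiteMoment X P a b c d k l m (n - 1)) := by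
      rw [hX.hermiteMoment_succ]
      rcases l with _ | l
      · simp [splitMoment]
        ring
      · simp only [splitMoment]
        by_cases hs : k = l ∧ m = n
        · obtain ⟨rfl, rfl⟩ := hs
          simp [Nat.factorial_succ, pow_succ]
          ring
        · simp [hs]
          ring
    have t0 : w * |l * (corr X P a b * (hermiteMoment X P a b c d k (l - 1) m n -
          splitMoment k (l - 1) m n (corr X P a b) (corr X P c d)))| ≤ l * K₀ * B := by
      rcases l with _ | l
      · simp
      have := h₀ X hX a b c d (w * |corr X P a b|) B (by positivity) hB
        (fun e₁₂ e₁₃ e₁₄ e₂₃ e₂₄ e₃₄ h1 h2 h3 h4 h5 => by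
          refine le_of_eq_of_le ?_ (hd (e₁₂ + 1) e₁₃ e₁₄ e₂₃ e₂₄ e₃₄ (by omega) (by omega)
            (by omega) (by omega) (by omega))
          ring)
      rw [abs_mul, abs_mul, Nat.abs_cast]
      calc _ = ((l + 1 : ℕ) : ℝ) * (w * |corr X P a b| *
            |hermiteMoment X P a b c d k (l + 1 - 1) m n -
              splitMoment k (l + 1 - 1) m n (corr X P a b) (corr X P c d)|) := by ring
        _ ≤ ((l + 1 : ℕ) : ℝ) * (K₀ * B) := by gcongr
        _ = _ := by ring
    have t1 : w * |m * (corr X P a c * hermiteMoment X P a b c d k l (m - 1) n)| ≤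
        m * K₁ * B := by
      rcases m with _ | m
      · simp
      have := h₁ X hX a b c d (w * |corr X P a c|) B (by positivity) hB
        (fun e₁₂ e₁₃ e₁₄ e₂₃ e₂₄ e₃₄ h1 h2 h3 h4 h5 => by
          refine le_of_eq_of_le ?_ (hd e₁₂ (e₁₃ + 1) e₁₄ e₂₃ e₂₄ e₃₄ (by omega) (by omega)
            (by omega) (by omega) (by omega))
          ring)
      rw [abs_mul, abs_mul, Nat.abs_cast]
      calc _ = ((m + 1 : ℕ) : ℝ) * (w * |corr X P a c| *
            |hermiteMoment X P a b c d k l (m + 1 - 1) n|) := by ring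
        _ ≤ ((m + 1 : ℕ) : ℝ) * (K₁ * B) := by gcongr
        _ = _ := by ring
    have t2 : w * |n * (corr X P a d * hermiteMoment X P a b c d k l m (n - 1))| ≤
        n * K₂ * B := by
      rcases n with _ | n
      · simp
      have := h₂ X hX a b c d (w * |corr X P a d|) B (by positivity) hB
        (fun e₁₂ e₁₃ e₁₄ e₂₃ e₂₄ e₃₄ h1 h2 h3 h4 h5 => by
          refine le_of_eq_of_le ?_ (hd e₁₂ e₁₃ (e₁₄ + 1) e₂₃ e₂₄ e₃₄ (by omega) (by omega)
            (by omega) (by omega) (by omega))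
          ring)
      rw [abs_mul, abs_mul, Nat.abs_cast]
      calc _ = ((n + 1 : ℕ) : ℝ) * (w * |corr X P a d| *
            |hermiteMoment X P a b c d k l m (n + 1 - 1)|) := by ring
        _ ≤ ((n + 1 : ℕ) : ℝ) * (K₂ * B) := by gcongr
        _ = _ := by ring
    rw [e1]
    refine (mul_le_mul_of_nonneg_left (abs_add_three _ _ _) hw).trans ?_
    linarith

/-- The fourth mixed moment of the Hermite polynomials of degree `p`, up to its main term. -/
theorem exists_abs_hermiteMoment_sub_le (T : Type*) (P : Measure Ω) [IsProbabilityMeasure P]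
    (p : ℕ) : ∃ K : ℝ, 0 ≤ K ∧ ∀ (X : T → Ω → ℝ), IsStdGaussian X P → ∀ a b c d : T,
      |hermiteMoment X P a b c d p p p p -
        (p.factorial : ℝ) ^ 2 * (corr X P a b * corr X P c d) ^ p| ≤
      K * ∑ q ∈ Finset.Icc 1 p, |corr X P a b * corr X P c d| ^ (p - q) *
        (|corr X P a c * corr X P b d| ^ q + |corr X P a d * corr X P b c| ^ q) := by
  obtain ⟨K, hK, h⟩ := exists_abs_hermiteMoment_sub_splitMoment_le (T := T) P _ p p p p rfl
  refine ⟨K, hK, fun X hX a b c d => ?_⟩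
  have := h X hX a b c d 1 (∑ q ∈ Finset.Icc 1 p, |corr X P a b * corr X P c d| ^ (p - q) *
        (|corr X P a c * corr X P b d| ^ q + |corr X P a d * corr X P b c| ^ q)) zero_le_one
        (by positivity) ?_
  · rw [one_mul] at this
    convert this using 3
    simp [splitMoment]
    ring
  · intro e₁₂ e₁₃ e₁₄ e₂₃ e₂₄ e₃₄ h1 h2 h3 h4 h5
    -- Equal degrees at the four vertices force opposite edges to have equal multiplicity. With `q`
    -- crossing edges at each vertex, `p - q` remain in each pair.
    obtain rfl : e₃₄ = e₁₂ := by omega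
    obtain rfl : e₂₄ = e₁₃ := by omega
    obtain rfl : e₂₃ = e₁₄ := by omega
    refine le_trans ?_ (Finset.single_le_sum (f := fun q => |corr X P a b * corr X P c d| ^ (p - q) *
        (|corr X P a c * corr X P b d| ^ q + |corr X P a d * corr X P b c| ^ q))
        (fun _ _ => by positivity) (Finset.mem_Icc.2 (⟨by omega, by omega⟩ :
          1 ≤ e₂₄ + e₂₃ ∧ e₂₄ + e₂₃ ≤ p)))
    have hp : p - (e₂₄ + e₂₃) = e₃₄ := by omega
    simp only [hp, one_mul]
    -- A diagram that mixes the two crossing pairings is dominated by the two that use a single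
    -- pairing.
    have hmax : ∀ x y : ℝ, 0 ≤ x → 0 ≤ y → x ^ e₂₄ * y ^ e₂₃ ≤ x ^ (e₂₄ + e₂₃) + y ^ (e₂₄ + e₂₃) := by
      intro x y hx hy
      rw [pow_add, pow_add]
      rcases le_total x y with hxy | hxy
      · have : x ^ e₂₄ * y ^ e₂₃ ≤ y ^ e₂₄ * y ^ e₂₃ := by gcongr
        have : 0 ≤ x ^ e₂₄ * x ^ e₂₃ := by positivity
        linarith
      · have : x ^ e₂₄ * y ^ e₂₃ ≤ x ^ e₂₄ * x ^ e₂₃ := by gcongr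
        have : 0 ≤ y ^ e₂₄ * y ^ e₂₃ := by positivity
        linarith
    calc _ = |corr X P a b * corr X P c d| ^ e₃₄ * (|corr X P a c * corr X P b d| ^ e₂₄ *
          |corr X P a d * corr X P b c| ^ e₂₃) := by
          simp only [abs_mul, mul_pow]; ring
      _ ≤ _ := by
          gcongr
          exact hmax _ _ (abs_nonneg _) (abs_nonneg _)

/-- Orthogonality of the Hermite polynomials of two correlated standard Gaussian variables. -/
theorem IsStdGaussian.integral_He_mul_He (hX : IsStdGaussian X P) (s t : T) (m n : ℕ) :
    ∫ ω, He m (X s ω) * He n (X t ω) ∂P =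
      if m = n then (m.factorial : ℝ) * corr X P s t ^ m else 0 := by
  have h : ∀ m n, ∫ ω, He m (X s ω) * He n (X t ω) ∂P = hermiteMoment X P s t s s m n 0 0 := by
    simp [hermiteMoment, He_zero]
  rw [h]
  induction m generalizing n with
  | zero =>
    rcases n with _ | n
    · simp [IsStdGaussian.hermiteMoment_zero]
    · rw [hermiteMoment_swap12, hX.hermiteMoment_succ]
      simp
  | succ m ih =>
    rw [hX.hermiteMoment_succ, ih]
    rcases n with _ | n
    · simp
    · by_cases hmn : m = n
      · subst hmn
        simp [Nat.factorial_succ, pow_succ]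
        ring
      · simp [hmn]

end HermiteMoments

/-! ### Stein's method for finite sums in one Hermite chaos -/

/-- The variance of `|Y|` is nonnegative. -/
theorem integral_abs_le_sqrt {Ω : Type*} [MeasurableSpace Ω] {P : Measure Ω}
    [IsProbabilityMeasure P] {Y : Ω → ℝ} (hY : MemLp Y 2 P) :
    ∫ ω, |Y ω| ∂P ≤ √(∫ ω, Y ω ^ 2 ∂P) := by
  have h := variance_eq_sub hY.abs
  have h0 := variance_nonneg (|Y|) P
  refine Real.le_sqrt_of_sq_le ?_
  have e : ∫ ω, (|Y| ^ 2) ω ∂P = ∫ ω, Y ω ^ 2 ∂P := by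
    congr 1; ext ω; simp
  have e2 : ∫ ω, |Y| ω ∂P = ∫ ω, |Y ω| ∂P := rfl
  rw [e, e2] at h
  linarith

/-- A function whose logarithmic derivative is close to `-V t` is close to a Gaussian
characteristic function. -/
theorem norm_sub_exp_le_of_hasDerivAt {ψ r : ℝ → ℂ} {V s : ℝ} (hV : 0 ≤ V) (hs : 0 ≤ s)
    (h0 : ψ 0 = 1) (hd : ∀ t, HasDerivAt ψ (-(t * V : ℝ) * ψ t + r t) t)
    (hr : ∀ t, ‖r t‖ ≤ |t| * s) (t : ℝ) :
    ‖ψ t - Complex.exp (-(V * t ^ 2 / 2 : ℝ))‖ ≤ t ^ 2 * s := by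
  have hE : ∀ u : ℝ, HasDerivAt (fun u : ℝ => Complex.exp ((V * u ^ 2 / 2 : ℝ) : ℂ))
      (Complex.exp ((V * u ^ 2 / 2 : ℝ) : ℂ) * (u * V : ℝ)) u := by
    intro u
    have h1 : HasDerivAt (fun u : ℝ => V * u ^ 2 / 2) (u * V) u := by
      have := ((hasDerivAt_pow 2 u).const_mul V).div_const 2
      convert! this using 1
      simp
      ring
    exact h1.ofReal_comp.cexp
  -- The integrating factor `exp (V u² / 2)` removes the linear term. Its largest value between `0`
  -- and `t` is cancelled at the end by `exp (-V t² / 2)`.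
  have hD : ∀ u : ℝ, HasDerivAt (fun u : ℝ => ψ u * Complex.exp ((V * u ^ 2 / 2 : ℝ) : ℂ))
      (r u * Complex.exp ((V * u ^ 2 / 2 : ℝ) : ℂ)) u := by
    intro u
    have := (hd u).mul (hE u)
    convert! this using 1
    ring
  have hbound : ∀ u ∈ uIcc 0 t, ‖r u * Complex.exp ((V * u ^ 2 / 2 : ℝ) : ℂ)‖ ≤
      |t| * s * Real.exp (V * t ^ 2 / 2) := by
    intro u hu
    have hut : |u| ≤ |t| := by simpa using abs_sub_left_of_mem_uIcc hu
    rw [norm_mul, Complex.norm_exp_ofReal]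
    have : u ^ 2 ≤ t ^ 2 := sq_le_sq.2 hut
    refine mul_le_mul ((hr u).trans ?_) ?_ (Real.exp_pos _).le (by positivity)
    · gcongr
    · gcongr
  have key := (convex_uIcc (0 : ℝ) t).norm_image_sub_le_of_norm_hasDerivWithin_le
    (fun u _ => (hD u).hasDerivWithinAt) hbound left_mem_uIcc right_mem_uIcc
  have hexp : Complex.exp ((V * t ^ 2 / 2 : ℝ) : ℂ) * Complex.exp (-(V * t ^ 2 / 2 : ℝ)) = 1 := by
    rw [← Complex.exp_add]; simp
  have e : ψ t - Complex.exp (-(V * t ^ 2 / 2 : ℝ)) =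
      (ψ t * Complex.exp ((V * t ^ 2 / 2 : ℝ) : ℂ) -
        ψ 0 * Complex.exp ((V * (0 : ℝ) ^ 2 / 2 : ℝ) : ℂ)) *
        Complex.exp (-(V * t ^ 2 / 2 : ℝ)) := by
    rw [h0, sub_mul, mul_assoc, hexp]
    simp
  rw [e, norm_mul]
  have hn : ‖Complex.exp (-(V * t ^ 2 / 2 : ℝ))‖ = Real.exp (-(V * t ^ 2 / 2)) := by
    rw [← Complex.ofReal_neg, Complex.norm_exp_ofReal]
  rw [hn]
  calc _ ≤ |t| * s * Real.exp (V * t ^ 2 / 2) * ‖t - 0‖ * Real.exp (-(V * t ^ 2 / 2)) := by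
        gcongr
    _ = t ^ 2 * s * (Real.exp (V * t ^ 2 / 2) * Real.exp (-(V * t ^ 2 / 2))) := by
        rw [sub_zero, Real.norm_eq_abs, ← sq_abs t]; ring
    _ = t ^ 2 * s := by rw [← Real.exp_add]; simp

/-- The four-cycle sums that control the variance of the Stein factor. -/
theorem sum_cycle_le {ι : Type*} [Fintype ι] {ρ : ι → ι → ℝ} (hnn : ∀ a b, 0 ≤ ρ a b)
    (hsymm : ∀ a b, ρ a b = ρ b a) {w : ℝ} (hw : 0 ≤ w) {p q : ℕ} (hq : q ≤ p + 1) {U U' : ℝ}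
    (hU : ∀ a, ∑ b, w * ρ a b ^ q ≤ U) (hU' : ∀ a, ∑ b, w * ρ a b ^ (p + 1 - q) ≤ U') :
    ∑ a, ∑ b, ∑ c, ∑ d, w ^ 4 * ((ρ a b * ρ c d) ^ (p + 1 - q) * (ρ a c * ρ b d) ^ q) ≤
      2 * (w ^ 2 * ∑ a, ∑ b, ρ a b ^ (p + 1)) * (U * U') := by
  rcases isEmpty_or_nonempty ι with hι | ⟨⟨i₀⟩⟩
  · simp
  have hU0 : 0 ≤ U := (Finset.sum_nonneg fun b _ => mul_nonneg hw (pow_nonneg (hnn i₀ b) q)).trans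
    (hU i₀)
  have hU0' : 0 ≤ U' :=
    (Finset.sum_nonneg fun b _ => mul_nonneg hw (pow_nonneg (hnn i₀ b) _)).trans (hU' i₀)
  -- Applied to the two edges at `a`, this breaks the four-cycle: one of them takes the full power
  -- `p + 1`, the other disappears, and the remaining path is summed from its free end.
  have hmax : ∀ x y : ℝ, 0 ≤ x → 0 ≤ y → x ^ (p + 1 - q) * y ^ q ≤ x ^ (p + 1) + y ^ (p + 1) := by
    intro x y hx hy
    have hsplit : ∀ z : ℝ, z ^ (p + 1) = z ^ (p + 1 - q) * z ^ q := fun z => by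
      rw [← pow_add]; congr 1; omega
    rcases le_total x y with hxy | hxy
    · have : x ^ (p + 1 - q) * y ^ q ≤ y ^ (p + 1 - q) * y ^ q := by gcongr
      rw [← hsplit] at this
      have : 0 ≤ x ^ (p + 1) := by positivity
      linarith
    · have : x ^ (p + 1 - q) * y ^ q ≤ x ^ (p + 1 - q) * x ^ q := by gcongr
      rw [← hsplit] at this
      have : 0 ≤ y ^ (p + 1) := by positivity
      linarith
  -- the two sums that arise from `hmax`
  have h1 : ∀ b, ∑ d, ∑ c, w ^ 2 * (ρ c d ^ (p + 1 - q) * ρ b d ^ q) ≤ U * U' := by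
    intro b
    calc ∑ d, ∑ c, w ^ 2 * (ρ c d ^ (p + 1 - q) * ρ b d ^ q)
        = ∑ d, (w * ρ b d ^ q) * ∑ c, w * ρ d c ^ (p + 1 - q) := by
          refine Finset.sum_congr rfl fun d _ => ?_
          rw [Finset.mul_sum]
          refine Finset.sum_congr rfl fun c _ => ?_
          rw [hsymm c d]; ring
      _ ≤ ∑ d, (w * ρ b d ^ q) * U' := by
          refine Finset.sum_le_sum fun d _ => ?_
          exact mul_le_mul_of_nonneg_left (hU' d) (mul_nonneg hw (pow_nonneg (hnn _ _) _))
      _ = (∑ d, w * ρ b d ^ q) * U' := by rw [Finset.sum_mul]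
      _ ≤ U * U' := by gcongr; exact hU b
  have h2 : ∀ c, ∑ d, ∑ b, w ^ 2 * (ρ c d ^ (p + 1 - q) * ρ b d ^ q) ≤ U * U' := by
    intro c
    calc ∑ d, ∑ b, w ^ 2 * (ρ c d ^ (p + 1 - q) * ρ b d ^ q)
        = ∑ d, (w * ρ c d ^ (p + 1 - q)) * ∑ b, w * ρ d b ^ q := by
          refine Finset.sum_congr rfl fun d _ => ?_
          rw [Finset.mul_sum]
          refine Finset.sum_congr rfl fun b _ => ?_
          rw [hsymm b d]; ring
      _ ≤ ∑ d, (w * ρ c d ^ (p + 1 - q)) * U := by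
          refine Finset.sum_le_sum fun d _ => ?_
          exact mul_le_mul_of_nonneg_left (hU d) (mul_nonneg hw (pow_nonneg (hnn _ _) _))
      _ = (∑ d, w * ρ c d ^ (p + 1 - q)) * U := by rw [Finset.sum_mul]
      _ ≤ U * U' := by rw [mul_comm U U']; gcongr; exact hU' c
  calc ∑ a, ∑ b, ∑ c, ∑ d, w ^ 4 * ((ρ a b * ρ c d) ^ (p + 1 - q) * (ρ a c * ρ b d) ^ q)
      ≤ ∑ a, ∑ b, ∑ c, ∑ d, (w ^ 2 * ρ a b ^ (p + 1) * (w ^ 2 * (ρ c d ^ (p + 1 - q) * ρ b d ^ q)) +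
          w ^ 2 * ρ a c ^ (p + 1) * (w ^ 2 * (ρ c d ^ (p + 1 - q) * ρ b d ^ q))) := by
        refine Finset.sum_le_sum fun a _ => Finset.sum_le_sum fun b _ => Finset.sum_le_sum
          fun c _ => Finset.sum_le_sum fun d _ => ?_
        have := hmax _ _ (hnn a b) (hnn a c)
        have h3 : 0 ≤ w ^ 4 * (ρ c d ^ (p + 1 - q) * ρ b d ^ q) :=
          mul_nonneg (by positivity) (mul_nonneg (pow_nonneg (hnn _ _) _) (pow_nonneg (hnn _ _) _))
        calc _ = w ^ 4 * (ρ c d ^ (p + 1 - q) * ρ b d ^ q) *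
              (ρ a b ^ (p + 1 - q) * ρ a c ^ q) := by rw [mul_pow, mul_pow]; ring
          _ ≤ w ^ 4 * (ρ c d ^ (p + 1 - q) * ρ b d ^ q) * (ρ a b ^ (p + 1) + ρ a c ^ (p + 1)) := by
              gcongr
          _ = _ := by ring
    _ = (∑ a, ∑ b, w ^ 2 * ρ a b ^ (p + 1) *
            ∑ d, ∑ c, w ^ 2 * (ρ c d ^ (p + 1 - q) * ρ b d ^ q)) +
          ∑ a, ∑ c, w ^ 2 * ρ a c ^ (p + 1) *
            ∑ d, ∑ b, w ^ 2 * (ρ c d ^ (p + 1 - q) * ρ b d ^ q) := by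
        simp only [Finset.sum_add_distrib, Finset.mul_sum]
        congr 1
        · refine Finset.sum_congr rfl fun a _ => Finset.sum_congr rfl fun b _ => ?_
          rw [Finset.sum_comm]
        · refine Finset.sum_congr rfl fun a _ => ?_
          rw [Finset.sum_comm]
          refine Finset.sum_congr rfl fun c _ => ?_
          rw [Finset.sum_comm]
    _ ≤ (∑ a, ∑ b, w ^ 2 * ρ a b ^ (p + 1) * (U * U')) +
          ∑ a, ∑ c, w ^ 2 * ρ a c ^ (p + 1) * (U * U') := by
        gcongr with a _ b _ a _ c _
        · exact mul_nonneg (by positivity) (pow_nonneg (hnn _ _) _)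
        · exact h1 b
        · exact mul_nonneg (by positivity) (pow_nonneg (hnn _ _) _)
        · exact h2 c
    _ = _ := by
        simp only [← Finset.sum_mul, ← Finset.mul_sum]
        ring

/-! ### Stein factor and characteristic function of a finite chaos sum -/

section FiniteChaos

variable {Ω : Type*} [MeasurableSpace Ω] {P : Measure Ω} [IsProbabilityMeasure P]
  {ι : Type*} [Fintype ι] {ξ : ι → Ω → ℝ}

/-- The Stein factor of a sum of Hermite polynomials of degree `p + 1` with weight `w`. -/
noncomputable def steinFactor (ξ : ι → Ω → ℝ) (P : Measure Ω) (p : ℕ) (w : ℝ) (ω : Ω) : ℝ :=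
  ∑ i, ∑ j, w ^ 2 / p.factorial * corr ξ P i j * (He p (ξ i ω) * He p (ξ j ω))

theorem IsStdGaussian.hasAllMoments_steinFactor (hξ : IsStdGaussian ξ P) (p : ℕ) (w : ℝ) :
    HasAllMoments (steinFactor ξ P p w) P :=
  HasAllMoments.sum _ fun i _ => HasAllMoments.sum _ fun j _ =>
    ((hξ.hasAllMoments_He p i).mul (hξ.hasAllMoments_He p j)).const_mul _

/-- By orthogonality each pair contributes `p! r^p` times its correlation, so the mean of the Stein
factor is the variance of the chaos sum. -/
theorem IsStdGaussian.integral_steinFactor (hξ : IsStdGaussian ξ P) (p : ℕ) (w : ℝ) :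
    ∫ ω, steinFactor ξ P p w ω ∂P = w ^ 2 * ∑ i, ∑ j, corr ξ P i j ^ (p + 1) := by
  unfold steinFactor
  have hi : ∀ i j, Integrable (fun ω => w ^ 2 / p.factorial * corr ξ P i j *
      (He p (ξ i ω) * He p (ξ j ω))) P := fun i j =>
    (((hξ.hasAllMoments_He p i).mul (hξ.hasAllMoments_He p j)).const_mul _).integrable
  rw [integral_finsetSum _ fun i _ => integrable_finsetSum _ fun j _ => hi i j, Finset.mul_sum]
  refine Finset.sum_congr rfl fun i _ => ?_
  rw [integral_finsetSum _ fun j _ => hi i j, Finset.mul_sum]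
  refine Finset.sum_congr rfl fun j _ => ?_
  rw [integral_const_mul, hξ.integral_He_mul_He]
  have : (p.factorial : ℝ) ≠ 0 := by positivity
  simp only [if_true]
  field_simp
  ring

theorem IsStdGaussian.integral_sq_steinFactor (hξ : IsStdGaussian ξ P) (p : ℕ) (w : ℝ) :
    ∫ ω, steinFactor ξ P p w ω ^ 2 ∂P = ∑ a, ∑ b, ∑ c, ∑ d, w ^ 4 / (p.factorial : ℝ) ^ 2 *
      (corr ξ P a b * corr ξ P c d) * hermiteMoment ξ P a b c d p p p p := by
  have hi : ∀ a b c d, Integrable (fun ω => w ^ 4 / (p.factorial : ℝ) ^ 2 *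
      (corr ξ P a b * corr ξ P c d) *
      (He p (ξ a ω) * He p (ξ b ω) * He p (ξ c ω) * He p (ξ d ω))) P := fun a b c d =>
    ((hξ.hasAllMoments_He_mul a b c d p p p p).const_mul _).integrable
  have e : ∀ ω, steinFactor ξ P p w ω ^ 2 = ∑ a, ∑ b, ∑ c, ∑ d, w ^ 4 / (p.factorial : ℝ) ^ 2 *
      (corr ξ P a b * corr ξ P c d) *
      (He p (ξ a ω) * He p (ξ b ω) * He p (ξ c ω) * He p (ξ d ω)) := by
    intro ω
    rw [pow_two]
    simp only [steinFactor]
    simp only [Finset.sum_mul]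
    refine Finset.sum_congr rfl fun a _ => Finset.sum_congr rfl fun b _ => ?_
    simp only [Finset.mul_sum]
    refine Finset.sum_congr rfl fun c _ => Finset.sum_congr rfl fun d _ => ?_
    ring
  simp only [e]
  rw [integral_finsetSum _ fun a _ => integrable_finsetSum _ fun b _ => integrable_finsetSum _
    fun c _ => integrable_finsetSum _ fun d _ => hi a b c d]
  refine Finset.sum_congr rfl fun a _ => ?_
  rw [integral_finsetSum _ fun b _ => integrable_finsetSum _
    fun c _ => integrable_finsetSum _ fun d _ => hi a b c d]
  refine Finset.sum_congr rfl fun b _ => ?_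
  rw [integral_finsetSum _ fun c _ => integrable_finsetSum _ fun d _ => hi a b c d]
  refine Finset.sum_congr rfl fun c _ => ?_
  rw [integral_finsetSum _ fun d _ => hi a b c d]
  refine Finset.sum_congr rfl fun d _ => ?_
  rw [integral_const_mul, hermiteMoment]

/-- The normalized chaos sum. -/
noncomputable def chaosSum (ξ : ι → Ω → ℝ) (k : ℕ) (w : ℝ) (ω : Ω) : ℝ :=
  w * ∑ i, normHermite k (ξ i ω)

theorem normHermite_eq (k : ℕ) (x : ℝ) : normHermite k x = He k x / √(k.factorial : ℝ) := rfl

theorem IsStdGaussian.hasAllMoments_normHermite (hξ : IsStdGaussian ξ P) (k : ℕ) (i : ι) :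
    HasAllMoments (fun ω => normHermite k (ξ i ω)) P := by
  simp only [normHermite_eq, div_eq_inv_mul]
  exact (hξ.hasAllMoments_He k i).const_mul _

theorem IsStdGaussian.hasAllMoments_chaosSum (hξ : IsStdGaussian ξ P) (k : ℕ) (w : ℝ) :
    HasAllMoments (chaosSum ξ k w) P :=
  (HasAllMoments.sum _ fun i _ => hξ.hasAllMoments_normHermite k i).const_mul _

theorem hasAllMoments_cexp {F : Ω → ℝ} (hF : AEMeasurable F P) (t : ℝ) :
    HasAllMoments (fun ω => Complex.exp ((t * F ω : ℝ) * Complex.I)) P := by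
  intro q hq
  refine MemLp.of_bound (C := 1) ?_ (ae_of_all _ fun ω => ?_)
  · exact ((Complex.measurable_exp.comp_aemeasurable
      ((Complex.measurable_ofReal.comp_aemeasurable (hF.const_mul t)).mul_const _))).aestronglyMeasurable
  · rw [Complex.norm_exp_ofReal_mul_I]

theorem hasDerivAt_integral_cexp {F : Ω → ℝ} (hF : HasAllMoments F P) (t : ℝ) :
    HasDerivAt (fun t : ℝ => ∫ ω, Complex.exp ((t * F ω : ℝ) * Complex.I) ∂P)
      (∫ ω, Complex.I * (F ω * Complex.exp ((t * F ω : ℝ) * Complex.I)) ∂P) t := by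
  have hm : AEMeasurable F P := hF.integrable.aemeasurable
  refine (hasDerivAt_integral_of_dominated_loc_of_deriv_le (bound := fun ω => |F ω|)
    (F := fun (t : ℝ) ω => Complex.exp ((t * F ω : ℝ) * Complex.I))
    (F' := fun (t : ℝ) ω => Complex.I * (F ω * Complex.exp ((t * F ω : ℝ) * Complex.I)))
    Filter.univ_mem ?_ ?_ ?_ ?_ ?_ ?_).2
  · exact Eventually.of_forall fun s => (hasAllMoments_cexp hm s).integrable.aestronglyMeasurable
  · exact (hasAllMoments_cexp hm t).integrable
  · exact (((hF.ofReal (𝕜 := ℂ)).mul (hasAllMoments_cexp hm t)).const_mul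
      _).integrable.aestronglyMeasurable
  · refine ae_of_all _ fun ω s _ => ?_
    rw [norm_mul, norm_mul, Complex.norm_exp_ofReal_mul_I]
    simp
  · exact hF.integrable.abs
  · refine ae_of_all _ fun ω s _ => ?_
    have h1 : HasDerivAt (fun s : ℝ => ((s * F ω : ℝ) : ℂ) * Complex.I) (F ω * Complex.I) s := by
      have : HasDerivAt (fun s : ℝ => s * F ω) (F ω) s := by
        simpa using (hasDerivAt_id s).mul_const (F ω)
      exact this.ofReal_comp.mul_const _
    have := h1.cexp
    convert! this using 1
    ring

/-- Stein's identity. Integrating by parts in each `He_{p+1}(ξ_i)` differentiates the exponential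
and brings down `He_p(ξ_j)` for every `j`. The left side is the derivative of the characteristic
function. -/
theorem IsStdGaussian.integral_chaosSum_mul_cexp (hξ : IsStdGaussian ξ P) (p : ℕ) (w t : ℝ) :
    ∫ ω, Complex.I * (chaosSum ξ (p + 1) w ω *
        Complex.exp ((t * chaosSum ξ (p + 1) w ω : ℝ) * Complex.I)) ∂P =
      -t * ∫ ω, (steinFactor ξ P p w ω : ℂ) *
        Complex.exp ((t * chaosSum ξ (p + 1) w ω : ℝ) * Complex.I) ∂P := by
  set c : ℝ := w / √((p + 1).factorial : ℝ) with hc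
  have hF : ∀ ω, chaosSum ξ (p + 1) w ω = c * ∑ i, He (p + 1) (ξ i ω) := by
    intro ω
    simp only [chaosSum, normHermite_eq, ← Finset.sum_div, hc]
    ring
  have hm : AEMeasurable (chaosSum ξ (p + 1) w) P :=
    (hξ.hasAllMoments_chaosSum _ _).integrable.aemeasurable
  have hexp := hasAllMoments_cexp hm t
  have ibp : ∀ i, ∫ ω, (He (p + 1) (ξ i ω) : ℂ) *
      Complex.exp ((t * chaosSum ξ (p + 1) w ω : ℝ) * Complex.I) ∂P =
      ∫ ω, (He p (ξ i ω) : ℂ) * (Complex.I * t * c * (p + 1 : ℕ) *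
        ((∑ j, corr ξ P i j * He p (ξ j ω) : ℝ) : ℂ) *
        Complex.exp ((t * chaosSum ξ (p + 1) w ω : ℝ) * Complex.I)) ∂P := by
    intro i
    have hsum : HasAllMoments (fun ω => ((∑ j, corr ξ P i j * He p (ξ j ω) : ℝ) : ℂ)) P :=
      (HasAllMoments.sum Finset.univ fun j _ =>
        (hξ.hasAllMoments_He p j).const_mul (corr ξ P i j)).ofReal
    have := hξ.integral_He_succ_smul (𝕜 := ℂ) i p
      (Φ := fun v => Complex.exp ((t * (c * ∑ j, He (p + 1) (v j)) : ℝ) * Complex.I))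
      (Φ' := fun v => Complex.I * t * c * (p + 1 : ℕ) *
        ((∑ j, corr ξ P i j * He p (v j) : ℝ) : ℂ) *
        Complex.exp ((t * (c * ∑ j, He (p + 1) (v j)) : ℝ) * Complex.I))
      (by fun_prop) (by fun_prop) (fun v => by
        have h1 : ∀ j, HasDerivAt (fun s : ℝ => He (p + 1) (v j + s * corr ξ P i j))
            ((p + 1 : ℕ) * He p (v j) * corr ξ P i j) 0 := fun j => by
          have hlin : HasDerivAt (fun s : ℝ => v j + s * corr ξ P i j) (corr ξ P i j) 0 := by
            simpa using ((hasDerivAt_id (0 : ℝ)).mul_const (corr ξ P i j)).const_add (v j)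
          exact (hasDerivAt_He_succ p (v j)).comp_of_eq (0 : ℝ) hlin (by simp)
        have h2 := ((HasDerivAt.fun_sum (u := Finset.univ) fun j _ => h1 j).const_mul
          c).const_mul t
        have h3 := (h2.ofReal_comp.mul_const Complex.I).cexp
        convert! h3 using 1
        simp only [zero_mul, add_zero]
        push_cast
        simp only [Finset.mul_sum, Finset.sum_mul]
        refine Finset.sum_congr rfl fun j _ => ?_
        ring)
      (by simpa only [hF] using hexp.memLp_two)
      (by simpa only [hF] using ((hsum.const_mul _).mul hexp).memLp_two)
    simp only [hF]
    rw [RCLike.ofReal_eq_complex_ofReal] at this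
    exact this
  have i1 : ∀ i, Integrable (fun ω => Complex.I * c * ((He (p + 1) (ξ i ω) : ℂ) *
      Complex.exp ((t * chaosSum ξ (p + 1) w ω : ℝ) * Complex.I))) P := fun i =>
    ((((hξ.hasAllMoments_He (p + 1) i).ofReal (𝕜 := ℂ)).mul hexp).const_mul
      (Complex.I * c)).integrable
  have e1 : ∀ ω, Complex.I * ((chaosSum ξ (p + 1) w ω : ℂ) *
      Complex.exp ((t * chaosSum ξ (p + 1) w ω : ℝ) * Complex.I)) =
      ∑ i, Complex.I * c * ((He (p + 1) (ξ i ω) : ℂ) *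
        Complex.exp ((t * chaosSum ξ (p + 1) w ω : ℝ) * Complex.I)) := by
    intro ω
    rw [← Finset.mul_sum, ← Finset.sum_mul]
    generalize Complex.exp ((t * chaosSum ξ (p + 1) w ω : ℝ) * Complex.I) = E
    rw [hF ω]
    push_cast
    ring
  -- One `c` comes from the sum, the other from differentiating the exponent, and `p + 1` from
  -- differentiating `He_{p+1}`; `(p+1)/(p+1)! = 1/p!`.
  have hcc : c * c * (p + 1 : ℕ) = w ^ 2 / p.factorial := by
    have h1 : √((p + 1).factorial : ℝ) * √((p + 1).factorial : ℝ) = (p + 1) * p.factorial := by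
      rw [Real.mul_self_sqrt (by positivity), Nat.factorial_succ]; push_cast; ring
    have h2 : √((p + 1).factorial : ℝ) ≠ 0 := by positivity
    have h3 : (p.factorial : ℝ) ≠ 0 := by positivity
    rw [hc, div_mul_div_comm, h1]
    push_cast
    field_simp
  simp only [e1]
  rw [integral_finsetSum _ fun i _ => i1 i]
  simp only [integral_const_mul, ibp]
  have i2 : ∀ i, Integrable (fun ω => (He p (ξ i ω) : ℂ) * (Complex.I * t * c * (p + 1 : ℕ) *
        ((∑ j, corr ξ P i j * He p (ξ j ω) : ℝ) : ℂ) *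
        Complex.exp ((t * chaosSum ξ (p + 1) w ω : ℝ) * Complex.I))) P := by
    intro i
    have hsum : HasAllMoments (fun ω => ((∑ j, corr ξ P i j * He p (ξ j ω) : ℝ) : ℂ)) P :=
      (HasAllMoments.sum Finset.univ fun j _ =>
        (hξ.hasAllMoments_He p j).const_mul (corr ξ P i j)).ofReal
    exact (((hξ.hasAllMoments_He p i).ofReal (𝕜 := ℂ)).mul
      ((hsum.const_mul _).mul hexp)).integrable
  simp only [← integral_const_mul]
  rw [← integral_finsetSum _ fun i _ => (i2 i).const_mul _]
  congr 1
  ext ω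
  have hcc' : (c : ℂ) * c * (p + 1 : ℕ) = w ^ 2 / p.factorial := by exact_mod_cast hcc
  simp only [steinFactor]
  push_cast
  rw [Finset.sum_mul, Finset.mul_sum]
  refine Finset.sum_congr rfl fun i _ => ?_
  rw [Finset.mul_sum, Finset.sum_mul, Finset.sum_mul, Finset.mul_sum, Finset.mul_sum,
    Finset.mul_sum]
  refine Finset.sum_congr rfl fun j _ => ?_
  rw [← hcc']
  push_cast
  linear_combination (c * c * (p + 1) * t * corr ξ P i j * He p (ξ i ω) * He p (ξ j ω) *
    Complex.exp (t * chaosSum ξ (p + 1) w ω * Complex.I)) * Complex.I_mul_I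

/-- Replacing the Stein factor by its mean `V` leaves the differential equation `ψ' = -t V ψ` with a
remainder of size at most `|t|` times the standard deviation of the factor. -/
theorem IsStdGaussian.norm_integral_cexp_chaosSum_sub_le (hξ : IsStdGaussian ξ P) (p : ℕ) (w : ℝ)
    {V : ℝ} (hV : 0 ≤ V) (hVeq : V = w ^ 2 * ∑ i, ∑ j, corr ξ P i j ^ (p + 1)) (t : ℝ) :
    ‖∫ ω, Complex.exp ((t * chaosSum ξ (p + 1) w ω : ℝ) * Complex.I) ∂P -
        Complex.exp (-(V * t ^ 2 / 2 : ℝ))‖ ≤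
      t ^ 2 * √(∫ ω, steinFactor ξ P p w ω ^ 2 ∂P - V ^ 2) := by
  have hT := hξ.hasAllMoments_steinFactor p w
  have hTm : MemLp (fun ω => steinFactor ξ P p w ω - V) 2 P :=
    (hT.sub (hasAllMoments_const V)).memLp_two
  have hvar : ∫ ω, (steinFactor ξ P p w ω - V) ^ 2 ∂P =
      ∫ ω, steinFactor ξ P p w ω ^ 2 ∂P - V ^ 2 := by
    have i1 : Integrable (fun ω => steinFactor ξ P p w ω ^ 2) P := hT.memLp_two.integrable_sq
    have i2 : Integrable (fun ω => 2 * V * steinFactor ξ P p w ω) P := hT.integrable.const_mul _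
    have : ∀ ω, (steinFactor ξ P p w ω - V) ^ 2 =
        steinFactor ξ P p w ω ^ 2 - 2 * V * steinFactor ξ P p w ω + V ^ 2 := fun ω => by ring
    simp only [this]
    rw [integral_add (f := fun ω => steinFactor ξ P p w ω ^ 2 - 2 * V * steinFactor ξ P p w ω)
      (i1.sub i2) (integrable_const _), integral_sub i1 i2, integral_const_mul,
      hξ.integral_steinFactor, ← hVeq]
    simp
    ring
  have hF := hξ.hasAllMoments_chaosSum (p + 1) w
  have hm : AEMeasurable (chaosSum ξ (p + 1) w) P := hF.integrable.aemeasurable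
  rw [← hvar]
  refine norm_sub_exp_le_of_hasDerivAt (ψ := fun t : ℝ =>
      ∫ ω, Complex.exp ((t * chaosSum ξ (p + 1) w ω : ℝ) * Complex.I) ∂P)
    (r := fun t => -t * ∫ ω, ((steinFactor ξ P p w ω - V : ℝ) : ℂ) *
        Complex.exp ((t * chaosSum ξ (p + 1) w ω : ℝ) * Complex.I) ∂P) hV (Real.sqrt_nonneg _)
    (by simp) (fun t => ?_) (fun t => ?_) t
  · have h := hasDerivAt_integral_cexp hF t
    rw [hξ.integral_chaosSum_mul_cexp] at h
    convert! h using 1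
    have hexp := hasAllMoments_cexp hm t
    have i1 : Integrable (fun ω => (steinFactor ξ P p w ω : ℂ) *
        Complex.exp ((t * chaosSum ξ (p + 1) w ω : ℝ) * Complex.I)) P :=
      ((hT.ofReal (𝕜 := ℂ)).mul hexp).integrable
    have i2 := hexp.integrable.const_mul (V : ℂ)
    simp only [Complex.ofReal_sub, sub_mul]
    rw [integral_sub i1 i2, integral_const_mul]
    rw [Complex.ofReal_mul t V]
    ring
  · rw [norm_mul, norm_neg, Complex.norm_real, Real.norm_eq_abs]
    gcongr
    refine (norm_integral_le_integral_norm _).trans ?_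
    refine le_trans (le_of_eq ?_) (integral_abs_le_sqrt hTm)
    congr 1
    ext ω
    rw [norm_mul, Complex.norm_exp_ofReal_mul_I, Complex.norm_real, mul_one, Real.norm_eq_abs]

end FiniteChaos

/-- The main part of the fourfold moment sums to the squared mean exactly. What is left are cycles:
a factor `2` for the two crossing pairings and a factor `2` from `sum_cycle_le` give the `4`. -/
theorem sum_cycle_sub_le {ι : Type*} [Fintype ι] {r : ι → ι → ℝ} (hsymm : ∀ a b, r a b = r b a)
    {M : ι → ι → ι → ι → ℝ} {w K f : ℝ} (hw : 0 ≤ w) (hK : 0 ≤ K) (hf : 0 < f) {p : ℕ}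
    (hM : ∀ a b c d, |M a b c d - f * (r a b * r c d) ^ p| ≤
      K * ∑ q ∈ Finset.Icc 1 p, |r a b * r c d| ^ (p - q) *
        (|r a c * r b d| ^ q + |r a d * r b c| ^ q)) {U : ℕ → ℝ}
    (hU : ∀ q, 1 ≤ q → q ≤ p → ∀ i, ∑ j, w * |r i j| ^ q ≤ U q) :
    ∑ a, ∑ b, ∑ c, ∑ d, w ^ 4 / f * (r a b * r c d) * M a b c d -
      (w ^ 2 * ∑ a, ∑ b, r a b ^ (p + 1)) ^ 2 ≤
    4 * K / f * ((w ^ 2 * ∑ a, ∑ b, |r a b| ^ (p + 1)) *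
        ∑ q ∈ Finset.Icc 1 p, U q * U (p + 1 - q)) := by
  have hV2 : (w ^ 2 * ∑ a, ∑ b, r a b ^ (p + 1)) ^ 2 =
      ∑ a, ∑ b, ∑ c, ∑ d, w ^ 4 / f * (r a b * r c d) * (f * (r a b * r c d) ^ p) := by
    rw [mul_pow, pow_two (∑ i, _)]
    rw [Finset.sum_mul, Finset.mul_sum]
    refine Finset.sum_congr rfl fun a _ => ?_
    rw [Finset.sum_mul, Finset.mul_sum]
    refine Finset.sum_congr rfl fun b _ => ?_
    rw [Finset.mul_sum, Finset.mul_sum]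
    refine Finset.sum_congr rfl fun c _ => ?_
    rw [Finset.mul_sum, Finset.mul_sum]
    refine Finset.sum_congr rfl fun d _ => ?_
    field_simp
    ring
  rw [hV2]
  simp only [← Finset.sum_sub_distrib]
  -- The prefactor `r a b * r c d` raises the exponent `p - q` by one. Exchanging `c` and `d` in `Z`
  -- yields the other crossing pairing.
  set Z : ℕ → ι → ι → ι → ι → ℝ := fun q a b c d =>
    w ^ 4 * ((|r a b| * |r c d|) ^ (p + 1 - q) * (|r a c| * |r b d|) ^ q) with hZ
  have hterm : ∀ a b c d, w ^ 4 / f * (r a b * r c d) * M a b c d -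
      w ^ 4 / f * (r a b * r c d) * (f * (r a b * r c d) ^ p) ≤
      ∑ q ∈ Finset.Icc 1 p, K / f * (Z q a b c d + Z q a b d c) := by
    intro a b c d
    calc _ ≤ w ^ 4 / f * |r a b * r c d| * |M a b c d - f * (r a b * r c d) ^ p| := by
          rw [← mul_sub]
          refine (le_abs_self _).trans (le_of_eq ?_)
          rw [abs_mul, abs_mul, abs_of_nonneg (a := w ^ 4 / _) (by positivity)]
      _ ≤ w ^ 4 / f * |r a b * r c d| *
          (K * ∑ q ∈ Finset.Icc 1 p, |r a b * r c d| ^ (p - q) *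
            (|r a c * r b d| ^ q + |r a d * r b c| ^ q)) :=
          mul_le_mul_of_nonneg_left (hM a b c d) (by positivity)
      _ = _ := by
          simp only [Finset.mul_sum]
          refine Finset.sum_congr rfl fun q hq => ?_
          have hq' := Finset.mem_Icc.1 hq
          have : p + 1 - q = p - q + 1 := by omega
          simp only [hZ, this, hsymm d c, abs_mul]
          ring
  have hcyc : ∀ q ∈ Finset.Icc 1 p, ∑ a, ∑ b, ∑ c, ∑ d, Z q a b c d ≤
      2 * (w ^ 2 * ∑ a, ∑ b, |r a b| ^ (p + 1)) * (U q * U (p + 1 - q)) := by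
    intro q hq
    have hq' := Finset.mem_Icc.1 hq
    exact sum_cycle_le (ρ := fun i j => |r i j|) (fun _ _ => abs_nonneg _)
      (fun a b => by simp only [hsymm a b]) hw (by omega)
      (hU q hq'.1 hq'.2) (hU (p + 1 - q) (by omega) (by omega))
  have hswap : ∀ g : ι → ι → ι → ι → ℕ → ℝ,
      ∑ a, ∑ b, ∑ c, ∑ d, ∑ q ∈ Finset.Icc 1 p, g a b c d q =
        ∑ q ∈ Finset.Icc 1 p, ∑ a, ∑ b, ∑ c, ∑ d, g a b c d q := by
    intro g
    simp only [Finset.sum_comm (t := Finset.Icc 1 p)]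
  calc _ ≤ ∑ a, ∑ b, ∑ c, ∑ d, ∑ q ∈ Finset.Icc 1 p, K / f * (Z q a b c d + Z q a b d c) :=
        Finset.sum_le_sum fun a _ => Finset.sum_le_sum fun b _ => Finset.sum_le_sum fun c _ =>
          Finset.sum_le_sum fun d _ => hterm a b c d
    _ = ∑ q ∈ Finset.Icc 1 p, K / f * (2 * ∑ a, ∑ b, ∑ c, ∑ d, Z q a b c d) := by
        rw [hswap]
        refine Finset.sum_congr rfl fun q _ => ?_
        simp only [← Finset.mul_sum, Finset.sum_add_distrib]
        have hcd : ∑ a, ∑ b, ∑ c, ∑ d, Z q a b d c = ∑ a, ∑ b, ∑ c, ∑ d, Z q a b c d :=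
          Finset.sum_congr rfl fun a _ => Finset.sum_congr rfl fun b _ => Finset.sum_comm
        rw [hcd, two_mul]
    _ ≤ ∑ q ∈ Finset.Icc 1 p, K / f * (2 *
        (2 * (w ^ 2 * ∑ a, ∑ b, |r a b| ^ (p + 1)) * (U q * U (p + 1 - q)))) := by
        refine Finset.sum_le_sum fun q hq => ?_
        exact mul_le_mul_of_nonneg_left (mul_le_mul_of_nonneg_left (hcyc q hq) zero_le_two)
          (by positivity)
    _ = _ := by
        simp only [Finset.mul_sum (s := Finset.Icc 1 p)]
        refine Finset.sum_congr rfl fun q _ => ?_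
        ring

/-- Quantitative normal approximation for a finite sum in a Hermite chaos of degree `p + 1`. -/
theorem exists_norm_integral_cexp_chaosSum_sub_le {Ω : Type*} [MeasurableSpace Ω] (T : Type*)
    (P : Measure Ω) [IsProbabilityMeasure P] (p : ℕ) : ∃ K : ℝ, 0 ≤ K ∧
      ∀ (X : T → Ω → ℝ), IsStdGaussian X P → ∀ (ι : Type) [Fintype ι] (τ : ι → T) (w : ℝ), 0 ≤ w →
      ∀ V : ℝ, 0 ≤ V → V = w ^ 2 * ∑ i, ∑ j, corr X P (τ i) (τ j) ^ (p + 1) → ∀ U : ℕ → ℝ,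
      (∀ q, 1 ≤ q → q ≤ p → ∀ i, ∑ j, w * |corr X P (τ i) (τ j)| ^ q ≤ U q) → ∀ t : ℝ,
      ‖∫ ω, Complex.exp ((t * chaosSum (fun i => X (τ i)) (p + 1) w ω : ℝ) * Complex.I) ∂P -
        Complex.exp (-(V * t ^ 2 / 2 : ℝ))‖ ≤
      t ^ 2 * √(K * ((w ^ 2 * ∑ i, ∑ j, |corr X P (τ i) (τ j)| ^ (p + 1)) *
        ∑ q ∈ Finset.Icc 1 p, U q * U (p + 1 - q))) := by
  obtain ⟨K, hK, hM⟩ := exists_abs_hermiteMoment_sub_le T P p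
  refine ⟨4 * K / (p.factorial : ℝ) ^ 2, by positivity, ?_⟩
  intro X hX ι _ τ w hw V hV hVeq U hU t
  have hξ := hX.comp τ
  refine (hξ.norm_integral_cexp_chaosSum_sub_le p w hV hVeq t).trans ?_
  refine mul_le_mul_of_nonneg_left (Real.sqrt_le_sqrt ?_) (sq_nonneg t)
  rw [hξ.integral_sq_steinFactor, hVeq]
  exact sum_cycle_sub_le (r := fun i j => corr X P (τ i) (τ j))
    (fun a b => IsStdGaussian.corr_comm _ _) hw hK (by positivity)
    (fun a b c d => hM X hX (τ a) (τ b) (τ c) (τ d)) hU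

/-! ### The Hermite basis of `L²` of the standard Gaussian measure -/

/-- The identity as a one-point process: results on Gaussian processes then apply to the Gaussian
measure on the line itself. -/
theorem isStdGaussian_id : IsStdGaussian (fun _ : Unit => (id : ℝ → ℝ)) (gaussianReal 0 1) where
  gaussian := ⟨fun I => (IsGaussian.hasGaussianLaw_id (μ := gaussianReal 0 1)).map_fun
    (ContinuousLinearMap.pi fun _ : I => ContinuousLinearMap.id ℝ ℝ)⟩
  mean _ := by simp
  second _ := by
    have h := variance_of_integral_eq_zero (μ := gaussianReal 0 1) (X := (id : ℝ → ℝ))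
      aemeasurable_id (by simp)
    rw [variance_id_gaussianReal] at h
    simpa using h.symm

theorem memLp_normHermite (n : ℕ) : MemLp (normHermite n) 2 (gaussianReal 0 1) :=
  (isStdGaussian_id.hasAllMoments_normHermite n ()).memLp_two

theorem memLp_pow_mul_He (m n : ℕ) :
    MemLp (fun x : ℝ => x ^ m * He n x) 2 (gaussianReal 0 1) := by
  have h : HasAllMoments (fun x : ℝ => ∏ _i ∈ Finset.range m, x) (gaussianReal 0 1) :=
    HasAllMoments.prod _ fun _ _ => isStdGaussian_id.hasAllMoments ()
  simp only [Finset.prod_const, Finset.card_range] at h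
  exact (h.mul (isStdGaussian_id.hasAllMoments_He n ())).memLp_two

theorem IsStdGaussian.integral_normHermite_mul {T Ω : Type*} [MeasurableSpace Ω] {P : Measure Ω}
    [IsProbabilityMeasure P] {X : T → Ω → ℝ} (hX : IsStdGaussian X P) (s t : T) (m n : ℕ) :
    ∫ ω, normHermite m (X s ω) * normHermite n (X t ω) ∂P =
      if m = n then corr X P s t ^ m else 0 := by
  simp only [normHermite_eq, div_mul_div_comm]
  rw [integral_div, hX.integral_He_mul_He]
  split_ifs with h
  · subst h
    rw [Real.mul_self_sqrt (by positivity)]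
    have : (m.factorial : ℝ) ≠ 0 := by positivity
    field_simp
  · simp

/-- Since `x He_m = He_{m+1} + m He_{m-1}`, powers can be traded for Hermite polynomials one at a
time; the induction keeps `m` free. -/
theorem integral_mul_pow_eq_zero {g : ℝ → ℝ} (hg : MemLp g 2 (gaussianReal 0 1))
    (h : ∀ m, ∫ x, g x * He m x ∂(gaussianReal 0 1) = 0) (n : ℕ) :
    ∫ x, g x * x ^ n ∂(gaussianReal 0 1) = 0 := by
  suffices H : ∀ n m, ∫ x, g x * (x ^ n * He m x) ∂(gaussianReal 0 1) = 0 by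
    simpa [He_zero] using H n 0
  intro n
  induction n with
  | zero => simpa using h
  | succ n ih =>
    intro m
    have e : ∀ x, g x * (x ^ (n + 1) * He m x) =
        g x * (x ^ n * He (m + 1) x) + m * (g x * (x ^ n * He (m - 1) x)) := by
      intro x; rw [He_succ]; ring
    simp only [e]
    rw [integral_add, integral_const_mul, ih, ih]
    · simp
    · exact hg.integrable_mul (memLp_pow_mul_He n (m + 1))
    · exact (hg.integrable_mul (memLp_pow_mul_He n (m - 1))).const_mul _

theorem memLp_exp_mul_abs (t : ℝ) :
    MemLp (fun x => Real.exp (|t * x|)) 2 (gaussianReal 0 1) := by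
  have h : ∀ t : ℝ, MemLp (fun x => Real.exp (t * x)) 2 (gaussianReal 0 1) := by
    intro t
    rw [memLp_two_iff_integrable_sq (by fun_prop)]
    have := integrable_exp_mul_gaussianReal (μ := 0) (v := 1) (2 * t)
    refine this.congr (ae_of_all _ fun x => ?_)
    simp only [← Real.exp_nat_mul]
    congr 1; push_cast; ring
  refine ((h t).add (h (-t))).mono (by fun_prop) (ae_of_all _ fun x => ?_)
  simp only [Pi.add_apply, Real.norm_eq_abs, Real.abs_exp]
  refine le_trans ?_ (le_abs_self _)
  rcases abs_cases (t * x) with ⟨h1, _⟩ | ⟨h1, _⟩ <;> rw [h1]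
  · linarith [Real.exp_pos (-t * x)]
  · rw [← neg_mul]; linarith [Real.exp_pos (t * x)]

/-- The exponential series may be integrated term by term: its partial sums are dominated by `|g|
e^{|t x|}`, a product of two square integrable functions. -/
theorem integral_mul_cexp_eq_zero {g : ℝ → ℝ} (hg : MemLp g 2 (gaussianReal 0 1))
    (h : ∀ n, ∫ x, g x * x ^ n ∂(gaussianReal 0 1) = 0) (t : ℝ) :
    ∫ x, (g x : ℂ) * Complex.exp (t * x * Complex.I) ∂(gaussianReal 0 1) = 0 := by
  have hgm : AEStronglyMeasurable (fun x => (g x : ℂ)) (gaussianReal 0 1) :=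
    hg.ofReal.aestronglyMeasurable
  have hsum : ∀ x, HasSum (fun n : ℕ => |g x| * (|t * x| ^ n / n.factorial))
      (|g x| * Real.exp (|t * x|)) := by
    intro x
    refine HasSum.mul_left _ ?_
    rw [Real.exp_eq_exp_ℝ]
    exact NormedSpace.exp_series_hasSum_exp' (𝕂 := ℝ) (|t * x|) |>.congr_fun (fun n => by
      simp [div_eq_inv_mul])
  have key := hasSum_integral_of_dominated_convergence (μ := gaussianReal 0 1)
    (F := fun (n : ℕ) (x : ℝ) => (g x : ℂ) * ((t * x * Complex.I) ^ n / n.factorial))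
    (f := fun x => (g x : ℂ) * Complex.exp (t * x * Complex.I))
    (fun n x => |g x| * (|t * x| ^ n / n.factorial)) (fun n => ?_) (fun n => ?_) ?_ ?_ ?_
  · have h0 : ∀ n : ℕ, ∫ x, (g x : ℂ) * ((t * x * Complex.I) ^ n / n.factorial)
        ∂(gaussianReal 0 1) = 0 := by
      intro n
      have e : ∀ x : ℝ, (g x : ℂ) * ((t * x * Complex.I) ^ n / n.factorial) =
          ((t * Complex.I) ^ n / n.factorial) * ((g x * x ^ n : ℝ) : ℂ) := by
        intro x; push_cast; ring
      simp only [e]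
      rw [integral_const_mul, integral_complex_ofReal, h n]
      simp
    simp only [h0] at key
    exact key.unique hasSum_zero
  · exact hgm.mul (Continuous.aestronglyMeasurable (by fun_prop))
  · refine ae_of_all _ fun x => le_of_eq ?_
    simp [abs_mul]
  · exact ae_of_all _ fun x => (hsum x).summable
  · simp only [fun x => (hsum x).tsum_eq]
    exact hg.abs.integrable_mul (memLp_exp_mul_abs t)
  · refine ae_of_all _ fun x => HasSum.mul_left _ ?_
    rw [Complex.exp_eq_exp_ℂ]
    exact NormedSpace.exp_series_hasSum_exp' (𝕂 := ℂ) _ |>.congr_fun (fun n => by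
      simp [div_eq_inv_mul])

/-- The Hermite polynomials are complete in `L²` of the standard Gaussian measure. -/
theorem ae_eq_zero_of_integral_mul_He {g : ℝ → ℝ} (hg : MemLp g 2 (gaussianReal 0 1))
    (h : ∀ m, ∫ x, g x * He m x ∂(gaussianReal 0 1) = 0) : g =ᵐ[gaussianReal 0 1] 0 := by
  set γ := gaussianReal 0 1 with hγ
  have hgi : Integrable g γ := hg.integrable (by norm_num)
  have hexp := integral_mul_cexp_eq_zero hg (integral_mul_pow_eq_zero hg h)
  have hp : AEMeasurable (fun x => ENNReal.ofReal (g x)) γ := hgi.aemeasurable.ennreal_ofReal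
  have hn : AEMeasurable (fun x => ENNReal.ofReal (-g x)) γ := hgi.aemeasurable.neg.ennreal_ofReal
  have hpf : ∫⁻ x, ENNReal.ofReal (g x) ∂γ ≠ ⊤ := hgi.lintegral_lt_top.ne
  have hnf : ∫⁻ x, ENNReal.ofReal (-g x) ∂γ ≠ ⊤ := hgi.neg.lintegral_lt_top.ne
  have : IsFiniteMeasure (γ.withDensity fun x => ENNReal.ofReal (g x)) :=
    isFiniteMeasure_withDensity hpf
  have : IsFiniteMeasure (γ.withDensity fun x => ENNReal.ofReal (-g x)) :=
    isFiniteMeasure_withDensity hnf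
  -- The positive and negative parts of `g` are densities of finite measures whose characteristic
  -- functions agree, so the parts agree almost everywhere; as one of them vanishes at each point,
  -- both do.
  have heq : γ.withDensity (fun x => ENNReal.ofReal (g x)) =
      γ.withDensity (fun x => ENNReal.ofReal (-g x)) := by
    refine Measure.ext_of_charFun (funext fun t => ?_)
    have hbd : ∀ u : ℝ → ℝ, Integrable u γ →
        Integrable (fun x => (u x : ℂ) * Complex.exp (t * x * Complex.I)) γ := by
      intro u hu
      refine hu.ofReal.mul_bdd (c := 1) (Continuous.aestronglyMeasurable (by fun_prop))
        (ae_of_all _ fun x => ?_)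
      rw [← Complex.ofReal_mul, Complex.norm_exp_ofReal_mul_I]
    rw [charFun_apply_real, charFun_apply_real,
      integral_withDensity_eq_integral_toReal_smul₀ hp (by simp),
      integral_withDensity_eq_integral_toReal_smul₀ hn (by simp), ← sub_eq_zero]
    simp only [Complex.real_smul]
    rw [← integral_sub]
    · rw [← hexp t]
      congr 1
      ext x
      rw [← sub_mul, ← Complex.ofReal_sub]
      congr 2
      simp only [ENNReal.toReal_ofReal']
      rw [max_zero_sub_max_neg_zero_eq_self]
    · exact hbd _ (by simpa using integrable_toReal_of_lintegral_ne_top hp hpf)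
    · exact hbd _ (by simpa using integrable_toReal_of_lintegral_ne_top hn hnf)
  rw [withDensity_eq_iff hp hn hpf] at heq
  filter_upwards [heq] with x hx
  rcases le_total 0 (g x) with h0 | h0
  · have : ENNReal.ofReal (-g x) = 0 := ENNReal.ofReal_eq_zero.2 (by linarith)
    rw [this, ENNReal.ofReal_eq_zero] at hx
    exact le_antisymm hx h0
  · have : ENNReal.ofReal (g x) = 0 := ENNReal.ofReal_eq_zero.2 h0
    rw [this, eq_comm, ENNReal.ofReal_eq_zero] at hx
    exact le_antisymm h0 (by simpa using hx)

/-- The class of `H_m` in `L²` of the Gaussian measure. -/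
noncomputable def hermiteLp (m : ℕ) : Lp ℝ 2 (gaussianReal 0 1) := (memLp_normHermite m).toLp _

theorem inner_toLp {Ω : Type*} [MeasurableSpace Ω] {P : Measure Ω} {f g : Ω → ℝ} (hf : MemLp f 2 P)
    (hg : MemLp g 2 P) : inner ℝ (hf.toLp f) (hg.toLp g) = ∫ ω, f ω * g ω ∂P := by
  rw [L2.inner_def]
  refine integral_congr_ae ?_
  filter_upwards [hf.coeFn_toLp, hg.coeFn_toLp] with ω h1 h2
  rw [h1, h2]
  simp [mul_comm]

theorem orthonormal_hermiteLp : Orthonormal ℝ hermiteLp := by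
  rw [orthonormal_iff_ite]
  intro m n
  have h := isStdGaussian_id.integral_normHermite_mul () () m n
  rw [isStdGaussian_id.corr_self, one_pow] at h
  rw [hermiteLp, hermiteLp, inner_toLp]
  exact h

theorem span_hermiteLp_orthogonal_eq_bot : (Submodule.span ℝ (Set.range hermiteLp))ᗮ = ⊥ := by
  rw [Submodule.eq_bot_iff]
  intro g hg
  rw [Submodule.mem_orthogonal] at hg
  rw [← Lp.toLp_coeFn g (Lp.memLp g)] at hg ⊢
  have h0 : (g : ℝ → ℝ) =ᵐ[gaussianReal 0 1] 0 := by
    refine ae_eq_zero_of_integral_mul_He (Lp.memLp g) fun m => ?_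
    have := hg (hermiteLp m) (Submodule.subset_span ⟨m, rfl⟩)
    rw [hermiteLp, inner_toLp] at this
    simp only [normHermite_eq, div_mul_eq_mul_div] at this
    rw [integral_div, div_eq_zero_iff] at this
    rcases this with h | h
    · simpa only [mul_comm] using h
    · exact absurd h (by positivity)
  rw [MemLp.toLp_eq_toLp_iff (Lp.memLp g) (MemLp.zero)|>.2 h0]
  rfl

/-- The Hilbert basis of `L²` of the Gaussian measure formed by the Hermite polynomials. -/
noncomputable def hermiteBasis : HilbertBasis ℕ ℝ (Lp ℝ 2 (gaussianReal 0 1)) :=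
  HilbertBasis.mkOfOrthogonalEqBot orthonormal_hermiteLp span_hermiteLp_orthogonal_eq_bot

theorem hasSum_hermiteCoeff_smul {φ : ℝ → ℝ} (hφ : MemLp φ 2 (gaussianReal 0 1)) :
    HasSum (fun n => hermiteCoeff φ n • hermiteLp n) (hφ.toLp φ) := by
  have h := hermiteBasis.hasSum_repr (hφ.toLp φ)
  convert! h using 1
  ext1 n
  rw [hermiteBasis.repr_apply_apply, hermiteBasis, HilbertBasis.coe_mkOfOrthogonalEqBot, hermiteLp,
    inner_toLp, hermiteCoeff]
  simp only [mul_comm]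

/-! ### Mehler's formula and truncation of the Hermite series -/

section Mehler

variable {T Ω : Type*} [MeasurableSpace Ω] {P : Measure Ω} [IsProbabilityMeasure P]
  {X : T → Ω → ℝ}

theorem IsStdGaussian.measurePreserving (hX : IsStdGaussian X P) {t : T} (ht : Measurable (X t)) :
    MeasurePreserving (X t) P (gaussianReal 0 1) := ⟨ht, hX.map_eq t⟩

/-- Mehler's formula for the covariance of a function at two times of a standardized process. -/
theorem IsStdGaussian.hasSum_hermiteCoeff_sq_mul (hX : IsStdGaussian X P)
    (hm : ∀ t, Measurable (X t)) {φ : ℝ → ℝ} (hφ : MemLp φ 2 (gaussianReal 0 1)) (s t : T) :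
    HasSum (fun n => hermiteCoeff φ n ^ 2 * corr X P s t ^ n)
      (∫ ω, φ (X s ω) * φ (X t ω) ∂P) := by
  -- Composition with `X t` is an isometry of `L²` spaces, so the Hermite expansion of `φ` can be
  -- pushed to `L²(P)` and paired there, first at `s` and then at `t`.
  let C : T → (Lp ℝ 2 (gaussianReal 0 1) →L[ℝ] Lp ℝ 2 P) := fun t =>
    (Lp.compMeasurePreservingₗᵢ ℝ (X t) (hX.measurePreserving (hm t))).toContinuousLinearMap
  have hC : ∀ t (ψ : ℝ → ℝ) (hψ : MemLp ψ 2 (gaussianReal 0 1)), C t (hψ.toLp ψ) =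
      (hψ.comp_measurePreserving (hX.measurePreserving (hm t))).toLp (ψ ∘ X t) := fun t ψ hψ => rfl
  have h1 : ∀ n, inner ℝ (C s (hφ.toLp φ)) (C t (hermiteLp n)) =
      hermiteCoeff φ n * corr X P s t ^ n := by
    intro n
    have h := (hasSum_hermiteCoeff_smul hφ).mapL (C s)
    have h2 := h.mapL (innerSL ℝ (C t (hermiteLp n)))
    simp only [innerSL_apply_apply] at h2
    rw [real_inner_comm]
    refine h2.unique ?_
    have e : ∀ m, inner ℝ (C t (hermiteLp n)) (C s (hermiteCoeff φ m • hermiteLp m)) =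
        if m = n then hermiteCoeff φ n * corr X P s t ^ n else 0 := by
      intro m
      rw [map_smul, inner_smul_right, hermiteLp, hermiteLp, hC, hC, inner_toLp]
      have := hX.integral_normHermite_mul t s n m
      simp only [Function.comp]
      rw [this]
      by_cases hmn : m = n
      · subst hmn; simp [IsStdGaussian.corr_comm t s]
      · simp [hmn, Ne.symm hmn]
    simp only [e]
    exact hasSum_ite_eq n _
  have h := ((hasSum_hermiteCoeff_smul hφ).mapL (C t)).mapL (innerSL ℝ (C s (hφ.toLp φ)))
  simp only [innerSL_apply_apply, map_smul, h1] at h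
  rw [hC, hC, inner_toLp] at h
  convert! h using 1
  ext n
  ring

/-- `E φ(X_s) φ(X_t)` up to its term of degree `k`, for `φ` without terms of another degree less
than `N`. -/
theorem IsStdGaussian.abs_integral_mul_sub_le (hX : IsStdGaussian X P)
    (hm : ∀ t, Measurable (X t)) {φ : ℝ → ℝ} (hφ : MemLp φ 2 (gaussianReal 0 1)) {k N : ℕ}
    (h0 : ∀ n, n < N → n ≠ k → hermiteCoeff φ n = 0) (s t : T) :
    |∫ ω, φ (X s ω) * φ (X t ω) ∂P - hermiteCoeff φ k ^ 2 * corr X P s t ^ k| ≤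
      |corr X P s t| ^ N * ∫ x, φ x ^ 2 ∂(gaussianReal 0 1) := by
  -- Parseval's identity is Mehler's formula at correlation `1`.
  have hsq : HasSum (fun n => hermiteCoeff φ n ^ 2) (∫ x, φ x ^ 2 ∂(gaussianReal 0 1)) := by
    have := isStdGaussian_id.hasSum_hermiteCoeff_sq_mul (fun _ => measurable_id) hφ () ()
    rw [isStdGaussian_id.corr_self] at this
    simpa [← pow_two] using this
  have h1 := (hX.hasSum_hermiteCoeff_sq_mul hm hφ s t)
  have h2 : HasSum (fun n => if n = k then hermiteCoeff φ k ^ 2 * corr X P s t ^ k else 0)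
      (hermiteCoeff φ k ^ 2 * corr X P s t ^ k) := hasSum_ite_eq k _
  have h3 := h1.sub h2
  rw [← Real.norm_eq_abs, ← h3.tsum_eq]
  refine tsum_of_norm_bounded (hsq.mul_left (|corr X P s t| ^ N)) fun n => ?_
  by_cases hn : n = k
  · subst hn
    simp
    positivity
  · simp only [hn, if_false, sub_zero, norm_mul, norm_pow, Real.norm_eq_abs, sq_abs]
    rcases lt_or_ge n N with hlt | hge
    · simp [h0 n hlt hn]
    · rw [mul_comm]
      exact mul_le_mul_of_nonneg_right
        (pow_le_pow_of_le_one (abs_nonneg _) (hX.abs_corr_le_one s t) hge) (sq_nonneg _)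

end Mehler

/-! ### Measurable Gaussian processes with stationary increments -/

/-- Continuity of translation in `L¹`. -/
theorem tendsto_integral_norm_translate_sub {g : ℝ → ℂ} (hg : Integrable g) :
    Tendsto (fun h : ℝ => ∫ x, ‖g (x + h) - g x‖) (𝓝 0) (𝓝 0) := by
  have hmp : ∀ h : ℝ, MeasurePreserving (fun x : ℝ => x + h) volume volume := fun h =>
    measurePreserving_add_right volume h
  have hgL : MemLp g 1 volume := memLp_one_iff_integrable.2 hg
  let τ : ℝ → C(ℝ, ℝ) := fun h => ⟨fun x => x + h, by fun_prop⟩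
  have hτ : Continuous τ := ContinuousMap.continuous_of_continuous_uncurry _ (by
    simp only [τ, Function.uncurry_def, ContinuousMap.coe_mk]; fun_prop)
  have key : Tendsto (fun h => Lp.compMeasurePreserving (τ h) (hmp h) (hgL.toLp g)) (𝓝 0)
      (𝓝 (Lp.compMeasurePreserving (τ 0) (hmp 0) (hgL.toLp g))) :=
    Tendsto.compMeasurePreservingLp tendsto_const_nhds hτ.continuousAt (fun h => hmp h) (hmp 0)
      (by simp)
  have h2 := (tendsto_iff_norm_sub_tendsto_zero.1 key)
  refine h2.congr fun h => ?_
  have e : ∀ h, Lp.compMeasurePreserving (τ h) (hmp h) (hgL.toLp g) =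
      (hgL.comp_measurePreserving (hmp h)).toLp (g ∘ fun x => x + h) := fun h => rfl
  rw [e, e, ← MemLp.toLp_sub, Lp.norm_toLp, eLpNorm_one_eq_lintegral_enorm,
    integral_norm_eq_lintegral_enorm]
  · simp
  · exact ((hg.comp_add_right h).sub hg).aestronglyMeasurable

/-- A jointly measurable centred Gaussian process with stationary increments. -/
structure IsStationaryGaussian {Ω : Type*} [MeasurableSpace Ω] (G : ℝ → Ω → ℝ) (P : Measure Ω) :
    Prop where
  measurable : Measurable (fun p : ℝ × Ω => G p.1 p.2)
  gaussian : IsGaussianProcess G P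
  mean : ∀ x : ℝ, ∫ ω, G x ω ∂P = 0
  stationary : HasStationaryIncrements G P

/-- The normalized increments of a process. -/
noncomputable def normIncrement {Ω : Type*} [MeasurableSpace Ω] (G : ℝ → Ω → ℝ) (P : Measure Ω)
    (h x : ℝ) (ω : Ω) : ℝ :=
  (G (x + h) ω - G x ω) / √(incVar G P h)

namespace IsStationaryGaussian

variable {Ω : Type*} [MeasurableSpace Ω] {P : Measure Ω} [IsProbabilityMeasure P] {G : ℝ → Ω → ℝ}

theorem measurable_eval (hG : IsStationaryGaussian G P) (x : ℝ) : Measurable (G x) :=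
  hG.measurable.comp (measurable_const.prodMk measurable_id)

theorem memLp_sub (hG : IsStationaryGaussian G P) (x y : ℝ) :
    MemLp (fun ω => G x ω - G y ω) 2 P :=
  (hG.gaussian.hasGaussianLaw_fun_sub (s := x) (t := y)).memLp_two

theorem integral_sub_eq_zero (hG : IsStationaryGaussian G P) (x y : ℝ) :
    ∫ ω, (G x ω - G y ω) ∂P = 0 := by
  rw [integral_sub (hG.gaussian.hasGaussianLaw_eval x).integrable
    (hG.gaussian.hasGaussianLaw_eval y).integrable, hG.mean, hG.mean, sub_zero]

/-- The shifted and the unshifted increment processes have the same law; evaluate both at the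
coordinate `x - y`. -/
theorem incVar_sub (hG : IsStationaryGaussian G P) (x y : ℝ) :
    ∫ ω, (G x ω - G y ω) ^ 2 ∂P = incVar G P (x - y) := by
  have h := hG.stationary y
  have hm : ∀ y : ℝ, Measurable (fun ω (x : ℝ) => G (x + y) ω - G y ω) := fun y =>
    measurable_pi_lambda _ fun x => (hG.measurable_eval _).sub (hG.measurable_eval _)
  have hm0 : Measurable (fun ω (x : ℝ) => G x ω - G 0 ω) :=
    measurable_pi_lambda _ fun x => (hG.measurable_eval _).sub (hG.measurable_eval _)
  have hev : Measurable (fun p : ℝ → ℝ => p (x - y) ^ 2) :=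
    (measurable_pi_apply (x - y)).pow_const 2
  have e1 := integral_map (μ := P) (hm y).aemeasurable hev.aestronglyMeasurable
  have e2 := integral_map (μ := P) hm0.aemeasurable hev.aestronglyMeasurable
  rw [h, e2] at e1
  simp only [sub_add_cancel] at e1
  exact e1.symm

theorem incVar_nonneg (h : ℝ) : 0 ≤ incVar G P h := integral_nonneg fun _ => sq_nonneg _

theorem map_sub_eq (hG : IsStationaryGaussian G P) (x y : ℝ) :
    P.map (fun ω => G x ω - G y ω) = gaussianReal 0 (incVar G P (x - y)).toNNReal := by
  have hl := hG.gaussian.hasGaussianLaw_fun_sub (s := x) (t := y)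
  rw [hl.map_eq_gaussianReal, hG.integral_sub_eq_zero,
    variance_of_integral_eq_zero hl.aemeasurable (hG.integral_sub_eq_zero x y), hG.incVar_sub]

theorem integral_cexp_sub (hG : IsStationaryGaussian G P) (x y : ℝ) :
    ∫ ω, Complex.exp ((G x ω - G y ω : ℝ) * Complex.I) ∂P =
      Real.exp (-incVar G P (x - y) / 2) := by
  have h := charFun_gaussianReal (μ := 0) (v := (incVar G P (x - y)).toNNReal) 1
  rw [← hG.map_sub_eq, charFun_apply_real, integral_map] at h
  · simp only [Complex.ofReal_one, one_mul] at h
    rw [h, Real.coe_toNNReal _ (incVar_nonneg _)]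
    push_cast
    congr 1
    ring
  · exact ((hG.measurable_eval x).sub (hG.measurable_eval y)).aemeasurable
  · exact Continuous.aestronglyMeasurable (by fun_prop)

/-- Joint measurability forces `σ²` to be continuous at `0`. -/
theorem tendsto_incVar_zero (hG : IsStationaryGaussian G P) :
    Tendsto (incVar G P) (𝓝 0) (𝓝 0) := by
  -- The bounded process `e^{iG}` replaces `G`, so that measurable paths are locally integrable with
  -- no further assumption.
  let U : ℝ → Ω → ℂ := fun x ω => Complex.exp (G x ω * Complex.I)
  have hUm : Measurable (fun p : ℝ × Ω => U p.1 p.2) :=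
    Complex.measurable_exp.comp ((Complex.measurable_ofReal.comp hG.measurable).mul_const _)
  have hUn : ∀ x ω, ‖U x ω‖ = 1 := fun x ω => Complex.norm_exp_ofReal_mul_I _
  let D : ℝ → ℝ := fun h => ∫ ω, (∫ x in (0 : ℝ)..1, ‖U (x + h) ω - U x ω‖) ∂P
  have hbd : ∀ h x ω, ‖U (x + h) ω - U x ω‖ ≤ 2 := fun h x ω =>
    (norm_sub_le _ _).trans (by rw [hUn, hUn]; norm_num)
  have hmeas : ∀ h, Measurable (fun p : ℝ × Ω => ‖U (p.1 + h) p.2 - U p.1 p.2‖) := by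
    intro h
    have h1 : Measurable (fun p : ℝ × Ω => U (p.1 + h) p.2) :=
      hUm.comp ((measurable_fst.add_const h).prodMk measurable_snd)
    exact (h1.sub hUm).norm
  have hint : ∀ h, Integrable (fun p : ℝ × Ω => ‖U (p.1 + h) p.2 - U p.1 p.2‖)
      ((volume.restrict (Ioc (0 : ℝ) 1)).prod P) := fun h =>
    Integrable.of_bound (hmeas h).aestronglyMeasurable 2
      (ae_of_all _ fun p => by simpa using hbd h p.1 p.2)
  have hD0 : Tendsto D (𝓝 0) (𝓝 0) := by
    have hfib : ∀ ω, Tendsto (fun h => ∫ x in (0 : ℝ)..1, ‖U (x + h) ω - U x ω‖) (𝓝 0) (𝓝 0) := by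
      intro ω
      have hum : Measurable (fun x => U x ω) := hUm.comp (measurable_id.prodMk measurable_const)
      -- The window contains both `x` and `x + h` for `x ∈ (0, 1]` and `|h| < 1`.
      let g : ℝ → ℂ := (Icc (-1 : ℝ) 2).indicator (fun x => U x ω)
      have hg : Integrable g := by
        refine IntegrableOn.integrable_indicator ?_ measurableSet_Icc
        exact Measure.integrableOn_of_bounded (M := 1) (by simp) hum.aestronglyMeasurable
          (ae_of_all _ fun x => (hUn x ω).le)
      have ht := tendsto_integral_norm_translate_sub hg
      refine tendsto_of_tendsto_of_tendsto_of_le_of_le' tendsto_const_nhds ht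
        (Eventually.of_forall fun h => intervalIntegral.integral_nonneg zero_le_one
          fun x _ => norm_nonneg _) ?_
      filter_upwards [Metric.ball_mem_nhds (0 : ℝ) one_pos] with h hh
      rw [Metric.mem_ball, dist_zero_right, Real.norm_eq_abs, abs_lt] at hh
      rw [intervalIntegral.integral_of_le zero_le_one]
      have : ∫ x in Ioc (0 : ℝ) 1, ‖U (x + h) ω - U x ω‖ =
          ∫ x in Ioc (0 : ℝ) 1, ‖g (x + h) - g x‖ := by
        refine setIntegral_congr_fun measurableSet_Ioc fun x hx => ?_
        have h1 : x ∈ Icc (-1 : ℝ) 2 := ⟨by linarith [hx.1], by linarith [hx.2]⟩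
        have h2 : x + h ∈ Icc (-1 : ℝ) 2 := ⟨by linarith [hx.1, hh.1], by linarith [hx.2, hh.2]⟩
        simp only [g, indicator_of_mem h1, indicator_of_mem h2]
      rw [this]
      exact setIntegral_le_integral ((hg.comp_add_right h).sub hg).norm
        (ae_of_all _ fun x => norm_nonneg _)
    have := tendsto_integral_filter_of_dominated_convergence (μ := P) (l := 𝓝 (0 : ℝ))
      (F := fun h ω => ∫ x in (0 : ℝ)..1, ‖U (x + h) ω - U x ω‖) (f := fun _ => 0)
      (fun _ => (2 : ℝ)) ?_ ?_ (integrable_const _) (ae_of_all _ hfib)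
    · simpa using this
    · refine Eventually.of_forall fun h => ?_
      simp only [intervalIntegral.integral_of_le zero_le_one]
      exact (hint h).swap.integral_prod_left.aestronglyMeasurable
    · refine Eventually.of_forall fun h => ae_of_all _ fun ω => ?_
      have := intervalIntegral.norm_integral_le_of_norm_le_const (a := (0 : ℝ)) (b := 1)
        (f := fun x => ‖U (x + h) ω - U x ω‖) (C := 2) (fun x _ => by simpa using hbd h x ω)
      simpa using this
  -- As `|U| = 1`, the mean of `|U(x+h) - U(x)|` is that of `|e^{iΔ} - 1|` for the increment `Δ`,
  -- hence at least `1 - E e^{iΔ}`, which does not depend on `x`.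
  have hle : ∀ h, 1 - Real.exp (-incVar G P h / 2) ≤ D h := by
    intro h
    have hpt : ∀ x, 1 - Real.exp (-incVar G P h / 2) ≤ ∫ ω, ‖U (x + h) ω - U x ω‖ ∂P := by
      intro x
      have e := hG.integral_cexp_sub (x + h) x
      rw [add_sub_cancel_left] at e
      have hexp : ∀ ω, Complex.exp ((G (x + h) ω - G x ω : ℝ) * Complex.I) * U x ω = U (x + h) ω := by
        intro ω
        simp only [U]
        rw [← Complex.exp_add]
        congr 1
        push_cast
        ring
      have hi : Integrable (fun ω => Complex.exp ((G (x + h) ω - G x ω : ℝ) * Complex.I)) P := by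
        refine Integrable.of_bound (C := 1) ?_ (ae_of_all _ fun ω => ?_)
        · exact (Complex.measurable_exp.comp ((Complex.measurable_ofReal.comp
            ((hG.measurable_eval _).sub (hG.measurable_eval _))).mul_const _)).aestronglyMeasurable
        · rw [Complex.norm_exp_ofReal_mul_I]
      calc 1 - Real.exp (-incVar G P h / 2)
          ≤ ‖((Real.exp (-incVar G P h / 2) - 1 : ℝ) : ℂ)‖ := by
            rw [Complex.norm_real, Real.norm_eq_abs, abs_sub_comm]; exact le_abs_self _
        _ = ‖∫ ω, (Complex.exp ((G (x + h) ω - G x ω : ℝ) * Complex.I) - 1) ∂P‖ := by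
            rw [integral_sub hi (integrable_const _), e]; simp
        _ ≤ ∫ ω, ‖Complex.exp ((G (x + h) ω - G x ω : ℝ) * Complex.I) - 1‖ ∂P :=
            norm_integral_le_integral_norm _
        _ = ∫ ω, ‖U (x + h) ω - U x ω‖ ∂P := by
            congr 1
            ext ω
            rw [← hexp ω, ← sub_one_mul, norm_mul, hUn, mul_one]
    have hswap : D h = ∫ x in (0 : ℝ)..1, ∫ ω, ‖U (x + h) ω - U x ω‖ ∂P := by
      simp only [D, intervalIntegral.integral_of_le zero_le_one]
      exact (integral_integral_swap (f := fun x ω => ‖U (x + h) ω - U x ω‖) (hint h)).symm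
    rw [hswap]
    have := intervalIntegral.integral_mono_on (a := (0 : ℝ)) (b := 1) (μ := volume)
      (f := fun _ => 1 - Real.exp (-incVar G P h / 2))
      (g := fun x => ∫ ω, ‖U (x + h) ω - U x ω‖ ∂P) zero_le_one (by simp)
      ((intervalIntegrable_iff_integrableOn_Ioc_of_le zero_le_one).2 (hint h).integral_prod_left)
      (fun x _ => hpt x)
    simpa using this
  have hexp1 : Tendsto (fun h => Real.exp (-incVar G P h / 2)) (𝓝 0) (𝓝 1) := by
    refine tendsto_of_tendsto_of_tendsto_of_le_of_le (g := fun h => 1 - D h) (h := fun _ => 1)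
      (by simpa using hD0.const_sub 1) tendsto_const_nhds (fun h => by have := hle h; simp; linarith)
      (fun h => ?_)
    rw [Real.exp_le_one_iff]
    have := incVar_nonneg (G := G) (P := P) h
    linarith
  have := ((Real.continuousAt_log one_ne_zero).tendsto.comp hexp1).const_mul (-2)
  simp only [Function.comp_def, Real.log_exp, Real.log_one, mul_zero] at this
  refine this.congr fun h => by ring

/-! ### Continuity of the increments in `L²` and of the correlation kernel -/

/-- The increment from `0` as an element of `L²(P)`. -/
noncomputable def lpIncrement (hG : IsStationaryGaussian G P) (x : ℝ) : Lp ℝ 2 P :=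
  (hG.memLp_sub x 0).toLp _

theorem lpIncrement_sub (hG : IsStationaryGaussian G P) (x y : ℝ) :
    hG.lpIncrement x - hG.lpIncrement y = (hG.memLp_sub x y).toLp _ := by
  rw [lpIncrement, lpIncrement, ← MemLp.toLp_sub]
  refine MemLp.toLp_congr _ _ (ae_of_all _ fun ω => ?_)
  simp

theorem norm_lpIncrement_sub (hG : IsStationaryGaussian G P) (x y : ℝ) :
    ‖hG.lpIncrement x - hG.lpIncrement y‖ = √(incVar G P (x - y)) := by
  rw [lpIncrement_sub, ← hG.incVar_sub, norm_eq_sqrt_real_inner, inner_toLp]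
  simp only [pow_two]

/-- The distance between two increments depends only on `x - y`, so continuity of `σ²` at `0`
suffices everywhere. -/
theorem continuous_lpIncrement (hG : IsStationaryGaussian G P) : Continuous hG.lpIncrement := by
  rw [continuous_iff_continuousAt]
  intro y
  rw [ContinuousAt, tendsto_iff_norm_sub_tendsto_zero]
  simp only [norm_lpIncrement_sub]
  have h1 : Tendsto (fun x => x - y) (𝓝 y) (𝓝 0) := by
    have : Continuous (fun x : ℝ => x - y) := by fun_prop
    simpa using this.tendsto y
  simpa using (hG.tendsto_incVar_zero.comp h1).sqrt

theorem rho_eq_inner (hG : IsStationaryGaussian G P) (h x y : ℝ) :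
    rho G P h x y = inner ℝ (hG.lpIncrement (x + h) - hG.lpIncrement x)
      (hG.lpIncrement (y + h) - hG.lpIncrement y) / incVar G P h := by
  rw [lpIncrement_sub, lpIncrement_sub, inner_toLp, rho]

theorem continuous_rho (hG : IsStationaryGaussian G P) (h : ℝ) :
    Continuous (fun p : ℝ × ℝ => rho G P h p.1 p.2) := by
  simp only [hG.rho_eq_inner]
  have := hG.continuous_lpIncrement
  fun_prop

theorem incVar_eq_sq_norm (hG : IsStationaryGaussian G P) (x : ℝ) :
    √(incVar G P x) = ‖hG.lpIncrement x - hG.lpIncrement 0‖ := by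
  rw [hG.norm_lpIncrement_sub, sub_zero]

/-- If `σ(h) = 0`, the increments are `h`-periodic in `L²`, so `σ²(t)` equals `σ²` at the remainder
of `t` modulo `h`. For small `h` that value is below `σ²(t) > 0`, by continuity at `0`. -/
theorem eventually_incVar_pos (hG : IsStationaryGaussian G P) (hne : ∃ h, incVar G P h ≠ 0) :
    ∀ᶠ h in 𝓝[>] (0 : ℝ), 0 < incVar G P h := by
  obtain ⟨t₀, ht₀⟩ := hne
  have hsymm : ∀ x, incVar G P (-x) = incVar G P x := by
    intro x
    have h1 := hG.incVar_sub 0 x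
    have h2 := hG.incVar_sub x 0
    rw [zero_sub] at h1
    rw [sub_zero] at h2
    rw [← h1, ← h2]
    congr 1; ext ω; ring
  obtain ⟨t, ht0, ht⟩ : ∃ t : ℝ, 0 ≤ t ∧ incVar G P t ≠ 0 := by
    rcases le_total 0 t₀ with h | h
    · exact ⟨t₀, h, ht₀⟩
    · exact ⟨-t₀, by linarith, by rwa [hsymm]⟩
  have htpos : 0 < incVar G P t := lt_of_le_of_ne (incVar_nonneg t) ht.symm
  have hlt := hG.tendsto_incVar_zero.eventually (gt_mem_nhds htpos)
  obtain ⟨δ, hδ, hball⟩ := Metric.eventually_nhds_iff.1 hlt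
  filter_upwards [Ioo_mem_nhdsGT hδ] with h hh
  by_contra hcon
  have h0 : incVar G P h = 0 := le_antisymm (not_lt.1 hcon) (incVar_nonneg h)
  have hstep : ∀ x, hG.lpIncrement (x + h) = hG.lpIncrement x := by
    intro x
    rw [← sub_eq_zero, ← norm_eq_zero, norm_lpIncrement_sub, add_sub_cancel_left, h0, Real.sqrt_zero]
  have hmul : ∀ (n : ℕ) x, hG.lpIncrement (x + n * h) = hG.lpIncrement x := by
    intro n
    induction n with
    | zero => intro x; simp
    | succ n ih =>
      intro x
      have : x + (n + 1 : ℕ) * h = (x + n * h) + h := by push_cast; ring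
      rw [this, hstep, ih]
  have hr := hmul ⌊t / h⌋₊ (t - ⌊t / h⌋₊ * h)
  rw [sub_add_cancel] at hr
  have hrlt : incVar G P (t - ⌊t / h⌋₊ * h) < incVar G P t := by
    refine hball ?_
    have h1 : (⌊t / h⌋₊ : ℝ) * h ≤ t := by
      rw [← le_div_iff₀ hh.1]; exact Nat.floor_le (div_nonneg ht0 hh.1.le)
    have h2 : t < (⌊t / h⌋₊ + 1 : ℝ) * h := by
      rw [← div_lt_iff₀ hh.1]; exact Nat.lt_floor_add_one _
    rw [dist_zero_right, Real.norm_eq_abs, abs_of_nonneg (by linarith)]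
    linarith [hh.2]
  have e1 := hG.incVar_eq_sq_norm t
  rw [hr, ← hG.incVar_eq_sq_norm, Real.sqrt_inj (incVar_nonneg _) (incVar_nonneg _)] at e1
  linarith

/-! ### Normalized increments as a standardized process -/

theorem isStdGaussian_normIncrement (hG : IsStationaryGaussian G P) {h : ℝ}
    (hpos : 0 < incVar G P h) : IsStdGaussian (normIncrement G P h) P where
  gaussian := by
    classical
    refine hG.gaussian.of_isGaussianProcess fun x => ⟨{x + h, x},
      (√(incVar G P h))⁻¹ • (ContinuousLinearMap.proj (R := ℝ)
          (φ := fun _ : ({x + h, x} : Finset ℝ) => ℝ) ⟨x + h, by simp⟩ -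
        ContinuousLinearMap.proj (R := ℝ) (φ := fun _ : ({x + h, x} : Finset ℝ) => ℝ)
          ⟨x, by simp⟩), fun ω => ?_⟩
    simp [normIncrement, div_eq_inv_mul]
  mean x := by
    simp only [normIncrement]
    rw [integral_div, hG.integral_sub_eq_zero, zero_div]
  second x := by
    simp only [normIncrement, div_pow]
    rw [integral_div, hG.incVar_sub, add_sub_cancel_left, Real.sq_sqrt hpos.le, div_self hpos.ne']

theorem corr_normIncrement {h : ℝ} (hpos : 0 < incVar G P h) (x y : ℝ) :
    corr (normIncrement G P h) P x y = rho G P h x y := by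
  simp only [corr, normIncrement, rho, div_mul_div_comm]
  rw [integral_div, Real.mul_self_sqrt hpos.le]

theorem measurable_normIncrement_prod (hG : IsStationaryGaussian G P) (h : ℝ) :
    Measurable (fun p : ℝ × Ω => normIncrement G P h p.1 p.2) := by
  have h1 : Measurable (fun p : ℝ × Ω => G (p.1 + h) p.2) :=
    hG.measurable.comp ((measurable_fst.add_const h).prodMk measurable_snd)
  exact (h1.sub hG.measurable).div_const _

theorem continuous_integral_abs_rho_pow (hG : IsStationaryGaussian G P) (a b h : ℝ) (n : ℕ) :
    Continuous (fun x => ∫ y in a..b, |rho G P h x y| ^ n) := by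
  refine intervalIntegral.continuous_parametric_intervalIntegral_of_continuous' ?_ a b
  have := hG.continuous_rho h
  simp only [Function.uncurry_def]
  fun_prop

/-- The integrand is continuous, nonnegative and equal to `1` on the diagonal. -/
theorem rhoInt_pos (hG : IsStationaryGaussian G P) {a b h : ℝ} (hab : a < b)
    (hpos : 0 < incVar G P h) (n : ℕ) : 0 < rhoInt G P a b n h := by
  have hcont := hG.continuous_rho h
  have hX := hG.isStdGaussian_normIncrement hpos
  refine intervalIntegral.integral_pos hab
    (hG.continuous_integral_abs_rho_pow a b h n).continuousOn
    (fun x _ => intervalIntegral.integral_nonneg hab.le fun y _ => by positivity)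
    ⟨a, left_mem_Icc.2 hab.le, ?_⟩
  refine intervalIntegral.integral_pos hab
    (by fun_prop) (fun y _ => by positivity) ⟨a, left_mem_Icc.2 hab.le, ?_⟩
  rw [← corr_normIncrement hpos, hX.corr_self]
  simp

end IsStationaryGaussian

/-! ### Integrals of functions of a measurable standardized Gaussian process -/

section Functional

variable {S Ω : Type*} [MeasurableSpace S] [MeasurableSpace Ω] {P : Measure Ω}
  [IsProbabilityMeasure P] {X : S → Ω → ℝ} {ν : Measure S} {φ : ℝ → ℝ}

namespace IsStdGaussian

theorem measurable_of_prod (hXm : Measurable (fun p : S × Ω => X p.1 p.2)) (x : S) :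
    Measurable (X x) := hXm.comp (measurable_const.prodMk measurable_id)

/-- Every slice `X x` has the Gaussian law, so null sets pull back to null sets by Fubini. Functions
determined only almost everywhere may therefore be composed with the process. -/
theorem quasiMeasurePreserving (hX : IsStdGaussian X P)
    (hXm : Measurable (fun p : S × Ω => X p.1 p.2)) :
    Measure.QuasiMeasurePreserving (fun p : S × Ω => X p.1 p.2) (ν.prod P) (gaussianReal 0 1) := by
  refine ⟨hXm, Measure.AbsolutelyContinuous.mk fun s hs h0 => ?_⟩
  rw [Measure.map_apply hXm hs, Measure.measure_prod_null (hXm hs)]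
  refine ae_of_all _ fun x => ?_
  have := Measure.map_apply (μ := P) (measurable_of_prod hXm x) hs
  rw [hX.map_eq, h0] at this
  exact this.symm

theorem aestronglyMeasurable_comp (hX : IsStdGaussian X P)
    (hXm : Measurable (fun p : S × Ω => X p.1 p.2))
    (hφ : AEStronglyMeasurable φ (gaussianReal 0 1)) :
    AEStronglyMeasurable (fun p : S × Ω => φ (X p.1 p.2)) (ν.prod P) :=
  hφ.comp_quasiMeasurePreserving (hX.quasiMeasurePreserving hXm)

theorem memLp_comp (hX : IsStdGaussian X P) (hm : ∀ x, Measurable (X x))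
    (hφ : MemLp φ 2 (gaussianReal 0 1)) (x : S) : MemLp (fun ω => φ (X x ω)) 2 P :=
  hφ.comp_measurePreserving (hX.measurePreserving (hm x))

theorem integral_comp (hX : IsStdGaussian X P) (hm : ∀ x, Measurable (X x))
    (hφ : AEStronglyMeasurable φ (gaussianReal 0 1)) (x : S) :
    ∫ ω, φ (X x ω) ∂P = ∫ u, φ u ∂(gaussianReal 0 1) := by
  rw [← hX.map_eq x, integral_map (hm x).aemeasurable]
  rwa [hX.map_eq]

theorem integrable_comp [IsFiniteMeasure ν] (hX : IsStdGaussian X P)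
    (hXm : Measurable (fun p : S × Ω => X p.1 p.2)) (hφ : MemLp φ 2 (gaussianReal 0 1)) :
    Integrable (fun p : S × Ω => φ (X p.1 p.2)) (ν.prod P) := by
  have hm := measurable_of_prod hXm
  rw [integrable_prod_iff (hX.aestronglyMeasurable_comp hXm hφ.aestronglyMeasurable)]
  refine ⟨ae_of_all _ fun x => (hX.memLp_comp hm hφ x).integrable (by norm_num), ?_⟩
  simp only [fun x => hX.integral_comp hm (φ := fun u => ‖φ u‖) hφ.aestronglyMeasurable.norm x]
  exact integrable_const _

theorem ae_integrable_comp [IsFiniteMeasure ν] (hX : IsStdGaussian X P)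
    (hXm : Measurable (fun p : S × Ω => X p.1 p.2)) (hφ : MemLp φ 2 (gaussianReal 0 1)) :
    ∀ᵐ ω ∂P, Integrable (fun x => φ (X x ω)) ν :=
  (hX.integrable_comp hXm hφ).prod_left_ae

theorem integral_integral_comp [IsFiniteMeasure ν] (hX : IsStdGaussian X P)
    (hXm : Measurable (fun p : S × Ω => X p.1 p.2)) (hφ : MemLp φ 2 (gaussianReal 0 1)) :
    ∫ ω, (∫ x, φ (X x ω) ∂ν) ∂P = ν.real univ * ∫ u, φ u ∂(gaussianReal 0 1) := by
  rw [← integral_integral_swap (f := fun x ω => φ (X x ω)) (hX.integrable_comp hXm hφ)]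
  simp [fun x => hX.integral_comp (measurable_of_prod hXm) hφ.aestronglyMeasurable x]

/-- `|u v| ≤ (u² + v²) / 2`, and both variables have the same law. -/
theorem abs_integral_mul_le (hX : IsStdGaussian X P) (hm : ∀ x, Measurable (X x))
    (hφ : MemLp φ 2 (gaussianReal 0 1)) (x y : S) :
    ∫ ω, ‖φ (X x ω) * φ (X y ω)‖ ∂P ≤ ∫ u, φ u ^ 2 ∂(gaussianReal 0 1) := by
  have h2 : AEStronglyMeasurable (fun u => φ u ^ 2) (gaussianReal 0 1) :=
    hφ.aestronglyMeasurable.pow 2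
  have hi := fun x => (hX.memLp_comp hm hφ x).integrable_sq
  have e : ∫ u, φ u ^ 2 ∂(gaussianReal 0 1) = ∫ ω, (φ (X x ω) ^ 2 + φ (X y ω) ^ 2) / 2 ∂P := by
    rw [integral_div, integral_add (hi x) (hi y), hX.integral_comp hm (φ := fun u => φ u ^ 2) h2,
      hX.integral_comp hm (φ := fun u => φ u ^ 2) h2]
    ring
  rw [e]
  refine integral_mono ((hX.memLp_comp hm hφ x).integrable_mul (hX.memLp_comp hm hφ y)).norm
    (((hi x).add (hi y)).div_const 2) fun ω => ?_
  simp only [norm_mul, Real.norm_eq_abs]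
  nlinarith [sq_nonneg (|φ (X x ω)| - |φ (X y ω)|), sq_abs (φ (X x ω)), sq_abs (φ (X y ω))]

theorem integrable_comp_mul_comp [IsFiniteMeasure ν] (hX : IsStdGaussian X P)
    (hXm : Measurable (fun p : S × Ω => X p.1 p.2)) (hφ : MemLp φ 2 (gaussianReal 0 1)) :
    Integrable (fun p : (S × S) × Ω => φ (X p.1.1 p.2) * φ (X p.1.2 p.2))
      ((ν.prod ν).prod P) := by
  have hm := measurable_of_prod hXm
  have h1 := (hX.comp (Prod.fst : S × S → S)).aestronglyMeasurable_comp (ν := ν.prod ν)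
    (hXm.comp ((measurable_fst.comp measurable_fst).prodMk measurable_snd))
    hφ.aestronglyMeasurable
  have h2 := (hX.comp (Prod.snd : S × S → S)).aestronglyMeasurable_comp (ν := ν.prod ν)
    (hXm.comp ((measurable_snd.comp measurable_fst).prodMk measurable_snd))
    hφ.aestronglyMeasurable
  have h12 : AEStronglyMeasurable (fun p : (S × S) × Ω => φ (X p.1.1 p.2) * φ (X p.1.2 p.2))
      ((ν.prod ν).prod P) := h1.mul h2
  rw [integrable_prod_iff h12]
  refine ⟨ae_of_all _ fun p => (hX.memLp_comp hm hφ p.1).integrable_mul (hX.memLp_comp hm hφ p.2),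
    ?_⟩
  refine Integrable.of_bound (C := ∫ u, φ u ^ 2 ∂(gaussianReal 0 1))
    h12.norm.integral_prod_right' (ae_of_all _ fun p => ?_)
  rw [Real.norm_of_nonneg (integral_nonneg fun ω => norm_nonneg _)]
  exact hX.abs_integral_mul_le hm hφ p.1 p.2

/-- The square of the integral is the double integral of `φ(X_x) φ(X_y)`, which is integrable
jointly with `ω`. -/
theorem memLp_functional [IsFiniteMeasure ν] (hX : IsStdGaussian X P)
    (hXm : Measurable (fun p : S × Ω => X p.1 p.2)) (hφ : MemLp φ 2 (gaussianReal 0 1)) :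
    MemLp (fun ω => ∫ x, φ (X x ω) ∂ν) 2 P := by
  have hmeas : AEStronglyMeasurable (fun ω => ∫ x, φ (X x ω) ∂ν) P :=
    (hX.aestronglyMeasurable_comp hXm hφ.aestronglyMeasurable).prod_swap.integral_prod_right'
  refine (memLp_two_iff_integrable_sq hmeas).2 ?_
  refine (hX.integrable_comp_mul_comp (ν := ν) hXm hφ).integral_prod_right.congr
    (ae_of_all _ fun ω => ?_)
  simp only [pow_two]
  exact integral_prod_mul (fun x => φ (X x ω)) (fun x => φ (X x ω))

theorem integral_functional_sq [IsFiniteMeasure ν] (hX : IsStdGaussian X P)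
    (hXm : Measurable (fun p : S × Ω => X p.1 p.2)) (hφ : MemLp φ 2 (gaussianReal 0 1)) :
    ∫ ω, (∫ x, φ (X x ω) ∂ν) ^ 2 ∂P =
      ∫ p : S × S, (∫ ω, φ (X p.1 ω) * φ (X p.2 ω) ∂P) ∂(ν.prod ν) := by
  rw [integral_integral_swap (f := fun (p : S × S) ω => φ (X p.1 ω) * φ (X p.2 ω))
    (hX.integrable_comp_mul_comp (ν := ν) hXm hφ)]
  congr 1
  ext ω
  rw [pow_two]
  exact (integral_prod_mul (fun x => φ (X x ω)) (fun x => φ (X x ω))).symm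

/-- The second moment of `∫ φ(X_x) dν` up to its Hermite term of degree `k`. -/
theorem abs_integral_functional_sq_sub_le [IsFiniteMeasure ν] (hX : IsStdGaussian X P)
    (hXm : Measurable (fun p : S × Ω => X p.1 p.2))
    (hc : Measurable (fun p : S × S => corr X P p.1 p.2))
    (hφ : MemLp φ 2 (gaussianReal 0 1)) {k N : ℕ}
    (h0 : ∀ n, n < N → n ≠ k → hermiteCoeff φ n = 0) :
    |∫ ω, (∫ x, φ (X x ω) ∂ν) ^ 2 ∂P -
        hermiteCoeff φ k ^ 2 * ∫ p : S × S, corr X P p.1 p.2 ^ k ∂(ν.prod ν)| ≤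
      (∫ u, φ u ^ 2 ∂(gaussianReal 0 1)) *
        ∫ p : S × S, |corr X P p.1 p.2| ^ N ∂(ν.prod ν) := by
  have hb : ∀ n (p : S × S), |corr X P p.1 p.2| ^ n ≤ 1 := fun n p =>
    pow_le_one₀ (abs_nonneg _) (hX.abs_corr_le_one _ _)
  have hi1 : Integrable (fun p : S × S => corr X P p.1 p.2 ^ k) (ν.prod ν) :=
    Integrable.of_bound (C := 1) (hc.pow_const k).aestronglyMeasurable
      (ae_of_all _ fun p => by simpa using hb k p)
  have hi2 : Integrable (fun p : S × S => |corr X P p.1 p.2| ^ N) (ν.prod ν) :=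
    Integrable.of_bound (C := 1) (hc.abs.pow_const N).aestronglyMeasurable
      (ae_of_all _ fun p => by simpa using hb N p)
  rw [hX.integral_functional_sq hXm hφ, ← integral_const_mul, ← integral_const_mul,
    ← integral_sub (hX.integrable_comp_mul_comp hXm hφ).integral_prod_left (hi1.const_mul _)]
  refine (abs_integral_le_integral_abs).trans (integral_mono_of_nonneg
    (ae_of_all _ fun p => abs_nonneg _) (hi2.const_mul _) (ae_of_all _ fun p => ?_))
  refine le_of_le_of_eq ?_ (mul_comm _ _)
  exact hX.abs_integral_mul_sub_le (measurable_of_prod hXm) hφ h0 p.1 p.2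

/-- The distance in `L¹` of integrals of `H_k` along two time changes of the process. -/
theorem integral_abs_integral_normHermite_sub_le [IsFiniteMeasure ν] {T : Type*}
    {Y : T → Ω → ℝ} (hY : IsStdGaussian Y P) {σ τ : S → T}
    (hσ : Measurable (fun p : S × Ω => Y (σ p.1) p.2))
    (hτ : Measurable (fun p : S × Ω => Y (τ p.1) p.2)) (k : ℕ) :
    ∫ ω, |∫ x, normHermite k (Y (σ x) ω) ∂ν - ∫ x, normHermite k (Y (τ x) ω) ∂ν| ∂P ≤
      ∫ x, √(2 - 2 * corr Y P (σ x) (τ x) ^ k) ∂ν := by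
  have iσ := (hY.comp σ).integrable_comp (ν := ν) hσ (memLp_normHermite k)
  have iτ := (hY.comp τ).integrable_comp (ν := ν) hτ (memLp_normHermite k)
  have hd : Integrable (fun p : S × Ω => |normHermite k (Y (σ p.1) p.2) -
      normHermite k (Y (τ p.1) p.2)|) (ν.prod P) := (iσ.sub iτ).abs
  have hA : ∀ t, HasAllMoments (fun ω => normHermite k (Y t ω)) P :=
    fun t =>
    (hY.comp (fun _ : Unit => t)).hasAllMoments_normHermite k ()
  have hsq : ∀ x, ∫ ω, (normHermite k (Y (σ x) ω) - normHermite k (Y (τ x) ω)) ^ 2 ∂P =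
      2 - 2 * corr Y P (σ x) (τ x) ^ k := by
    intro x
    have e : ∀ ω, (normHermite k (Y (σ x) ω) - normHermite k (Y (τ x) ω)) ^ 2 =
        (normHermite k (Y (σ x) ω) * normHermite k (Y (σ x) ω) +
          normHermite k (Y (τ x) ω) * normHermite k (Y (τ x) ω)) -
        2 * (normHermite k (Y (σ x) ω) * normHermite k (Y (τ x) ω)) := fun ω => by ring
    simp only [e]
    rw [integral_sub (((hA _).mul (hA _)).add ((hA _).mul (hA _))).integrable
      (((hA _).mul (hA _)).const_mul 2).integrable,
      integral_add ((hA _).mul (hA _)).integrable ((hA _).mul (hA _)).integrable,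
      integral_const_mul]
    simp only [hY.integral_normHermite_mul, if_true, hY.corr_self, one_pow]
    ring
  calc _ ≤ ∫ ω, (∫ x, |normHermite k (Y (σ x) ω) - normHermite k (Y (τ x) ω)| ∂ν) ∂P := by
        refine integral_mono_of_nonneg (ae_of_all _ fun ω => abs_nonneg _) hd.integral_prod_right ?_
        filter_upwards [iσ.prod_left_ae, iτ.prod_left_ae] with ω h1 h2
        rw [← integral_sub h1 h2]
        exact abs_integral_le_integral_abs
    _ = ∫ x, (∫ ω, |normHermite k (Y (σ x) ω) - normHermite k (Y (τ x) ω)| ∂P) ∂ν :=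
        (integral_integral_swap (f := fun x ω => |normHermite k (Y (σ x) ω) -
          normHermite k (Y (τ x) ω)|) hd).symm
    _ ≤ _ := by
        -- Measurability of the right-hand integrand is inherited from the second moments, since no
        -- measurability of `corr` itself is assumed.
        have hmeas : AEStronglyMeasurable (fun x =>
            ∫ ω, (normHermite k (Y (σ x) ω) - normHermite k (Y (τ x) ω)) ^ 2 ∂P) ν :=
          (iσ.sub iτ).aestronglyMeasurable.pow 2 |>.integral_prod_right'
        simp only [hsq] at hmeas
        refine integral_mono_of_nonneg (ae_of_all _ fun x => integral_nonneg fun ω => abs_nonneg _)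
          (Integrable.of_bound (C := √4)
            (Real.continuous_sqrt.comp_aestronglyMeasurable hmeas) (ae_of_all _ fun x => ?_))
          (ae_of_all _ fun x => ?_)
        · rw [Real.norm_of_nonneg (Real.sqrt_nonneg _)]
          refine Real.sqrt_le_sqrt ?_
          have h1 : |corr Y P (σ x) (τ x) ^ k| ≤ 1 := by
            rw [abs_pow]
            exact pow_le_one₀ (abs_nonneg _) (hY.abs_corr_le_one _ _)
          linarith [neg_le_of_abs_le h1]
        · simp only
          rw [← hsq]
          exact integral_abs_le_sqrt ((hA _).sub (hA _)).memLp_two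

end IsStdGaussian

end Functional

/-! ### Riemann sums -/

/-- The largest point of the grid `a + w ℤ` that does not exceed `x`. -/
noncomputable def gridFloor (a w x : ℝ) : ℝ := a + w * ⌊(x - a) / w⌋

theorem measurable_gridFloor (a w : ℝ) : Measurable (gridFloor a w) := by
  unfold gridFloor
  fun_prop

theorem gridFloor_le {w : ℝ} (hw : 0 < w) (a x : ℝ) : gridFloor a w x ≤ x := by
  have h := Int.floor_le ((x - a) / w)
  rw [le_div_iff₀ hw] at h
  unfold gridFloor
  linarith

theorem lt_gridFloor_add {w : ℝ} (hw : 0 < w) (a x : ℝ) : x < gridFloor a w x + w := by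
  have h := Int.lt_floor_add_one ((x - a) / w)
  rw [div_lt_iff₀ hw] at h
  unfold gridFloor
  linarith

theorem le_gridFloor {w a x : ℝ} (hw : 0 < w) (hx : a ≤ x) : a ≤ gridFloor a w x := by
  have h : (0 : ℤ) ≤ ⌊(x - a) / w⌋ := Int.floor_nonneg.2 (div_nonneg (by linarith) hw.le)
  have h' : (0 : ℝ) ≤ ⌊(x - a) / w⌋ := by exact_mod_cast h
  unfold gridFloor
  nlinarith

theorem gridFloor_eq {w a x : ℝ} (hw : 0 < w) {n : ℕ} (h1 : a + n * w ≤ x)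
    (h2 : x < a + (n + 1) * w) : gridFloor a w x = a + n * w := by
  have : ⌊(x - a) / w⌋ = (n : ℤ) := by
    rw [Int.floor_eq_iff, le_div_iff₀ hw, div_lt_iff₀ hw]
    constructor
    · push_cast; linarith
    · push_cast; linarith
  rw [gridFloor, this]
  push_cast
  ring

/-- The integrand is a step function, so its integral is the left Riemann sum exactly, for any `g`.
Riemann sums thereby become integrals along a time change. -/
theorem integral_comp_gridFloor {w : ℝ} (hw : 0 < w) (a : ℝ) (g : ℝ → ℝ) (n : ℕ) :
    IntervalIntegrable (fun x => g (gridFloor a w x)) volume a (a + n * w) ∧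
      ∫ x in a..(a + n * w), g (gridFloor a w x) = w * ∑ i ∈ Finset.range n, g (a + i * w) := by
  induction n with
  | zero => simp
  | succ n ih =>
    obtain ⟨ih1, ih2⟩ := ih
    have hle : a + n * w ≤ a + (n + 1 : ℕ) * w := by push_cast; nlinarith
    -- Grid cells are closed on the left and integration intervals on the right; they differ in end
    -- points only.
    have hae : ∀ᵐ x ∂(volume : Measure ℝ), x ∈ uIoc (a + n * w) (a + (n + 1 : ℕ) * w) →
        g (a + n * w) = g (gridFloor a w x) := by
      filter_upwards [Measure.ae_ne volume (a + (n + 1 : ℕ) * w)] with x hx hmem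
      rw [uIoc_of_le hle] at hmem
      rw [gridFloor_eq hw hmem.1.le (by
        have := lt_of_le_of_ne hmem.2 hx
        push_cast at this; exact this)]
    have hii : IntervalIntegrable (fun x => g (gridFloor a w x)) volume (a + n * w)
        (a + (n + 1 : ℕ) * w) :=
      (intervalIntegrable_const (c := g (a + n * w))).congr_ae
        ((ae_restrict_iff' measurableSet_uIoc).2 hae)
    refine ⟨ih1.trans hii, ?_⟩
    rw [← intervalIntegral.integral_add_adjacent_intervals ih1 hii, ih2,
      ← intervalIntegral.integral_congr_ae hae, intervalIntegral.integral_const,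
      Finset.sum_range_succ, smul_eq_mul]
    push_cast
    ring

/-- The mesh of the regular partition of `[a, b]` into `N + 1` intervals. -/
noncomputable def mesh (a b : ℝ) (N : ℕ) : ℝ := (b - a) / (N + 1)

/-- The left end points of the regular partition of `[a, b]` into `N + 1` intervals. -/
noncomputable def node (a b : ℝ) (N : ℕ) (i : Fin (N + 1)) : ℝ := a + i * mesh a b N

/-- The left Riemann sum of the regular partition of `[a, b]` into `N + 1` intervals. -/
noncomputable def riemannSum (a b : ℝ) (N : ℕ) (g : ℝ → ℝ) : ℝ :=
  mesh a b N * ∑ i, g (node a b N i)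

section RiemannSum

variable {a b : ℝ}

theorem mesh_pos (hab : a < b) (N : ℕ) : 0 < mesh a b N :=
  div_pos (by linarith) (by positivity)

theorem tendsto_mesh : Tendsto (mesh a b) atTop (𝓝 0) :=
  tendsto_const_div_atTop_nhds_zero_nat (b - a) |>.comp (tendsto_add_atTop_nat 1) |>.congr
    fun N => by simp [mesh]

theorem mul_mesh (N : ℕ) : ((N + 1 : ℕ) : ℝ) * mesh a b N = b - a := by
  rw [mesh]; push_cast; field_simp

theorem node_mem (hab : a < b) (N : ℕ) (i : Fin (N + 1)) : node a b N i ∈ Icc a b := by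
  have h := mesh_pos hab N
  have hm := mul_mesh (a := a) (b := b) N
  have hi : ((i : ℕ) : ℝ) ≤ (N + 1 : ℕ) := by exact_mod_cast i.2.le
  constructor
  · unfold node; nlinarith [Nat.cast_nonneg (α := ℝ) (i : ℕ)]
  · unfold node; nlinarith

theorem integral_comp_gridFloor_mesh (hab : a < b) (N : ℕ) (g : ℝ → ℝ) :
    IntervalIntegrable (fun x => g (gridFloor a (mesh a b N) x)) volume a b ∧
      ∫ x in a..b, g (gridFloor a (mesh a b N) x) = riemannSum a b N g := by
  have h := integral_comp_gridFloor (mesh_pos hab N) a g (N + 1)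
  rw [mul_mesh, add_sub_cancel] at h
  refine ⟨h.1, h.2.trans ?_⟩
  rw [riemannSum, Finset.sum_range]
  rfl

theorem abs_riemannSum_le (hab : a < b) (N : ℕ) {g : ℝ → ℝ} {ε : ℝ}
    (hg : ∀ x ∈ Icc a b, |g x| ≤ ε) : |riemannSum a b N g| ≤ (b - a) * ε := by
  rw [riemannSum, abs_mul, abs_of_pos (mesh_pos hab N)]
  calc mesh a b N * |∑ i, g (node a b N i)| ≤ mesh a b N * ∑ _i : Fin (N + 1), ε :=
        mul_le_mul_of_nonneg_left ((Finset.abs_sum_le_sum_abs _ _).trans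
          (Finset.sum_le_sum fun i _ => hg _ (node_mem hab N i))) (mesh_pos hab N).le
    _ = (b - a) * ε := by
        rw [Finset.sum_const, Finset.card_univ, Fintype.card_fin, nsmul_eq_mul, ← mul_mesh N]
        ring

theorem eventually_gridFloor_near (hab : a < b) {φ : ℝ → ℝ → ℝ}
    (hφ : Continuous (Function.uncurry φ)) {ε : ℝ} (hε : 0 < ε) :
    ∀ᶠ N in atTop, ∀ x ∈ Icc a b, ∀ y ∈ Icc a b,
      |φ x (gridFloor a (mesh a b N) y) - φ x y| ≤ ε := by
  have huc : UniformContinuousOn (Function.uncurry φ) (Icc a b ×ˢ Icc a b) :=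
    (isCompact_Icc.prod isCompact_Icc).uniformContinuousOn_of_continuous hφ.continuousOn
  obtain ⟨δ, hδ, h⟩ := Metric.uniformContinuousOn_iff.1 huc ε hε
  filter_upwards [tendsto_mesh.eventually (gt_mem_nhds hδ)] with N hN x hx y hy
  have hw := mesh_pos hab N
  have h1 := gridFloor_le hw a y
  have h2 := lt_gridFloor_add hw a y
  have h3 := le_gridFloor hw hy.1
  refine (h (x, gridFloor a (mesh a b N) y) ⟨hx, h3, h1.trans hy.2⟩ (x, y) ⟨hx, hy⟩ ?_).le
  rw [Prod.dist_eq, dist_self, max_lt_iff]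
  refine ⟨hδ, ?_⟩
  rw [Real.dist_eq, abs_lt]
  constructor <;> linarith

/-- Uniform continuity on the square makes the error uniform in `x`; iterated Riemann sums and
suprema over `x` both rely on this. -/
theorem eventually_abs_riemannSum_sub_le (hab : a < b) {φ : ℝ → ℝ → ℝ}
    (hφ : Continuous (Function.uncurry φ)) {ε : ℝ} (hε : 0 < ε) :
    ∀ᶠ N in atTop, ∀ x ∈ Icc a b,
      |riemannSum a b N (φ x) - ∫ y in a..b, φ x y| ≤ ε := by
  have hba : 0 < b - a := by linarith
  filter_upwards [eventually_gridFloor_near hab hφ (div_pos hε hba)] with N hN x hx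
  obtain ⟨h1, h2⟩ := integral_comp_gridFloor_mesh hab N (φ x)
  have hc : Continuous (φ x) := hφ.comp (Continuous.prodMk_right x)
  rw [← h2, ← intervalIntegral.integral_sub h1 (hc.intervalIntegrable _ _), ← Real.norm_eq_abs]
  refine (intervalIntegral.norm_integral_le_of_norm_le_const fun y hy => ?_).trans_eq
    (b := ε / (b - a) * |b - a|) ?_
  · rw [uIoc_of_le hab.le] at hy
    exact hN x hx y (Ioc_subset_Icc_self hy)
  · rw [abs_of_pos hba]; field_simp

theorem tendsto_riemannSum_riemannSum (hab : a < b) {φ : ℝ → ℝ → ℝ}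
    (hφ : Continuous (Function.uncurry φ)) :
    Tendsto (fun N => riemannSum a b N fun x => riemannSum a b N (φ x)) atTop
      (𝓝 (∫ x in a..b, ∫ y in a..b, φ x y)) := by
  have hba : 0 < b - a := by linarith
  have hk : Continuous (fun x => ∫ y in a..b, φ x y) :=
    intervalIntegral.continuous_parametric_intervalIntegral_of_continuous' hφ a b
  rw [Metric.tendsto_nhds]
  intro ε hε
  have hδ : 0 < ε / (4 * (b - a)) := by positivity
  filter_upwards [eventually_abs_riemannSum_sub_le hab hφ hδ,
    eventually_abs_riemannSum_sub_le hab (φ := fun _ x => ∫ y in a..b, φ x y)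
      (hk.comp continuous_snd) (ε := ε / 4) (by positivity)] with N h1 h2
  have h3 := h2 a (left_mem_Icc.2 hab.le)
  have h4 := abs_riemannSum_le hab N h1
  have e : riemannSum a b N (fun x => riemannSum a b N (φ x) - ∫ y in a..b, φ x y) =
      riemannSum a b N (fun x => riemannSum a b N (φ x)) -
        riemannSum a b N (fun x => ∫ y in a..b, φ x y) := by
    simp only [riemannSum]
    rw [Finset.sum_sub_distrib, mul_sub]
  rw [e] at h4
  have e2 : (b - a) * (ε / (4 * (b - a))) = ε / 4 := by field_simp
  rw [e2] at h4
  rw [Real.dist_eq]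
  calc _ ≤ _ := abs_sub_le _ (riemannSum a b N (fun x => ∫ y in a..b, φ x y)) _
    _ ≤ ε / 4 + ε / 4 := add_le_add h4 h3
    _ < ε := by linarith

end RiemannSum

/-! ### Normal approximation of the integral of a Hermite polynomial along a process -/

section Clt

variable {Ω : Type*} [MeasurableSpace Ω] {P : Measure Ω} [IsProbabilityMeasure P]

/-- `|e^{iu} - 1| ≤ |u|`. -/
theorem norm_integral_cexp_sub_le {F F' : Ω → ℝ} (hF : Integrable F P) (hF' : Integrable F' P)
    (t : ℝ) :
    ‖∫ ω, Complex.exp ((t * F ω : ℝ) * Complex.I) ∂P -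
        ∫ ω, Complex.exp ((t * F' ω : ℝ) * Complex.I) ∂P‖ ≤ |t| * ∫ ω, |F ω - F' ω| ∂P := by
  rw [← integral_sub (hasAllMoments_cexp hF.aemeasurable t).integrable
    (hasAllMoments_cexp hF'.aemeasurable t).integrable, ← integral_const_mul]
  refine norm_integral_le_of_norm_le ((hF.sub hF').abs.const_mul _) (ae_of_all _ fun ω => ?_)
  have e : Complex.exp ((t * F ω : ℝ) * Complex.I) - Complex.exp ((t * F' ω : ℝ) * Complex.I) =
      Complex.exp ((t * F' ω : ℝ) * Complex.I) *
        (Complex.exp (Complex.I * (t * F ω - t * F' ω : ℝ)) - 1) := by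
    rw [mul_sub, mul_one, ← Complex.exp_add]
    congr 2
    push_cast
    ring
  rw [e, norm_mul, Complex.norm_exp_ofReal_mul_I, one_mul]
  refine (Real.norm_exp_I_mul_ofReal_sub_one_le).trans_eq ?_
  rw [← mul_sub, norm_mul]
  rfl

variable {X : ℝ → Ω → ℝ} {a b : ℝ}

theorem continuous_corr_pow (hc : Continuous (Function.uncurry (corr X P))) (q : ℕ) :
    Continuous (Function.uncurry fun x y => |corr X P x y| ^ q) := by
  have : Continuous fun p : ℝ × ℝ => |Function.uncurry (corr X P) p| ^ q := by fun_prop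
  exact this

theorem integrable_integral_normHermite (hX : IsStdGaussian X P)
    (hXm : Measurable (fun p : ℝ × Ω => X p.1 p.2)) (hab : a < b) (k : ℕ) :
    Integrable (fun ω => ∫ x in a..b, normHermite k (X x ω)) P := by
  simp only [intervalIntegral.integral_of_le hab.le]
  exact (hX.memLp_functional hXm (memLp_normHermite k)).integrable (by norm_num)

/-- The Riemann sum is the integral along the process sampled at grid points. Its `L¹` distance from
the true integral is at most that of `√(2 - 2 r^k)` between each point and its grid point, which
tends to `0` because `r` is continuous and equals `1` on the diagonal. -/
theorem tendsto_integral_abs_riemannSum_sub (hX : IsStdGaussian X P)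
    (hXm : Measurable (fun p : ℝ × Ω => X p.1 p.2))
    (hc : Continuous (Function.uncurry (corr X P))) (hab : a < b) (k : ℕ) :
    Tendsto (fun N => ∫ ω, |riemannSum a b N (fun x => normHermite k (X x ω)) -
      ∫ x in a..b, normHermite k (X x ω)| ∂P) atTop (𝓝 0) := by
  rw [Metric.tendsto_nhds]
  intro ε hε
  have hba : 0 < b - a := by linarith
  have hcont : Continuous (Function.uncurry fun x y => √(2 - 2 * corr X P y x ^ k)) := by
    have h1 : Continuous fun p : ℝ × ℝ => √(2 - 2 * (Function.uncurry (corr X P) p.swap) ^ k) := by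
      fun_prop
    exact h1
  filter_upwards [eventually_gridFloor_near hab hcont (ε := ε / (2 * (b - a))) (by positivity)]
    with N hN
  have hτ : Measurable (fun p : ℝ × Ω => X (gridFloor a (mesh a b N) p.1) p.2) :=
    hXm.comp (((measurable_gridFloor a _).comp measurable_fst).prodMk measurable_snd)
  have h1 := hX.integral_abs_integral_normHermite_sub_le (ν := volume.restrict (Ioc a b))
    (τ := fun x => x) hτ hXm k
  have hR : ∀ ω, riemannSum a b N (fun x => normHermite k (X x ω)) =
      ∫ x in Ioc a b, normHermite k (X (gridFloor a (mesh a b N) x) ω) := by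
    intro ω
    rw [← (integral_comp_gridFloor_mesh hab N fun x => normHermite k (X x ω)).2,
      intervalIntegral.integral_of_le hab.le]
  simp only [hR, intervalIntegral.integral_of_le hab.le]
  rw [dist_zero_right, Real.norm_of_nonneg (integral_nonneg fun ω => abs_nonneg _)]
  refine h1.trans_lt ?_
  rw [← intervalIntegral.integral_of_le hab.le]
  have h2 := intervalIntegral.norm_integral_le_of_norm_le_const (a := a) (b := b)
    (f := fun x => √(2 - 2 * corr X P (gridFloor a (mesh a b N) x) x ^ k))
    (C := ε / (2 * (b - a))) fun x hx => by
      rw [uIoc_of_le hab.le] at hx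
      have := hN x (Ioc_subset_Icc_self hx) x (Ioc_subset_Icc_self hx)
      simpa [hX.corr_self] using this
  rw [abs_of_pos hba] at h2
  calc _ ≤ _ := le_abs_self _
    _ ≤ ε / (2 * (b - a)) * (b - a) := h2
    _ = ε / 2 := by field_simp
    _ < ε := by linarith

theorem riemannSum_riemannSum (N : ℕ) (φ : ℝ → ℝ → ℝ) :
    riemannSum a b N (fun x => riemannSum a b N (φ x)) =
      mesh a b N ^ 2 * ∑ i, ∑ j, φ (node a b N i) (node a b N j) := by
  simp only [riemannSum]
  rw [← Finset.mul_sum]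
  ring

/-- Normal approximation of `∫ H_{p+1}(X_x) dx`, with an explicit bound. -/
theorem exists_norm_integral_cexp_integral_sub_le (P : Measure Ω) [IsProbabilityMeasure P] {p : ℕ}
    (hp : Even (p + 1)) : ∃ K : ℝ, 0 ≤ K ∧ ∀ (X : ℝ → Ω → ℝ), IsStdGaussian X P →
      Measurable (fun p : ℝ × Ω => X p.1 p.2) → Continuous (Function.uncurry (corr X P)) →
      ∀ a b : ℝ, a < b → ∀ U : ℕ → ℝ,
      (∀ q, 1 ≤ q → q ≤ p → ∀ x ∈ Icc a b, ∫ y in a..b, |corr X P x y| ^ q ≤ U q) → ∀ t : ℝ,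
      ‖∫ ω, Complex.exp ((t * ∫ x in a..b, normHermite (p + 1) (X x ω) : ℝ) * Complex.I) ∂P -
        Complex.exp (-((∫ x in a..b, ∫ y in a..b, |corr X P x y| ^ (p + 1)) * t ^ 2 / 2 : ℝ))‖ ≤
      t ^ 2 * √(K * ((∫ x in a..b, ∫ y in a..b, |corr X P x y| ^ (p + 1)) *
        ∑ q ∈ Finset.Icc 1 p, U q * U (p + 1 - q))) := by
  obtain ⟨K, hK, h⟩ := exists_norm_integral_cexp_chaosSum_sub_le ℝ P p
  refine ⟨K, hK, fun X hX hXm hc a b hab U hU t => ?_⟩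
  set V := ∫ x in a..b, ∫ y in a..b, |corr X P x y| ^ (p + 1) with hV
  have hVlim := tendsto_riemannSum_riemannSum hab (continuous_corr_pow hc (p + 1))
  rw [← hV] at hVlim
  -- Riemann sums of `|r|^q` satisfy the bounds `U q` only up to an error `η`, which is sent to `0`
  -- after the mesh.
  have hslack : ∀ η : ℝ, 0 < η →
      ‖∫ ω, Complex.exp ((t * ∫ x in a..b, normHermite (p + 1) (X x ω) : ℝ) * Complex.I) ∂P -
        Complex.exp (-(V * t ^ 2 / 2 : ℝ))‖ ≤
      t ^ 2 * √(K * (V * ∑ q ∈ Finset.Icc 1 p, (U q + η) * (U (p + 1 - q) + η))) := by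
    intro η hη
    have hUev : ∀ᶠ N in atTop, ∀ q ∈ Finset.Icc 1 p, ∀ x ∈ Icc a b,
        riemannSum a b N (fun y => |corr X P x y| ^ q) ≤ U q + η := by
      rw [Finset.eventually_all]
      intro q hq
      rw [Finset.mem_Icc] at hq
      filter_upwards [eventually_abs_riemannSum_sub_le hab (continuous_corr_pow hc q) hη]
        with N hN x hx
      linarith [(abs_le.1 (hN x hx)).2, hU q hq.1 hq.2 x hx]
    have hFN : ∀ N, Integrable
        (fun ω => riemannSum a b N fun x => normHermite (p + 1) (X x ω)) P := fun N =>
      ((hX.comp (node a b N)).hasAllMoments_chaosSum (p + 1) (mesh a b N)).integrable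
    have hF := integrable_integral_normHermite hX hXm hab (p + 1)
    have hLlim : Tendsto (fun N => ∫ ω, Complex.exp ((t * riemannSum a b N
          (fun x => normHermite (p + 1) (X x ω)) : ℝ) * Complex.I) ∂P) atTop
        (𝓝 (∫ ω, Complex.exp ((t * ∫ x in a..b, normHermite (p + 1) (X x ω) : ℝ) *
          Complex.I) ∂P)) := by
      rw [tendsto_iff_norm_sub_tendsto_zero]
      refine squeeze_zero (fun N => norm_nonneg _)
        (fun N => norm_integral_cexp_sub_le (hFN N) hF t) ?_
      simpa using (tendsto_integral_abs_riemannSum_sub hX hXm hc hab (p + 1)).const_mul |t|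
    have hElim : Tendsto (fun N => Complex.exp (-((riemannSum a b N fun x =>
        riemannSum a b N fun y => |corr X P x y| ^ (p + 1)) * t ^ 2 / 2 : ℝ))) atTop
        (𝓝 (Complex.exp (-(V * t ^ 2 / 2 : ℝ)))) := by
      refine (Complex.continuous_exp.tendsto _).comp ?_
      refine (Complex.continuous_ofReal.tendsto _ |>.comp ?_).neg
      exact (hVlim.mul_const _).div_const _
    refine le_of_tendsto_of_tendsto (hLlim.sub hElim).norm
      (((hVlim.mul_const _).const_mul K).sqrt.const_mul (t ^ 2)) ?_
    filter_upwards [hUev] with N hN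
    have hnn : 0 ≤ riemannSum a b N fun x => riemannSum a b N fun y =>
        |corr X P x y| ^ (p + 1) := by
      have := mesh_pos hab N
      simp only [riemannSum]
      positivity
    have := h X hX (Fin (N + 1)) (node a b N) (mesh a b N) (mesh_pos hab N).le _ hnn
      (by rw [riemannSum_riemannSum]; simp only [hp.pow_abs]) (fun q => U q + η)
      (fun q h1 h2 i => by
        have := hN q (Finset.mem_Icc.2 ⟨h1, h2⟩) _ (node_mem hab N i)
        rwa [riemannSum, Finset.mul_sum] at this) t
    rw [← riemannSum_riemannSum N (fun x y => |corr X P x y| ^ (p + 1))] at this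
    exact this
  have hcont : Continuous fun η : ℝ =>
      t ^ 2 * √(K * (V * ∑ q ∈ Finset.Icc 1 p, (U q + η) * (U (p + 1 - q) + η))) := by
    fun_prop
  have hlim := (hcont.tendsto 0).mono_left (nhdsWithin_le_nhds (s := Ioi 0))
  simp only [add_zero] at hlim
  refine ge_of_tendsto hlim ?_
  filter_upwards [self_mem_nhdsWithin] with η hη using hslack η hη

end Clt

/-! ### Hermite coefficients -/

theorem He_neg (n : ℕ) (x : ℝ) : He n (-x) = (-1) ^ n * He n x := by
  induction n using Nat.strong_induction_on with
  | _ n ih =>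
    rcases n with _ | _ | n
    · simp [He_zero]
    · simp [He_succ, He_zero]
    · rw [He_succ (n + 1) (-x), He_succ (n + 1) x, ih (n + 1) (by omega), ih (n + 1 - 1) (by omega), add_tsub_cancel_right]
      ring

theorem normHermite_neg (n : ℕ) (x : ℝ) : normHermite n (-x) = (-1) ^ n * normHermite n x := by
  rw [normHermite_eq, normHermite_eq, He_neg, mul_div_assoc]

theorem normHermite_zero (x : ℝ) : normHermite 0 x = 1 := by simp [normHermite_eq, He_zero]

theorem hermiteCoeff_zero (f : ℝ → ℝ) : hermiteCoeff f 0 = ∫ x, f x ∂(gaussianReal 0 1) := by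
  simp [hermiteCoeff, normHermite_zero]

theorem hermiteCoeff_of_odd {f : ℝ → ℝ} (hf : Function.Even f) {n : ℕ} (hn : Odd n) :
    hermiteCoeff f n = 0 := by
  have hmp : MeasurePreserving (MeasurableEquiv.neg ℝ) (gaussianReal 0 1) (gaussianReal 0 1) :=
    ⟨measurable_neg, by simpa using gaussianReal_map_neg (μ := 0) (v := 1)⟩
  have h := hmp.integral_comp' (fun x => f x * normHermite n x)
  simp only [MeasurableEquiv.neg_apply, hf _, normHermite_neg, hn.neg_one_pow] at h
  simp only [neg_mul, one_mul, mul_neg, integral_neg] at h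
  rw [hermiteCoeff]
  linarith

theorem hermiteCoeff_sub_mul_normHermite {f : ℝ → ℝ} (hf : MemLp f 2 (gaussianReal 0 1)) (c : ℝ)
    (k n : ℕ) : hermiteCoeff (fun x => f x - c * normHermite k x) n =
      hermiteCoeff f n - if k = n then c else 0 := by
  have h := isStdGaussian_id.integral_normHermite_mul () () k n
  simp only [id, isStdGaussian_id.corr_self, one_pow] at h
  simp only [hermiteCoeff, sub_mul, mul_assoc]
  rw [integral_sub (f := fun x => f x * normHermite n x)
    (g := fun x => c * (normHermite k x * normHermite n x))
    (hf.integrable_mul (memLp_normHermite n)) (((memLp_normHermite k).integrable_mul (memLp_normHermite n)).const_mul c),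
    integral_const_mul, h]
  simp

theorem memLp_sub_mul_normHermite {f : ℝ → ℝ} (hf : MemLp f 2 (gaussianReal 0 1)) (c : ℝ) (k : ℕ) :
    MemLp (fun x => f x - c * normHermite k x) 2 (gaussianReal 0 1) :=
  hf.sub ((memLp_normHermite k).const_mul c)

/-! ### Reduction of a functional to its first Hermite term -/

section Reduction

variable {Ω : Type*} [MeasurableSpace Ω] {P : Measure Ω} [IsProbabilityMeasure P]
  {X : ℝ → Ω → ℝ} {a b : ℝ} {f : ℝ → ℝ}

theorem integral_prod_corr_pow (hX : IsStdGaussian X P)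
    (hc : Continuous (Function.uncurry (corr X P))) (hab : a < b) {φ : ℝ → ℝ} (hφ : Continuous φ) :
    ∫ p : ℝ × ℝ, φ (corr X P p.1 p.2) ∂((volume.restrict (Ioc a b)).prod
      (volume.restrict (Ioc a b))) = ∫ x in a..b, ∫ y in a..b, φ (corr X P x y) := by
  simp only [intervalIntegral.integral_of_le hab.le]
  obtain ⟨C, hC⟩ := (isCompact_Icc (a := (-1 : ℝ)) (b := 1)).exists_bound_of_continuousOn
    hφ.continuousOn
  refine integral_prod (fun p : ℝ × ℝ => φ (corr X P p.1 p.2)) (Integrable.of_bound (C := C)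
    (Continuous.aestronglyMeasurable ?_) (ae_of_all _ fun p => hC _ ?_))
  · have : Continuous fun p => φ (Function.uncurry (corr X P) p) := by fun_prop
    exact this
  · exact abs_le.1 (hX.abs_corr_le_one _ _)

theorem abs_integral_interval_sq_sub_le (hX : IsStdGaussian X P)
    (hXm : Measurable (fun p : ℝ × Ω => X p.1 p.2))
    (hc : Continuous (Function.uncurry (corr X P))) (hab : a < b)
    (hf : MemLp f 2 (gaussianReal 0 1)) {k N : ℕ}
    (h0 : ∀ n, n < N → n ≠ k → hermiteCoeff f n = 0) :
    |∫ ω, (∫ x in a..b, f (X x ω)) ^ 2 ∂P -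
        hermiteCoeff f k ^ 2 * ∫ x in a..b, ∫ y in a..b, corr X P x y ^ k| ≤
      (∫ u, f u ^ 2 ∂(gaussianReal 0 1)) * ∫ x in a..b, ∫ y in a..b, |corr X P x y| ^ N := by
  have h := hX.abs_integral_functional_sq_sub_le (ν := volume.restrict (Ioc a b)) hXm
    hc.measurable hf h0
  rw [integral_prod_corr_pow hX hc hab (continuous_pow k),
    integral_prod_corr_pow hX hc hab (φ := fun r => |r| ^ N) (by fun_prop)] at h
  simpa only [← intervalIntegral.integral_of_le hab.le] using h

theorem ae_intervalIntegrable_comp (hX : IsStdGaussian X P)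
    (hXm : Measurable (fun p : ℝ × Ω => X p.1 p.2)) (hab : a < b)
    (hf : MemLp f 2 (gaussianReal 0 1)) :
    ∀ᵐ ω ∂P, IntervalIntegrable (fun x => f (X x ω)) volume a b := by
  filter_upwards [hX.ae_integrable_comp (ν := volume.restrict (Ioc a b)) hXm hf] with ω hω
  exact (intervalIntegrable_iff_integrableOn_Ioc_of_le hab.le).2 hω

theorem memLp_integral_comp (hX : IsStdGaussian X P)
    (hXm : Measurable (fun p : ℝ × Ω => X p.1 p.2)) (hab : a < b)
    (hf : MemLp f 2 (gaussianReal 0 1)) : MemLp (fun ω => ∫ x in a..b, f (X x ω)) 2 P := by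
  simpa only [intervalIntegral.integral_of_le hab.le] using
    hX.memLp_functional (ν := volume.restrict (Ioc a b)) hXm hf

theorem integral_integral_interval (hX : IsStdGaussian X P)
    (hXm : Measurable (fun p : ℝ × Ω => X p.1 p.2)) (hab : a < b)
    (hf : MemLp f 2 (gaussianReal 0 1)) :
    ∫ ω, (∫ x in a..b, f (X x ω)) ∂P = (b - a) * ∫ u, f u ∂(gaussianReal 0 1) := by
  have h := hX.integral_integral_comp (ν := volume.restrict (Ioc a b)) hXm hf
  simp only [intervalIntegral.integral_of_le hab.le, h]
  simp [Real.volume_real_Ioc_of_le hab.le]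

theorem ae_integral_sub_mul_normHermite (hX : IsStdGaussian X P)
    (hXm : Measurable (fun p : ℝ × Ω => X p.1 p.2)) (hab : a < b)
    (hf : MemLp f 2 (gaussianReal 0 1)) (c : ℝ) (k : ℕ) :
    ∀ᵐ ω ∂P, ∫ x in a..b, (f (X x ω) - c * normHermite k (X x ω)) =
      (∫ x in a..b, f (X x ω)) - c * ∫ x in a..b, normHermite k (X x ω) := by
  filter_upwards [ae_intervalIntegrable_comp hX hXm hab hf,
    ae_intervalIntegrable_comp hX hXm hab (memLp_normHermite k)] with ω h1 h2
  rw [intervalIntegral.integral_sub h1 (h2.const_mul c), intervalIntegral.integral_const_mul]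

/-- The variance of `∫ f(X_x) dx` up to its Hermite term of degree `k`. -/
theorem abs_variance_sub_le (hX : IsStdGaussian X P)
    (hXm : Measurable (fun p : ℝ × Ω => X p.1 p.2))
    (hc : Continuous (Function.uncurry (corr X P))) (hab : a < b)
    (hf : MemLp f 2 (gaussianReal 0 1)) {k N : ℕ} (hk : k ≠ 0)
    (h0 : ∀ n, 0 < n → n < N → n ≠ k → hermiteCoeff f n = 0) :
    |variance (fun ω => ∫ x in a..b, f (X x ω)) P -
        hermiteCoeff f k ^ 2 * ∫ x in a..b, ∫ y in a..b, corr X P x y ^ k| ≤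
      (∫ u, (f u - hermiteCoeff f 0 * normHermite 0 u) ^ 2 ∂(gaussianReal 0 1)) *
        ∫ x in a..b, ∫ y in a..b, |corr X P x y| ^ N := by
  -- Removing the degree-zero term centres the functional, so its second moment becomes the
  -- variance.
  have h := abs_integral_interval_sq_sub_le hX hXm hc hab
    (memLp_sub_mul_normHermite hf (hermiteCoeff f 0) 0) (k := k) (N := N) (fun n hn hnk => by
      rw [hermiteCoeff_sub_mul_normHermite hf]
      rcases Nat.eq_zero_or_pos n with rfl | hpos
      · simp
      · rw [h0 n hpos hn hnk, if_neg hpos.ne, sub_zero])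
  rw [hermiteCoeff_sub_mul_normHermite hf, if_neg hk.symm, sub_zero] at h
  rw [variance_eq_integral (memLp_integral_comp hX hXm hab hf).aemeasurable,
    integral_integral_interval hX hXm hab hf]
  refine le_of_eq_of_le ?_ h
  congr 2
  refine integral_congr_ae ?_
  filter_upwards [ae_integral_sub_mul_normHermite hX hXm hab hf (hermiteCoeff f 0) 0] with ω hω
  rw [hω, ← hermiteCoeff_zero]
  simp only [normHermite_zero, intervalIntegral.integral_const, smul_eq_mul, mul_one]
  rw [mul_comm (b - a)]

/-- The distance in `L¹` of `∫ f(X_x) dx` from its Hermite term of degree `k`. -/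
theorem integral_abs_sub_hermite_term_le (hX : IsStdGaussian X P)
    (hXm : Measurable (fun p : ℝ × Ω => X p.1 p.2))
    (hc : Continuous (Function.uncurry (corr X P))) (hab : a < b)
    (hf : MemLp f 2 (gaussianReal 0 1)) {k N : ℕ} (hk : k ≠ 0)
    (h0 : ∀ n, 0 < n → n < N → n ≠ k → hermiteCoeff f n = 0) :
    ∫ ω, |((∫ x in a..b, f (X x ω)) - (b - a) * ∫ u, f u ∂(gaussianReal 0 1)) -
        hermiteCoeff f k * ∫ x in a..b, normHermite k (X x ω)| ∂P ≤
      √((∫ u, (f u - hermiteCoeff f 0 * normHermite 0 u - hermiteCoeff f k * normHermite k u) ^ 2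
        ∂(gaussianReal 0 1)) * ∫ x in a..b, ∫ y in a..b, |corr X P x y| ^ N) := by
  have hf0 := memLp_sub_mul_normHermite hf (hermiteCoeff f 0) 0
  have hg := memLp_sub_mul_normHermite hf0 (hermiteCoeff f k) k
  have hg0 : ∀ n, n = k ∨ n < N →
      hermiteCoeff (fun u => f u - hermiteCoeff f 0 * normHermite 0 u -
        hermiteCoeff f k * normHermite k u) n = 0 := by
    intro n hn
    rw [hermiteCoeff_sub_mul_normHermite hf0, hermiteCoeff_sub_mul_normHermite hf]
    by_cases hnk : n = k
    · subst hnk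
      simp [hk.symm]
    · rcases Nat.eq_zero_or_pos n with rfl | hpos
      · simp [hk]
      · rw [h0 n hpos (hn.resolve_left hnk) hnk, if_neg hpos.ne, if_neg (Ne.symm hnk)]
        simp
  -- With degrees `0` and `k` both removed, the main term vanishes and the estimate bounds the
  -- second moment of the remainder outright.
  have h := abs_integral_interval_sq_sub_le hX hXm hc hab hg (k := k) (N := N)
    fun n hn _ => hg0 n (Or.inr hn)
  rw [hg0 k (Or.inl rfl), zero_pow two_ne_zero, zero_mul, sub_zero] at h
  refine le_trans (le_of_eq (integral_congr_ae ?_)) ((integral_abs_le_sqrt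
    (memLp_integral_comp hX hXm hab hg)).trans (Real.sqrt_le_sqrt ((le_abs_self _).trans h)))
  filter_upwards [ae_integral_sub_mul_normHermite hX hXm hab hf (hermiteCoeff f 0) 0,
    ae_integral_sub_mul_normHermite hX hXm hab hf0 (hermiteCoeff f k) k] with ω h1 h2
  rw [h2, h1, ← hermiteCoeff_zero]
  simp only [normHermite_zero, intervalIntegral.integral_const, smul_eq_mul, mul_one]
  rw [mul_comm (b - a)]

end Reduction

/-! ### Convergence in distribution -/

/-- Countable generation of the filter reduces to sequences, where Lévy's continuity theorem
applies. -/
theorem tendstoInDistribution_gaussian_of_integral_cexp {Ω : Type*} [MeasurableSpace Ω]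
    {P : Measure Ω} [IsProbabilityMeasure P] {Z : ℝ → Ω → ℝ} {l : Filter ℝ}
    [l.IsCountablyGenerated] (hZ : ∀ h, AEMeasurable (Z h) P)
    (h : ∀ t : ℝ, Tendsto (fun h => ∫ ω, Complex.exp ((t * Z h ω : ℝ) * Complex.I) ∂P) l
      (𝓝 (Complex.exp (-(t ^ 2 / 2 : ℝ))))) :
    TendstoInDistribution Z l (id : ℝ → ℝ) (fun _ => P) (gaussianReal 0 1) := by
  refine ⟨hZ, aemeasurable_id, tendsto_of_seq_tendsto fun u hu => ?_⟩
  refine ProbabilityMeasure.tendsto_iff_tendsto_charFun.2 fun t => ?_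
  have e : ∀ h, charFun (P.map (Z h)) t =
      ∫ ω, Complex.exp ((t * Z h ω : ℝ) * Complex.I) ∂P := by
    intro h
    rw [charFun_apply_real, integral_map (hZ h) (Continuous.aestronglyMeasurable (by fun_prop))]
    simp
  have e0 : charFun ((gaussianReal 0 1).map id) t = Complex.exp (-(t ^ 2 / 2 : ℝ)) := by
    rw [Measure.map_id, charFun_gaussianReal]
    congr 1
    push_cast
    ring
  simp only [ProbabilityMeasure.coe_mk, e0]
  exact ((h t).comp hu).congr fun n => (e (u n)).symm

/-! ### Functionals of normalized increments -/

namespace IsStationaryGaussian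

variable {Ω : Type*} [MeasurableSpace Ω] {P : Measure Ω} [IsProbabilityMeasure P] {G : ℝ → Ω → ℝ}
  {a b : ℝ} {f : ℝ → ℝ} {k : ℕ}

theorem continuous_corr_normIncrement (hG : IsStationaryGaussian G P) {h : ℝ}
    (hpos : 0 < incVar G P h) :
    Continuous (Function.uncurry (corr (normIncrement G P h) P)) := by
  refine (hG.continuous_rho h).congr fun p => ?_
  exact (corr_normIncrement hpos p.1 p.2).symm

theorem memLp_incFunctional (hG : IsStationaryGaussian G P) (hab : a < b)
    (hf : MemLp f 2 (gaussianReal 0 1)) (h : ℝ) : MemLp (incFunctional G P f a b h) 2 P := by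
  -- If `σ(h) = 0`, division by zero makes the argument of `f` equal to `0` and the functional
  -- constant.
  rcases (incVar_nonneg (G := G) (P := P) h).eq_or_lt' with h0 | hpos
  · have e : incFunctional G P f a b h = fun _ => (b - a) * f 0 := by
      ext ω
      simp [incFunctional, h0]
    rw [e]
    exact memLp_const _
  · exact memLp_integral_comp (hG.isStdGaussian_normIncrement hpos)
      (hG.measurable_normIncrement_prod h) hab hf

theorem abs_variance_incFunctional_sub_le (hG : IsStationaryGaussian G P) (hab : a < b)
    (hf : MemLp f 2 (gaussianReal 0 1)) (hk : k ≠ 0) (hev : Even k) {N : ℕ}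
    (h0 : ∀ n, 0 < n → n < N → n ≠ k → hermiteCoeff f n = 0) {h : ℝ} (hpos : 0 < incVar G P h) :
    |variance (incFunctional G P f a b h) P - hermiteCoeff f k ^ 2 * rhoInt G P a b k h| ≤
      (∫ u, (f u - hermiteCoeff f 0 * normHermite 0 u) ^ 2 ∂(gaussianReal 0 1)) *
        rhoInt G P a b N h := by
  have hv := abs_variance_sub_le (hG.isStdGaussian_normIncrement hpos)
    (hG.measurable_normIncrement_prod h) (hG.continuous_corr_normIncrement hpos) hab hf hk h0
  simp only [corr_normIncrement hpos] at hv
  simp only [rhoInt, hev.pow_abs]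
  exact hv

theorem integral_abs_incFunctional_sub_le (hG : IsStationaryGaussian G P) (hab : a < b)
    (hf : MemLp f 2 (gaussianReal 0 1)) (hk : k ≠ 0) {N : ℕ}
    (h0 : ∀ n, 0 < n → n < N → n ≠ k → hermiteCoeff f n = 0) {h : ℝ} (hpos : 0 < incVar G P h) :
    ∫ ω, |(incFunctional G P f a b h ω - (b - a) * ∫ u, f u ∂(gaussianReal 0 1)) -
        hermiteCoeff f k * incFunctional G P (normHermite k) a b h ω| ∂P ≤
      √((∫ u, (f u - hermiteCoeff f 0 * normHermite 0 u - hermiteCoeff f k * normHermite k u) ^ 2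
        ∂(gaussianReal 0 1)) * rhoInt G P a b N h) := by
  have hv := integral_abs_sub_hermite_term_le (hG.isStdGaussian_normIncrement hpos)
    (hG.measurable_normIncrement_prod h) (hG.continuous_corr_normIncrement hpos) hab hf hk h0
  simp only [corr_normIncrement hpos] at hv
  exact hv

/-- The relative error of the variance is at most a constant times the ratio assumed to vanish. -/
theorem tendsto_variance_div (hG : IsStationaryGaussian G P) (hne : ∃ h, incVar G P h ≠ 0)
    (hab : a < b) (hf : MemLp f 2 (gaussianReal 0 1)) (hk : k ≠ 0) (hev : Even k)
    (ha : hermiteCoeff f k ≠ 0) {N : ℕ}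
    (h0 : ∀ n, 0 < n → n < N → n ≠ k → hermiteCoeff f n = 0)
    (hratio : Tendsto (fun h => rhoInt G P a b N h / rhoInt G P a b k h) (𝓝[>] 0) (𝓝 0)) :
    Tendsto (fun h => variance (incFunctional G P f a b h) P /
      (hermiteCoeff f k ^ 2 * rhoInt G P a b k h)) (𝓝[>] 0) (𝓝 1) := by
  set C := ∫ u, (f u - hermiteCoeff f 0 * normHermite 0 u) ^ 2 ∂(gaussianReal 0 1)
  rw [tendsto_iff_norm_sub_tendsto_zero]
  have hlim := hratio.const_mul (C / hermiteCoeff f k ^ 2)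
  rw [mul_zero] at hlim
  refine squeeze_zero' (Eventually.of_forall fun h => norm_nonneg _) ?_ hlim
  filter_upwards [hG.eventually_incVar_pos hne] with h hpos
  have hV := hG.rhoInt_pos hab hpos k
  have haV : 0 < hermiteCoeff f k ^ 2 * rhoInt G P a b k h := by positivity
  have hv := hG.abs_variance_incFunctional_sub_le hab hf hk hev h0 hpos
  rw [div_sub_one haV.ne', norm_div, Real.norm_eq_abs, Real.norm_of_nonneg haV.le,
    div_mul_div_comm]
  gcongr

theorem integral_abs_rho_pow_le (hab : a < b) {ε h x : ℝ} {k₀ j : ℕ}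
    (hj : 1 ≤ j)
    (hx : (∫ y in a..b, |rho G P h x y| ^ j) ^ (1 / (j : ℝ)) ≤
      ε * rhoInt G P a b (2 * k₀) h ^ (1 / (2 * (k₀ : ℝ)))) :
    ∫ y in a..b, |rho G P h x y| ^ j ≤
      (ε * rhoInt G P a b (2 * k₀) h ^ (1 / (2 * (k₀ : ℝ)))) ^ j := by
  have hnn : 0 ≤ ∫ y in a..b, |rho G P h x y| ^ j :=
    intervalIntegral.integral_nonneg hab.le fun y _ => by positivity
  rw [one_div] at hx
  calc _ = ((∫ y in a..b, |rho G P h x y| ^ j) ^ ((j : ℝ)⁻¹)) ^ j :=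
        (Real.rpow_inv_natCast_pow hnn (by omega)).symm
    _ ≤ _ := pow_le_pow_left₀ (Real.rpow_nonneg hnn _) hx j

/-- Normal approximation of the integral of `H_{2 k₀}` of the normalized increments. -/
theorem tendsto_integral_cexp_hermite (hG : IsStationaryGaussian G P)
    (hne : ∃ h, incVar G P h ≠ 0) (hab : a < b) {k₀ : ℕ} (hk₀ : 1 ≤ k₀)
    (hsmall : ∀ j : ℕ, 1 ≤ j → j < 2 * k₀ → ∀ ε : ℝ, 0 < ε → ∀ᶠ h in 𝓝[>] (0 : ℝ), ∀ x ∈ Icc a b,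
      (∫ y in a..b, |rho G P h x y| ^ j) ^ (1 / (j : ℝ)) ≤
        ε * rhoInt G P a b (2 * k₀) h ^ (1 / (2 * (k₀ : ℝ)))) {s : ℝ → ℝ} {v : ℝ}
    (hs : Tendsto (fun h => s h ^ 2 * rhoInt G P a b (2 * k₀) h) (𝓝[>] 0) (𝓝 v)) :
    Tendsto (fun h => ∫ ω, Complex.exp
      ((s h * incFunctional G P (normHermite (2 * k₀)) a b h ω : ℝ) * Complex.I) ∂P) (𝓝[>] 0)
      (𝓝 (Complex.exp (-(v / 2 : ℝ)))) := by
  obtain ⟨p, hp⟩ : ∃ p, 2 * k₀ = p + 1 := ⟨2 * k₀ - 1, by omega⟩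
  obtain ⟨K, hK, hclt⟩ := exists_norm_integral_cexp_integral_sub_le P (p := p)
    (hp ▸ even_two_mul k₀)
  have hexp : Tendsto (fun h => Complex.exp (-(rhoInt G P a b (2 * k₀) h * s h ^ 2 / 2 : ℝ)))
      (𝓝[>] 0) (𝓝 (Complex.exp (-(v / 2 : ℝ)))) := by
    refine (Complex.continuous_exp.tendsto _).comp (((Complex.continuous_ofReal.tendsto _).comp
      ((hs.congr fun h => ?_).div_const 2)).neg)
    exact mul_comm _ _
  suffices hz : Tendsto (fun h => ∫ ω, Complex.exp
      ((s h * incFunctional G P (normHermite (2 * k₀)) a b h ω : ℝ) * Complex.I) ∂P -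
        Complex.exp (-(rhoInt G P a b (2 * k₀) h * s h ^ 2 / 2 : ℝ))) (𝓝[>] 0) (𝓝 0) by
    simpa using hz.add hexp
  rw [Metric.tendsto_nhds]
  intro δ hδ
  -- This bounds the distance of the characteristic functions once `s² V` is below `v + 1`; it
  -- vanishes with `ε`, which is chosen accordingly.
  have hcont : Continuous fun ε : ℝ => (v + 1) * √(K * (p * ε ^ (p + 1))) := by fun_prop
  have hε0 := (hcont.tendsto 0).mono_left (nhdsWithin_le_nhds (s := Ioi 0))
  simp only [ne_eq, Nat.succ_ne_zero, not_false_eq_true, zero_pow, mul_zero, Real.sqrt_zero] at hε0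
  obtain ⟨ε, hεδ, hε⟩ := ((hε0.eventually (gt_mem_nhds hδ)).and self_mem_nhdsWithin).exists
  have hε : 0 < ε := hε
  have hall : ∀ᶠ h in 𝓝[>] (0 : ℝ), ∀ j ∈ Finset.Icc 1 p, ∀ x ∈ Icc a b,
      (∫ y in a..b, |rho G P h x y| ^ j) ^ (1 / (j : ℝ)) ≤
        ε * rhoInt G P a b (2 * k₀) h ^ (1 / (2 * (k₀ : ℝ))) := by
    rw [Finset.eventually_all]
    intro j hj
    rw [Finset.mem_Icc] at hj
    exact hsmall j hj.1 (by omega) ε hε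
  filter_upwards [hall, hG.eventually_incVar_pos hne,
    hs.eventually (gt_mem_nhds (lt_add_one v))] with h hh hpos hsv
  have hV := hG.rhoInt_pos hab hpos (2 * k₀)
  set V := rhoInt G P a b (2 * k₀) h with hVdef
  have hUpow : (V ^ (1 / (2 * (k₀ : ℝ)))) ^ (p + 1) = V := by
    have := Real.rpow_inv_natCast_pow hV.le (n := 2 * k₀) (by omega)
    rw [← hp, one_div]
    push_cast at this
    exact this
  -- The bounds `U q` are the `q`-th powers of one number, so each product `U q * U (p + 1 - q)`
  -- equals `ε^{p+1} V`, whatever `q` is.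
  have hc := hclt _ (hG.isStdGaussian_normIncrement hpos) (hG.measurable_normIncrement_prod h)
    (hG.continuous_corr_normIncrement hpos) a b hab
    (fun j => (ε * V ^ (1 / (2 * (k₀ : ℝ)))) ^ j) (fun q h1 h2 x hx => by
      simp only [corr_normIncrement hpos]
      exact integral_abs_rho_pow_le hab h1 (hh q (Finset.mem_Icc.2 ⟨h1, h2⟩) x hx)) (s h)
  have hsum : ∑ q ∈ Finset.Icc 1 p, (ε * V ^ (1 / (2 * (k₀ : ℝ)))) ^ q *
      (ε * V ^ (1 / (2 * (k₀ : ℝ)))) ^ (p + 1 - q) = p * (ε ^ (p + 1) * V) := by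
    rw [← hUpow, ← mul_pow, hUpow]
    have : ∀ q ∈ Finset.Icc 1 p, (ε * V ^ (1 / (2 * (k₀ : ℝ)))) ^ q *
      (ε * V ^ (1 / (2 * (k₀ : ℝ)))) ^ (p + 1 - q) = (ε * V ^ (1 / (2 * (k₀ : ℝ)))) ^ (p + 1) := by
      intro q hq
      rw [Finset.mem_Icc] at hq
      rw [← pow_add]
      congr 1
      omega
    rw [Finset.sum_congr rfl this]
    simp
  simp only [corr_normIncrement hpos] at hc
  rw [hsum, ← hp] at hc
  have hVr : (∫ x in a..b, ∫ y in a..b, |rho G P h x y| ^ (2 * k₀)) = V := rfl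
  rw [hVr] at hc
  have hsq : √(K * (V * (p * (ε ^ (2 * k₀) * V)))) = V * √(K * (p * ε ^ (2 * k₀))) := by
    rw [show K * (V * (p * (ε ^ (2 * k₀) * V))) = V ^ 2 * (K * (p * ε ^ (2 * k₀))) by ring,
      Real.sqrt_mul (sq_nonneg V), Real.sqrt_sq hV.le]
  rw [hsq, ← mul_assoc] at hc
  rw [dist_zero_right]
  refine hc.trans_lt (lt_of_le_of_lt ?_ hεδ)
  rw [← hp]
  exact mul_le_mul_of_nonneg_right hsv.le (Real.sqrt_nonneg _)

/-- The central limit theorem for functionals of Hermite rank `2 k₀`. -/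
theorem tendstoInDistribution_incFunctional (hG : IsStationaryGaussian G P)
    (hne : ∃ h, incVar G P h ≠ 0) (hab : a < b) (hf : MemLp f 2 (gaussianReal 0 1))
    {k₀ : ℕ} (hk₀ : 1 ≤ k₀) (ha : hermiteCoeff f (2 * k₀) ≠ 0) {N : ℕ}
    (h0 : ∀ n, 0 < n → n < N → n ≠ 2 * k₀ → hermiteCoeff f n = 0)
    (hratio : Tendsto (fun h => rhoInt G P a b N h / rhoInt G P a b (2 * k₀) h) (𝓝[>] 0) (𝓝 0))
    (hsmall : ∀ j : ℕ, 1 ≤ j → j < 2 * k₀ → ∀ ε : ℝ, 0 < ε → ∀ᶠ h in 𝓝[>] (0 : ℝ), ∀ x ∈ Icc a b,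
      (∫ y in a..b, |rho G P h x y| ^ j) ^ (1 / (j : ℝ)) ≤
        ε * rhoInt G P a b (2 * k₀) h ^ (1 / (2 * (k₀ : ℝ)))) :
    TendstoInDistribution
      (fun (h : ℝ) (ω : Ω) => (incFunctional G P f a b h ω -
        (b - a) * ∫ x, f x ∂(gaussianReal 0 1)) / √(variance (incFunctional G P f a b h) P))
      (𝓝[>] 0) (id : ℝ → ℝ) (fun _ => P) (gaussianReal 0 1) := by
  have hI := fun h => hG.memLp_incFunctional hab hf h
  have hk : 2 * k₀ ≠ 0 := by omega
  refine tendstoInDistribution_gaussian_of_integral_cexp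
    (fun h => ((hI h).aemeasurable.sub_const _).div_const _) fun t => ?_
  set α := hermiteCoeff f (2 * k₀)
  set D := fun h => variance (incFunctional G P f a b h) P
  set V := fun h => rhoInt G P a b (2 * k₀) h
  set W := fun h => rhoInt G P a b N h
  set C := ∫ u, (f u - hermiteCoeff f 0 * normHermite 0 u - α * normHermite (2 * k₀) u) ^ 2
    ∂(gaussianReal 0 1)
  have hpos := hG.eventually_incVar_pos hne
  have hVpos : ∀ᶠ h in 𝓝[>] (0 : ℝ), 0 < V h := by
    filter_upwards [hpos] with h hh using hG.rhoInt_pos hab hh _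
  have hvar : Tendsto (fun h => D h / (α ^ 2 * V h)) (𝓝[>] 0) (𝓝 1) :=
    hG.tendsto_variance_div hne hab hf hk (even_two_mul k₀) ha h0 hratio
  have hDpos : ∀ᶠ h in 𝓝[>] (0 : ℝ), 0 < D h := by
    filter_upwards [hvar.eventually (lt_mem_nhds zero_lt_one), hVpos] with h h1 h2
    have h3 : 0 < α ^ 2 * V h := by positivity
    exact (div_pos_iff_of_pos_right h3).1 h1
  have hVD : Tendsto (fun h => V h / D h) (𝓝[>] 0) (𝓝 (α ^ 2)⁻¹) := by
    have := (hvar.inv₀ one_ne_zero).const_mul (α ^ 2)⁻¹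
    rw [inv_one, mul_one] at this
    refine this.congr' ?_
    filter_upwards [hDpos, hVpos] with h h1 h2
    field_simp
  have hWD : Tendsto (fun h => W h / D h) (𝓝[>] 0) (𝓝 0) := by
    have := hratio.mul hVD
    rw [zero_mul] at this
    refine this.congr' ?_
    filter_upwards [hDpos, hVpos] with h h1 h2
    have h2' : rhoInt G P a b (2 * k₀) h ≠ 0 := h2.ne'
    simp only [W, V]
    field_simp
  -- The scaling `s = t α / √D` gives `s² V = t² α² V / D`, which tends to `t²` because the variance
  -- `D` is asymptotic to `α² V`.
  have hmain := hG.tendsto_integral_cexp_hermite hne hab hk₀ hsmall (s := fun h => t * α / √(D h))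
    (v := t ^ 2) (by
      have := hVD.const_mul (t ^ 2 * α ^ 2)
      rw [mul_assoc, mul_inv_cancel₀ (pow_ne_zero 2 ha), mul_one] at this
      refine this.congr' ?_
      filter_upwards [hDpos] with h h1
      rw [div_pow, Real.sq_sqrt h1.le]
      ring)
  -- Replacing the functional by its Hermite term changes the characteristic function by at most
  -- `|t| √(C W / D)`, and `W / D` tends to `0`.
  refine (tendsto_iff_norm_sub_tendsto_zero.2 ?_ : Tendsto (fun h => (_ : ℂ) - _) _ (𝓝 0)).add
    hmain |>.congr (fun h => sub_add_cancel _ _) |>.trans (by rw [zero_add])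
  have hlim : Tendsto (fun h => |t| * √(C * (W h / D h))) (𝓝[>] 0) (𝓝 0) := by
    simpa using ((hWD.const_mul C).sqrt).const_mul |t|
  simp only [sub_zero]
  refine squeeze_zero' (Eventually.of_forall fun h => norm_nonneg _) ?_ hlim
  filter_upwards [hpos, hDpos] with h h1 h2
  have hF := hG.memLp_incFunctional hab (memLp_normHermite (2 * k₀)) h
  have hb := norm_integral_cexp_sub_le (P := P)
    (F := fun ω => (incFunctional G P f a b h ω - (b - a) * ∫ x, f x ∂(gaussianReal 0 1)) / √(D h))
    (F' := fun ω => α * incFunctional G P (normHermite (2 * k₀)) a b h ω / √(D h))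
    ((((hI h).integrable (by norm_num)).sub (integrable_const _)).div_const _)
    (((hF.integrable (by norm_num)).const_mul _).div_const _) t
  have e : ∀ ω, t * (α * incFunctional G P (normHermite (2 * k₀)) a b h ω / √(D h)) =
      t * α / √(D h) * incFunctional G P (normHermite (2 * k₀)) a b h ω := fun ω => by ring
  simp only [e] at hb
  refine hb.trans (mul_le_mul_of_nonneg_left ?_ (abs_nonneg t))
  simp only [← sub_div, abs_div, abs_of_nonneg (Real.sqrt_nonneg (D h))]
  rw [integral_div, mul_div_assoc', Real.sqrt_div' _ h2.le]
  exact div_le_div_of_nonneg_right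
    (hG.integral_abs_incFunctional_sub_le hab hf hk h0 h1) (Real.sqrt_nonneg _)

end IsStationaryGaussian

/-- Odd coefficients vanish by symmetry, positive even ones below `2 k₀` by minimality. As `2 k₀ +
1` is odd, the remainder starts at `2 k₀ + 2`, the exponent in the ratio hypothesis. -/
theorem hermiteCoeff_eq_zero_of_isLeast {f : ℝ → ℝ} (hf : Function.Even f) {k₀ : ℕ}
    (hk₀ : IsLeast {m : ℕ | 1 ≤ m ∧ hermiteCoeff f (2 * m) ≠ 0} k₀) (n : ℕ) (hpos : 0 < n)
    (hlt : n < 2 * k₀ + 2) (hne : n ≠ 2 * k₀) : hermiteCoeff f n = 0 := by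
  rcases Nat.even_or_odd' n with ⟨m, rfl | rfl⟩
  · by_contra hm
    have := hk₀.2 ⟨by omega, hm⟩
    omega
  · exact hermiteCoeff_of_odd hf (odd_two_mul_add_one m)

end GaussianIncrements

/-! ### Variance asymptotics and central limit theorem -/

theorem lemma2p2 {Ω : Type*} [MeasurableSpace Ω] (P : Measure Ω) [IsProbabilityMeasure P]
    (G : ℝ → Ω → ℝ)
    -- `G` is a (jointly measurable) mean zero Gaussian process with stationary increments
    (hGmeas : Measurable (fun p : ℝ × Ω => G p.1 p.2))
    (hGauss : IsGaussianProcess G P)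
    (hGmean : ∀ x : ℝ, ∫ ω, G x ω ∂P = 0)
    (hGstat : GaussianIncrements.HasStationaryIncrements G P)
    (hGnontriv : ∃ h : ℝ, GaussianIncrements.incVar G P h ≠ 0)
    (a b : ℝ) (hab : a < b)
    -- `f` is symmetric and square integrable for the standard Gaussian measure
    (f : ℝ → ℝ) (hfL2 : MemLp f 2 (gaussianReal 0 1)) (hfsymm : Function.Even f)
    -- `k₀` is the first index `m ≥ 1` with `a_{2m} ≠ 0`
    (k₀ : ℕ)
    (hk₀ : IsLeast {m : ℕ | 1 ≤ m ∧ GaussianIncrements.hermiteCoeff f (2 * m) ≠ 0} k₀)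
    (hratio : Tendsto
      (fun h : ℝ => GaussianIncrements.rhoInt G P a b (2 * k₀ + 2) h /
        GaussianIncrements.rhoInt G P a b (2 * k₀) h) (𝓝[>] 0) (𝓝 0)) :
    Tendsto
      (fun h : ℝ => variance (GaussianIncrements.incFunctional G P f a b h) P /
        (GaussianIncrements.hermiteCoeff f (2 * k₀) ^ 2 *
          GaussianIncrements.rhoInt G P a b (2 * k₀) h)) (𝓝[>] 0) (𝓝 1) ∧
    -- the central limit theorem, for kernels that satisfy the two conditions under which
    -- it holds for the single Hermite term of order `2 k₀`
    ((∃ C : ℝ, ∀ᶠ h in 𝓝[>] (0 : ℝ), ∀ x ∈ Icc a b,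
        (∫ y in a..b, |GaussianIncrements.rho G P h x y| ^ (2 * k₀)) ≤
          C * GaussianIncrements.rhoInt G P a b (2 * k₀) h) →
      (∀ j : ℕ, 1 ≤ j → j < 2 * k₀ → ∀ ε : ℝ, 0 < ε →
        ∀ᶠ h in 𝓝[>] (0 : ℝ), ∀ x ∈ Icc a b,
          (∫ y in a..b, |GaussianIncrements.rho G P h x y| ^ j) ^ (1 / (j : ℝ)) ≤
            ε * GaussianIncrements.rhoInt G P a b (2 * k₀) h ^ (1 / (2 * (k₀ : ℝ)))) →
      TendstoInDistribution
        (fun (h : ℝ) (ω : Ω) =>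
          (GaussianIncrements.incFunctional G P f a b h ω -
              (b - a) * ∫ x, f x ∂(gaussianReal 0 1)) /
            √(variance (GaussianIncrements.incFunctional G P f a b h) P))
        (𝓝[>] 0) (id : ℝ → ℝ) (fun _ => P) (gaussianReal 0 1)) := by
  have hG : GaussianIncrements.IsStationaryGaussian G P := ⟨hGmeas, hGauss, hGmean, hGstat⟩
  have h0 := GaussianIncrements.hermiteCoeff_eq_zero_of_isLeast hfsymm hk₀
  refine ⟨hG.tendsto_variance_div hGnontriv hab hfL2 (by have := hk₀.1.1; omega)
    (even_two_mul k₀) hk₀.1.2 h0 hratio, fun _ hsmall => ?_⟩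
  exact hG.tendstoInDistribution_incFunctional hGnontriv hab hfL2 hk₀.1.1 hk₀.1.2 h0 hratio hsmall
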